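/- Let $\Bbbk$ be an algebraically closed field of any characteristic. A strict composition is a finite (possibly empty) sequence $\lambda=(\lambda_1,\dots,\lambda_{\ell(\lambda)})$ of positive integers. For strict compositions $\lambda,\mu$, let $\mathrm{Mat}_{\lambda,\mu}$ be the set of $\ell(\lambda)\times\ell(\mu)$ matrices with non-negative integer entries, with $i$th row sum $\lambda_i$ and $j$th column sum $\mu_j$ for all $i,j$ (so it is empty unless $\sum_i\lambda_i=\sum_j\mu_j$). **The Schur category** $\mathcal{S}chur$ is the strict $\Bbbk$-linear monoidal category whose objects are the strict compositions, with tensor product given by concatenation and unit object the empty composition; $\operatorname{Hom}(\mu,\lambda)$ is the vector space with basis $\{\xi_A : A\in\mathrm{Mat}_{\lambda,\mu}\}$; the tensor product of morphisms is given by $\xi_A\otimes\xi_B=\xi_{\operatorname{diag}(A,B)}$; and composition is given by Schur's product rule $\xi_A\circ\xi_B=\sum_{C\in\mathrm{Mat}_{\lambda,\nu}} Z(A,B,C)\,\xi_C$ for $A\in \mathrm{Mat}_{\lambda,\mu}$, $B\in\mathrm{Mat}_{\mu,\nu}$. Here, with $d=\sum_i\lambda_i$, we fix $d$-tuples $\boldsymbol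 i,\boldsymbol k$ such that $\#\{r : (i_r,k_r)=(a,b)\}=c_{a,b}$ for all $a,b$, and $Z(A,B,C)$ is the number of $d$-tuples $\boldsymbol j$ such that $\#\{r:(i_r,j_r)=(a,b)\}=a_{a,b}$ and $\#\{r:(j_r,k_r)=(a,b)\}=b_{a,b}$ for all $a,b$ (entries of $A$ and $B$, respectively). **The polynomial web category** $\mathcal{W}eb$ is the strict $\Bbbk$-linear monoidal category with the same objects and the same tensor product of objects, generated by the morphisms $$m_{a,b}:(a,b)\to(a+b)\ \text{(merge)},\qquad s_{a,b}:(a+b)\to(a,b)\ \text{(split)},\qquad x_{a,b}:(a,b)\to(b,a)\ \text{(thick crossing)}$$ for $a,b>0$, subject to the following relations for $a,b,c,d>0$: * (associativity) $m_{a+b,c}\circ(m_{a,b}\otimes 1_{(c)})=m_{a,b+c}\circ(1_{(a)}\otimes m_{b,c})$ and $(s_{a,b}\otimes 1_{(c)})\circ s_{a+b,c}=(1_{(a)}\otimes s_{b,c})\circ s_{a,b+c}$; * (digon) $m_{a,b}\circ s_{a,b}=\binom{a+b}{a}1_{(a+b)}$; * (merge-split) if $a+c=b+d$ then $$s_{b,d}\circ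 m_{a,c}=\sum_{\substack{0\le s\le\min(a,b)\\ 0\le t\le\min(c,d)\\ t-s=d-a}}(m_{s,c-t}\otimes m_{a-s,t})\circ(1_{(s)}\otimes x_{a-s,c-t}\otimes 1_{(t)})\circ(s_{s,a-s}\otimes s_{c-t,t}),$$ where strings of thickness zero are omitted: $(0)$ is the unit object, and merges, splits and crossings with an index $0$ are identity morphisms. By associativity there are $n$-fold merges and splits for all $n\ge1$ (the identity if $n=1$). A **chicken foot diagram** from $\mu$ to $\lambda$ is a diagram in which the strings of thicknesses $\mu_1,\mu_2,\dots$ at the bottom split into thinner strings by $n$-fold splits, the thinner strings then cross each other by a sequence of thick crossings of neighbouring strings, and finally they merge by $n$-fold merges into the strings of thicknesses $\lambda_1,\lambda_2,\dots$ at the top. It defines a morphism in $\operatorname{Hom}_{\mathcal{W}eb}(\mu,\lambda)$. It is **reduced** if each pair of distinct thinner strings intersects or joins at most once: the number of crossings of the two strings, plus one if they start at the same bottom vertex, plus one if they end at the same top vertex, is at most one. In particular, at most one thinner string connects the $i$th vertex at the top to the $j$th vertex at the bottom. The **type** of a reduced chicken foot diagram is the matrix $A\in\mathrm{Mat}_{\lambda,\mu}$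 whose $(i,j)$-entry is the thickness of the string connecting the $i$th vertex at the top to the $j$th vertex at the bottom, or zero if there is none. **Theorem.** Every $A\in\mathrm{Mat}_{\lambda,\mu}$ is the type of some reduced chicken foot diagram from $\mu$ to $\lambda$, and there is an isomorphism of $\Bbbk$-linear strict monoidal categories $$F:\mathcal{W}eb\stackrel{\sim}{\longrightarrow}\mathcal{S}chur$$ which is the identity on objects and sends the morphism in $\operatorname{Hom}_{\mathcal{W}eb}(\mu,\lambda)$ defined by any reduced chicken foot diagram of type $A\in\mathrm{Mat}_{\lambda,\mu}$ to $\xi_A$. In particular, for all $a,b>0$, $$F(m_{a,b})=\xi_{\left(\begin{smallmatrix}a&b\end{smallmatrix}\right)},\qquad F(s_{a,b})=\xi_{\left(\begin{smallmatrix}a\\b\end{smallmatrix}\right)},\qquad F(x_{a,b})=\xi_{\left(\begin{smallmatrix}0&b\\a&0\end{smallmatrix}\right)}.$$ -/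

import Mathlib

universe u

open CategoryTheory MonoidalCategory

namespace SchurWeb

/-- A strict composition: a finite sequence of positive integers. -/
abbrev Comp : Type := List ℕ+

/-- Transport of an element of a doubly indexed family along equalities of the indices. -/
def castHom {H : Comp → Comp → Type u} {X X' Y Y' : Comp} (hX : X = X') (hY : Y = Y')
    (f : H X Y) : H X' Y' :=
  cast (congrArg₂ H hX hY) f

/-- A strict `k`-linear monoidal category whose monoid of objects is the monoid of strict
compositions under concatenation, with unit the empty composition. -/
structure CompCat (k : Type u) [CommRing k] where
  Hom : Comp → Comp → Type u
  [addCommGroup : ∀ X Y, AddCommGroup (Hom X Y)]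
  [module : ∀ X Y, Module k (Hom X Y)]
  id : ∀ X, Hom X X
  comp : ∀ {X Y Z}, Hom X Y → Hom Y Z → Hom X Z
  tensor : ∀ {X Y X' Y'}, Hom X Y → Hom X' Y' → Hom (X ++ X') (Y ++ Y')
  id_comp : ∀ {X Y} (f : Hom X Y), comp (id X) f = f
  comp_id : ∀ {X Y} (f : Hom X Y), comp f (id Y) = f
  assoc : ∀ {X Y Z W} (f : Hom X Y) (g : Hom Y Z) (h : Hom Z W),
    comp (comp f g) h = comp f (comp g h)
  add_comp : ∀ {X Y Z} (f f' : Hom X Y) (g : Hom Y Z),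
    comp (f + f') g = comp f g + comp f' g
  comp_add : ∀ {X Y Z} (f : Hom X Y) (g g' : Hom Y Z),
    comp f (g + g') = comp f g + comp f g'
  smul_comp : ∀ {X Y Z} (r : k) (f : Hom X Y) (g : Hom Y Z),
    comp (r • f) g = r • comp f g
  comp_smul : ∀ {X Y Z} (r : k) (f : Hom X Y) (g : Hom Y Z),
    comp f (r • g) = r • comp f g
  id_tensor_id : ∀ X Y, tensor (id X) (id Y) = id (X ++ Y)
  interchange : ∀ {X Y Z X' Y' Z'} (f : Hom X Y) (g : Hom Y Z) (f' : Hom X' Y')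
    (g' : Hom Y' Z'), comp (tensor f f') (tensor g g') = tensor (comp f g) (comp f' g')
  tensor_assoc : ∀ {X Y X' Y' X'' Y''} (f : Hom X Y) (f' : Hom X' Y') (f'' : Hom X'' Y''),
    castHom (List.append_assoc X X' X'') (List.append_assoc Y Y' Y'')
      (tensor (tensor f f') f'') = tensor f (tensor f' f'')
  unit_tensor : ∀ {X Y} (f : Hom X Y), tensor (id []) f = f
  tensor_unit : ∀ {X Y} (f : Hom X Y),
    castHom (List.append_nil X) (List.append_nil Y) (tensor f (id [])) = f
  add_tensor : ∀ {X Y X' Y'} (f g : Hom X Y) (f' : Hom X' Y'),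
    tensor (f + g) f' = tensor f f' + tensor g f'
  tensor_add : ∀ {X Y X' Y'} (f : Hom X Y) (f' g' : Hom X' Y'),
    tensor f (f' + g') = tensor f f' + tensor f g'
  smul_tensor : ∀ {X Y X' Y'} (r : k) (f : Hom X Y) (f' : Hom X' Y'),
    tensor (r • f) f' = r • tensor f f'
  tensor_smul : ∀ {X Y X' Y'} (r : k) (f : Hom X Y) (f' : Hom X' Y'),
    tensor f (r • f') = r • tensor f f'

namespace CompCat

variable {k : Type u} [CommRing k]

attribute [instance] addCommGroup module

/-- The type of objects, carrying the category structure. -/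
def Obj (_S : CompCat k) : Type := Comp

/-- A strict composition as an object. -/
def of (S : CompCat k) (X : Comp) : S.Obj := X

variable (S : CompCat k)

instance : Category.{u} S.Obj where
  Hom X Y := S.Hom X Y
  id X := S.id X
  comp f g := S.comp f g
  id_comp := S.id_comp
  comp_id := S.comp_id
  assoc := S.assoc

/-- An element of a morphism space, as a morphism. -/
def hom {X Y : Comp} (f : S.Hom X Y) : S.of X ⟶ S.of Y := f

instance : Preadditive S.Obj where
  homGroup X Y := S.addCommGroup X Y
  add_comp _ _ _ f f' g := S.add_comp f f' g
  comp_add _ _ _ f g g' := S.comp_add f g g'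

instance : Linear k S.Obj where
  homModule X Y := S.module X Y
  smul_comp _ _ _ r f g := S.smul_comp r f g
  comp_smul _ _ _ f r g := S.comp_smul r f g

instance : MonoidalCategoryStruct S.Obj where
  tensorObj X Y := List.append X Y
  tensorUnit := ([] : Comp)
  tensorHom f g := S.tensor f g
  whiskerLeft X _ _ f := S.tensor (S.id X) f
  whiskerRight f Y := S.tensor f (S.id Y)
  associator X Y Z := eqToIso (List.append_assoc (α := ℕ+) X Y Z)
  leftUnitor X := eqToIso (List.nil_append (α := ℕ+) X)
  rightUnitor X := eqToIso (List.append_nil (α := ℕ+) X)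

theorem obj_assoc (X Y Z : S.Obj) : (X ⊗ Y) ⊗ Z = X ⊗ (Y ⊗ Z) :=
  List.append_assoc (α := ℕ+) X Y Z

theorem obj_unit_tensor (X : S.Obj) : 𝟙_ S.Obj ⊗ X = X := List.nil_append (α := ℕ+) X

theorem obj_tensor_unit (X : S.Obj) : X ⊗ 𝟙_ S.Obj = X := List.append_nil (α := ℕ+) X

theorem castHom_eq {X X' Y Y' : S.Obj} (hX : X = X') (hY : Y = Y') (f : X ⟶ Y) :
    (castHom (H := S.Hom) hX hY f : X' ⟶ Y') = eqToHom hX.symm ≫ f ≫ eqToHom hY := by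
  subst hX hY
  simp [castHom]

theorem tensorHom_eqToHom_id {X X' : S.Obj} (h : X = X') (Y : S.Obj) :
    (eqToHom h ⊗ₘ 𝟙 Y) = eqToHom (congrArg (fun Z : S.Obj => Z ⊗ Y) h) := by
  subst h
  exact S.id_tensor_id _ _

theorem tensorHom_id_eqToHom {X X' : S.Obj} (h : X = X') (Y : S.Obj) :
    (𝟙 Y ⊗ₘ eqToHom h) = eqToHom (congrArg (fun Z : S.Obj => Y ⊗ Z) h) := by
  subst h
  exact S.id_tensor_id _ _

instance : MonoidalCategory S.Obj := MonoidalCategory.ofTensorHom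
  (id_tensorHom_id := fun X Y => S.id_tensor_id X Y)
  (id_tensorHom := fun _ _ _ _ => rfl)
  (tensorHom_id := fun _ _ => rfl)
  (tensorHom_comp_tensorHom := fun f f' g g' => S.interchange f g f' g')
  (associator_naturality := by
    intro X X' X'' Y Y' Y'' f f' f''
    have h3 : (f ⊗ₘ (f' ⊗ₘ f'')) = eqToHom (S.obj_assoc X X' X'').symm ≫
        ((f ⊗ₘ f') ⊗ₘ f'') ≫ eqToHom (S.obj_assoc Y Y' Y'') :=
      (S.tensor_assoc f f' f'').symm.trans
        (S.castHom_eq (S.obj_assoc X X' X'') (S.obj_assoc Y Y' Y'') ((f ⊗ₘ f') ⊗ₘ f''))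
    change ((f ⊗ₘ f') ⊗ₘ f'') ≫ eqToHom (S.obj_assoc Y Y' Y'') =
      eqToHom (S.obj_assoc X X' X'') ≫ (f ⊗ₘ (f' ⊗ₘ f''))
    rw [h3]
    simp only [eqToHom_trans_assoc, eqToHom_refl, Category.id_comp])
  (leftUnitor_naturality := by
    intro X Y f
    exact (S.comp_id _).trans ((S.unit_tensor f).trans (S.id_comp f).symm))
  (rightUnitor_naturality := by
    intro X Y f
    have h3 : f = eqToHom (S.obj_tensor_unit X).symm ≫ (f ⊗ₘ 𝟙 (𝟙_ S.Obj))
        ≫ eqToHom (S.obj_tensor_unit Y) :=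
      (S.tensor_unit f).symm.trans
        (S.castHom_eq (S.obj_tensor_unit X) (S.obj_tensor_unit Y) (f ⊗ₘ 𝟙 (𝟙_ S.Obj)))
    change (f ⊗ₘ 𝟙 (𝟙_ S.Obj)) ≫ eqToHom (S.obj_tensor_unit Y) =
      eqToHom (S.obj_tensor_unit X) ≫ f
    conv_rhs => rw [h3]
    simp only [eqToHom_trans_assoc, eqToHom_refl, Category.id_comp])
  (pentagon := by
    intro W X Y Z
    change (eqToHom (S.obj_assoc W X Y) ⊗ₘ 𝟙 Z) ≫ eqToHom (S.obj_assoc W (X ⊗ Y) Z) ≫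
      (𝟙 W ⊗ₘ eqToHom (S.obj_assoc X Y Z)) =
      eqToHom (S.obj_assoc (W ⊗ X) Y Z) ≫ eqToHom (S.obj_assoc W X (Y ⊗ Z))
    rw [tensorHom_eqToHom_id, tensorHom_id_eqToHom]
    simp only [eqToHom_trans])
  (triangle := by
    intro X Y
    change eqToHom (S.obj_assoc X (𝟙_ S.Obj) Y) ≫ (𝟙 X ⊗ₘ eqToHom (S.obj_unit_tensor Y)) =
      (eqToHom (S.obj_tensor_unit X) ⊗ₘ 𝟙 Y)
    rw [tensorHom_eqToHom_id, tensorHom_id_eqToHom]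
    simp only [eqToHom_trans])

theorem tensor_zero' {X Y X' Y' : Comp} (f : S.Hom X Y) :
    S.tensor f (0 : S.Hom X' Y') = 0 := by
  have := S.tensor_smul 0 f (0 : S.Hom X' Y')
  simpa using this

theorem zero_tensor' {X Y X' Y' : Comp} (f : S.Hom X Y) :
    S.tensor (0 : S.Hom X' Y') f = 0 := by
  have := S.smul_tensor 0 (0 : S.Hom X' Y') f
  simpa using this

instance : MonoidalPreadditive S.Obj where
  whiskerLeft_zero := S.tensor_zero' _
  zero_whiskerRight := S.zero_tensor' _
  whiskerLeft_add f g := S.tensor_add _ f g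
  add_whiskerRight f g := S.add_tensor f g _

instance : MonoidalLinear k S.Obj where
  whiskerLeft_smul _ _ _ r f := S.tensor_smul r _ f
  smul_whiskerRight r _ _ f _ := S.smul_tensor r f _

end CompCat

/-- A monoidal category is strict if the tensor product of objects is strictly associative and
unital and the associators and unitors are identities. -/
structure IsStrict (C : Type*) [Category* C] [MonoidalCategory C] : Prop where
  tensor_assoc : ∀ X Y Z : C, (X ⊗ Y) ⊗ Z = X ⊗ (Y ⊗ Z)
  unit_tensor : ∀ X : C, 𝟙_ C ⊗ X = X
  tensor_unit : ∀ X : C, X ⊗ 𝟙_ C = X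
  associator_hom : ∀ X Y Z : C, (α_ X Y Z).hom = eqToHom (tensor_assoc X Y Z)
  leftUnitor_hom : ∀ X : C, (λ_ X).hom = eqToHom (unit_tensor X)
  rightUnitor_hom : ∀ X : C, (ρ_ X).hom = eqToHom (tensor_unit X)

theorem CompCat.isStrict {k : Type u} [CommRing k] (S : CompCat k) : IsStrict S.Obj where
  tensor_assoc := S.obj_assoc
  unit_tensor := S.obj_unit_tensor
  tensor_unit := S.obj_tensor_unit
  associator_hom _ _ _ := rfl
  leftUnitor_hom _ := rfl
  rightUnitor_hom _ := rfl

/-- A functor between strict monoidal categories is strict monoidal if it preserves the unit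
object and the tensor products of objects and of morphisms on the nose. -/
structure IsStrictMonoidal {C D : Type*} [Category* C] [MonoidalCategory C] [Category* D]
    [MonoidalCategory D] (F : C ⥤ D) : Prop where
  obj_unit : F.obj (𝟙_ C) = 𝟙_ D
  obj_tensor : ∀ X Y : C, F.obj (X ⊗ Y) = F.obj X ⊗ F.obj Y
  map_tensor : ∀ {X Y X' Y' : C} (f : X ⟶ Y) (f' : X' ⟶ Y'),
    F.map (f ⊗ₘ f') =
      eqToHom (obj_tensor X X') ≫ (F.map f ⊗ₘ F.map f') ≫ eqToHom (obj_tensor Y Y').symm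

/-- An isomorphism of `k`-linear strict monoidal categories: a `k`-linear strict monoidal functor
with a two-sided inverse functor (which is then automatically `k`-linear and strict monoidal). -/
structure IsStrictMonoidalIso (k : Type*) [CommRing k] {C D : Type*} [Category* C]
    [Preadditive C] [Linear k C] [MonoidalCategory C] [Category* D] [Preadditive D] [Linear k D]
    [MonoidalCategory D] (F : C ⥤ D) : Prop where
  strictMonoidal : IsStrictMonoidal F
  additive : F.Additive
  linear : F.Linear k
  exists_inverse : ∃ G : D ⥤ C, F ⋙ G = 𝟭 C ∧ G ⋙ F = 𝟭 D

/-! The web category -/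

/-- Formal expressions for morphisms of the web category: `k`-linear combinations of diagrams
built from merges, splits and thick crossings by composition (`comp f g` is `f` followed by `g`,
with `g` drawn on top of `f`) and by horizontal juxtaposition. -/
inductive Term (k : Type u) : Comp → Comp → Type u
  | id (X : Comp) : Term k X X
  | comp {X Y Z : Comp} (f : Term k X Y) (g : Term k Y Z) : Term k X Z
  | tensor {X Y X' Y' : Comp} (f : Term k X Y) (f' : Term k X' Y') :
      Term k (X ++ X') (Y ++ Y')
  | zero {X Y : Comp} : Term k X Y
  | add {X Y : Comp} (f g : Term k X Y) : Term k X Y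
  | smul {X Y : Comp} (r : k) (f : Term k X Y) : Term k X Y
  | merge (a b : ℕ+) : Term k [a, b] [a + b]
  | split (a b : ℕ+) : Term k [a + b] [a, b]
  | cross (a b : ℕ+) : Term k [a, b] [b, a]

namespace Term

variable {k : Type u}

/-- A string of thickness `n`, where a string of thickness zero is invisible. -/
def strand : ℕ → Comp
  | 0 => []
  | n + 1 => [n.succPNat]

/-- The split of a string of thickness `x = s + t` into strings of thicknesses `s` and `t`,
which is the identity if `s = 0` or `t = 0`. -/
def splitZ : (s t : ℕ) → (x : ℕ+) → s + t = (x : ℕ) → Term k [x] (strand s ++ strand t)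
  | 0, 0, x, h => absurd h (Nat.ne_of_lt x.pos)
  | 0, t + 1, x, h =>
      castHom rfl (congrArg (fun y => [y]) (PNat.eq (by simpa using h.symm))) (id [x])
  | s + 1, 0, x, h =>
      castHom rfl (congrArg (fun y => [y]) (PNat.eq (by simpa using h.symm))) (id [x])
  | s + 1, t + 1, x, h =>
      castHom (congrArg (fun y => [y]) (PNat.eq (by simpa using h))) rfl
        (split s.succPNat t.succPNat)

/-- The merge of strings of thicknesses `s` and `t` into a string of thickness `x = s + t`,
which is the identity if `s = 0` or `t = 0`. -/
def mergeZ : (s t : ℕ) → (x : ℕ+) → s + t = (x : ℕ) → Term k (strand s ++ strand t) [x]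
  | 0, 0, x, h => absurd h (Nat.ne_of_lt x.pos)
  | 0, t + 1, x, h =>
      castHom (congrArg (fun y => [y]) (PNat.eq (by simpa using h.symm))) rfl (id [x])
  | s + 1, 0, x, h =>
      castHom (congrArg (fun y => [y]) (PNat.eq (by simpa using h.symm))) rfl (id [x])
  | s + 1, t + 1, x, h =>
      castHom rfl (congrArg (fun y => [y]) (PNat.eq (by simpa using h)))
        (merge s.succPNat t.succPNat)

/-- The crossing of strings of thicknesses `s` and `t`, which is the identity if `s = 0` or
`t = 0`. -/
def crossZ : (s t : ℕ) → Term k (strand s ++ strand t) (strand t ++ strand s)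
  | 0, 0 => id []
  | 0, t + 1 => id [t.succPNat]
  | s + 1, 0 => id [s.succPNat]
  | s + 1, t + 1 => cross s.succPNat t.succPNat

/-- The diagram with bottom `(a, c)` and top `(b, d)` in which `a` splits into strings of
thicknesses `s, u`, and `c` splits into strings of thicknesses `v, t`, then `u` and `v` cross,
then `s, v` merge to `b`, and `u, t` merge to `d`. -/
def ladder (a b c d : ℕ+) (s u v t : ℕ) (ha : s + u = (a : ℕ)) (hc : v + t = (c : ℕ))
    (hb : s + v = (b : ℕ)) (hd : u + t = (d : ℕ)) : Term k [a, c] [b, d] :=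
  comp (tensor (splitZ s u a ha) (splitZ v t c hc)) <|
  comp (castHom (by simp) (by simp)
    (tensor (id (strand s)) (tensor (crossZ u v) (id (strand t))))) <|
  tensor (mergeZ s v b hb) (mergeZ u t d hd)

/-- The diagram on the right hand side of the merge-split relation labelled by `s` and `t`, if
`s ≤ min a b`, `t ≤ min c d` and `t - s = d - a`; otherwise zero. -/
def ladderST (a b c d : ℕ+) (h : a + c = b + d) (s t : ℕ) : Term k [a, c] [b, d] :=
  if hst : s ≤ min (a : ℕ) b ∧ t ≤ min (c : ℕ) d ∧ t + (a : ℕ) = s + (d : ℕ) then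
    ladder a b c d s (a - s) (c - t) t (by omega) (by omega)
      (by have := congrArg PNat.val h; simp only [PNat.add_coe] at this; omega) (by omega)
  else zero

/-- A finite sum of expressions. -/
def sum {X Y : Comp} : List (Term k X Y) → Term k X Y
  | [] => zero
  | f :: l => add f (sum l)

/-- The sum on the right hand side of the merge-split relation. -/
def ladderSum (a b c d : ℕ+) (h : a + c = b + d) : Term k [a, c] [b, d] :=
  sum ((List.range (min (a : ℕ) b + 1)).flatMap fun s =>
    (List.range (min (c : ℕ) d + 1)).map fun t => ladderST a b c d h s t)

/-- The smallest congruence on expressions containing the axioms of strict `k`-linear monoidal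
categories and the defining relations of the web category. -/
inductive Rel [CommRing k] : {X Y : Comp} → Term k X Y → Term k X Y → Prop
  -- equivalence relation
  | refl {X Y} (f : Term k X Y) : Rel f f
  | symm {X Y} {f g : Term k X Y} : Rel f g → Rel g f
  | trans {X Y} {f g h : Term k X Y} : Rel f g → Rel g h → Rel f h
  -- congruence
  | comp_congr {X Y Z} {f f' : Term k X Y} {g g' : Term k Y Z} :
      Rel f f' → Rel g g' → Rel (comp f g) (comp f' g')
  | tensor_congr {X Y X' Y'} {f g : Term k X Y} {f' g' : Term k X' Y'} :
      Rel f g → Rel f' g' → Rel (tensor f f') (tensor g g')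
  | add_congr {X Y} {f f' g g' : Term k X Y} : Rel f f' → Rel g g' → Rel (add f g) (add f' g')
  | smul_congr {X Y} (r : k) {f f' : Term k X Y} : Rel f f' → Rel (smul r f) (smul r f')
  -- module axioms
  | add_assoc {X Y} (f g h : Term k X Y) : Rel (add (add f g) h) (add f (add g h))
  | add_comm {X Y} (f g : Term k X Y) : Rel (add f g) (add g f)
  | zero_add {X Y} (f : Term k X Y) : Rel (add zero f) f
  | one_smul {X Y} (f : Term k X Y) : Rel (smul 1 f) f
  | mul_smul {X Y} (r s : k) (f : Term k X Y) : Rel (smul (r * s) f) (smul r (smul s f))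
  | smul_add {X Y} (r : k) (f g : Term k X Y) :
      Rel (smul r (add f g)) (add (smul r f) (smul r g))
  | add_smul {X Y} (r s : k) (f : Term k X Y) :
      Rel (smul (r + s) f) (add (smul r f) (smul s f))
  | zero_smul {X Y} (f : Term k X Y) : Rel (smul 0 f) zero
  -- category axioms
  | id_comp {X Y} (f : Term k X Y) : Rel (comp (id X) f) f
  | comp_id {X Y} (f : Term k X Y) : Rel (comp f (id Y)) f
  | assoc {X Y Z W} (f : Term k X Y) (g : Term k Y Z) (h : Term k Z W) :
      Rel (comp (comp f g) h) (comp f (comp g h))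
  -- bilinearity of composition
  | add_comp {X Y Z} (f f' : Term k X Y) (g : Term k Y Z) :
      Rel (comp (add f f') g) (add (comp f g) (comp f' g))
  | comp_add {X Y Z} (f : Term k X Y) (g g' : Term k Y Z) :
      Rel (comp f (add g g')) (add (comp f g) (comp f g'))
  | smul_comp {X Y Z} (r : k) (f : Term k X Y) (g : Term k Y Z) :
      Rel (comp (smul r f) g) (smul r (comp f g))
  | comp_smul {X Y Z} (r : k) (f : Term k X Y) (g : Term k Y Z) :
      Rel (comp f (smul r g)) (smul r (comp f g))
  -- strict monoidal axioms
  | id_tensor_id (X Y) : Rel (tensor (id X) (id Y)) (id (X ++ Y))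
  | interchange {X Y Z X' Y' Z'} (f : Term k X Y) (g : Term k Y Z) (f' : Term k X' Y')
      (g' : Term k Y' Z') :
      Rel (comp (tensor f f') (tensor g g')) (tensor (comp f g) (comp f' g'))
  | tensor_assoc {X Y X' Y' X'' Y''} (f : Term k X Y) (f' : Term k X' Y')
      (f'' : Term k X'' Y'') :
      Rel (castHom (List.append_assoc X X' X'') (List.append_assoc Y Y' Y'')
        (tensor (tensor f f') f'')) (tensor f (tensor f' f''))
  | unit_tensor {X Y} (f : Term k X Y) : Rel (tensor (id []) f) f
  | tensor_unit {X Y} (f : Term k X Y) :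
      Rel (castHom (List.append_nil X) (List.append_nil Y) (tensor f (id []))) f
  -- bilinearity of the tensor product
  | add_tensor {X Y X' Y'} (f g : Term k X Y) (f' : Term k X' Y') :
      Rel (tensor (add f g) f') (add (tensor f f') (tensor g f'))
  | tensor_add {X Y X' Y'} (f : Term k X Y) (f' g' : Term k X' Y') :
      Rel (tensor f (add f' g')) (add (tensor f f') (tensor f g'))
  | smul_tensor {X Y X' Y'} (r : k) (f : Term k X Y) (f' : Term k X' Y') :
      Rel (tensor (smul r f) f') (smul r (tensor f f'))
  | tensor_smul {X Y X' Y'} (r : k) (f : Term k X Y) (f' : Term k X' Y') :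
      Rel (tensor f (smul r f')) (smul r (tensor f f'))
  -- associativity of merges and of splits
  | merge_assoc (a b c : ℕ+) :
      Rel (comp (Y := [a + b, c]) (tensor (merge a b) (id [c])) (merge (a + b) c))
        (castHom rfl (congrArg (fun x => [x]) (_root_.add_assoc a b c).symm)
          (comp (Y := [a, b + c]) (tensor (id [a]) (merge b c)) (merge a (b + c))))
  | split_assoc (a b c : ℕ+) :
      Rel (comp (Y := [a + b, c]) (split (a + b) c) (tensor (split a b) (id [c])))
        (castHom (congrArg (fun x => [x]) (_root_.add_assoc a b c).symm) rfl
          (comp (Y := [a, b + c]) (split a (b + c)) (tensor (id [a]) (split b c))))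
  -- the digon relation
  | digon (a b : ℕ+) :
      Rel (comp (split a b) (merge a b))
        (smul (Nat.choose ((a : ℕ) + b) a : k) (id [a + b]))
  -- the merge-split relation
  | merge_split (a b c d : ℕ+) (h : a + c = b + d) :
      Rel (comp (merge a c)
          (castHom (congrArg (fun x => [x]) h.symm) rfl (split b d)))
        (ladderSum a b c d h)

/-- Equality of morphisms in the web category. -/
def setoid (k : Type u) [CommRing k] (X Y : Comp) : Setoid (Term k X Y) where
  r := Rel
  iseqv := ⟨Rel.refl, Rel.symm, Rel.trans⟩

end Term

/-- Morphisms of the web category. -/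
def WebHom (k : Type u) [CommRing k] (X Y : Comp) : Type u := Quotient (Term.setoid k X Y)

namespace WebHom

variable {k : Type u} [CommRing k]

/-- The morphism represented by an expression. -/
def mk {X Y : Comp} (f : Term k X Y) : WebHom k X Y := Quotient.mk (Term.setoid k X Y) f

theorem sound {X Y : Comp} {f g : Term k X Y} (h : Term.Rel f g) : mk f = mk g :=
  Quotient.sound (s := Term.setoid k X Y) h

theorem ind {X Y : Comp} {p : WebHom k X Y → Prop} (h : ∀ f, p (mk f)) (f : WebHom k X Y) : p f :=
  Quotient.inductionOn (s := Term.setoid k X Y) f h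

theorem mk_castHom {X X' Y Y' : Comp} (hX : X = X') (hY : Y = Y') (f : Term k X Y) :
    mk (castHom hX hY f) = castHom (H := WebHom k) hX hY (mk f) := by
  subst hX hY
  rfl

instance (X Y : Comp) : Zero (WebHom k X Y) := ⟨mk .zero⟩

instance (X Y : Comp) : Add (WebHom k X Y) :=
  ⟨Quotient.map₂ Term.add fun _ _ h _ _ h' => Term.Rel.add_congr h h'⟩

instance (X Y : Comp) : SMul k (WebHom k X Y) :=
  ⟨fun r => Quotient.map (Term.smul r) fun _ _ h => Term.Rel.smul_congr r h⟩

instance (X Y : Comp) : Neg (WebHom k X Y) := ⟨fun f => (-1 : k) • f⟩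

theorem zero_def {X Y : Comp} : (0 : WebHom k X Y) = mk .zero := rfl

theorem mk_add {X Y : Comp} (f g : Term k X Y) : mk f + mk g = mk (.add f g) := rfl

theorem mk_smul {X Y : Comp} (r : k) (f : Term k X Y) : r • mk f = mk (.smul r f) := rfl

theorem zero_add' {X Y : Comp} (f : WebHom k X Y) : 0 + f = f := by
  induction f using ind with | h f => exact sound (.zero_add f)

theorem add_comm' {X Y : Comp} (f g : WebHom k X Y) : f + g = g + f := by
  induction f using ind with | h f => induction g using ind with
    | h g => exact sound (.add_comm f g)

theorem add_smul' {X Y : Comp} (r s : k) (f : WebHom k X Y) : (r + s) • f = r • f + s • f := by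
  induction f using ind with | h f => exact sound (.add_smul r s f)

theorem one_smul' {X Y : Comp} (f : WebHom k X Y) : (1 : k) • f = f := by
  induction f using ind with | h f => exact sound (.one_smul f)

theorem zero_smul' {X Y : Comp} (f : WebHom k X Y) : (0 : k) • f = 0 := by
  induction f using ind with | h f => exact sound (.zero_smul f)

theorem mul_smul' {X Y : Comp} (r s : k) (f : WebHom k X Y) : (r * s) • f = r • s • f := by
  induction f using ind with | h f => exact sound (.mul_smul r s f)

theorem smul_add' {X Y : Comp} (r : k) (f g : WebHom k X Y) : r • (f + g) = r • f + r • g := by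
  induction f using ind with
  | h f => induction g using ind with | h g => exact sound (.smul_add r f g)

instance (X Y : Comp) : AddCommGroup (WebHom k X Y) where
  add_assoc f g h := by
    induction f using ind with | h f => induction g using ind with
    | h g => induction h using ind with | h h => exact sound (.add_assoc f g h)
  zero_add := zero_add'
  add_zero f := (add_comm' f 0).trans (zero_add' f)
  add_comm := add_comm'
  nsmul := nsmulRec
  zsmul := zsmulRec
  neg_add_cancel f := by
    change (-1 : k) • f + f = 0
    conv_lhs => rw [← one_smul' f, ← mul_smul', mul_one, ← add_smul', neg_add_cancel]
    exact zero_smul' f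

instance (X Y : Comp) : Module k (WebHom k X Y) where
  one_smul := one_smul'
  mul_smul := mul_smul'
  smul_zero r := by
    rw [← zero_smul' (0 : WebHom k X Y), ← mul_smul', mul_zero]
  smul_add := smul_add'
  add_smul := add_smul'
  zero_smul := zero_smul'

end WebHom

/-- The polynomial web category, as the quotient of the category of formal expressions. -/
def webCat (k : Type u) [CommRing k] : CompCat k where
  Hom := WebHom k
  id X := .mk (.id X)
  comp := Quotient.map₂ Term.comp fun _ _ h _ _ h' => Term.Rel.comp_congr h h'
  tensor := Quotient.map₂ Term.tensor fun _ _ h _ _ h' => Term.Rel.tensor_congr h h'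
  id_comp f := by induction f using WebHom.ind with | h f => exact WebHom.sound (.id_comp f)
  comp_id f := by induction f using WebHom.ind with | h f => exact WebHom.sound (.comp_id f)
  assoc f g h := by
    induction f using WebHom.ind with | h f => induction g using WebHom.ind with
    | h g => induction h using WebHom.ind with | h h => exact WebHom.sound (.assoc f g h)
  add_comp f g h := by
    induction f using WebHom.ind with | h f => induction g using WebHom.ind with
    | h g => induction h using WebHom.ind with | h h => exact WebHom.sound (.add_comp f g h)
  comp_add f g h := by
    induction f using WebHom.ind with | h f => induction g using WebHom.ind with
    | h g => induction h using WebHom.ind with | h h => exact WebHom.sound (.comp_add f g h)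
  smul_comp r f g := by
    induction f using WebHom.ind with | h f => induction g using WebHom.ind with
    | h g => exact WebHom.sound (.smul_comp r f g)
  comp_smul r f g := by
    induction f using WebHom.ind with | h f => induction g using WebHom.ind with
    | h g => exact WebHom.sound (.comp_smul r f g)
  id_tensor_id X Y := WebHom.sound (.id_tensor_id X Y)
  interchange f g f' g' := by
    induction f using WebHom.ind with | h f => induction g using WebHom.ind with
    | h g => induction f' using WebHom.ind with | h f' => induction g' using WebHom.ind with
    | h g' => exact WebHom.sound (.interchange f g f' g')
  tensor_assoc f f' f'' := by
    induction f using WebHom.ind with | h f => induction f' using WebHom.ind with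
    | h f' => induction f'' using WebHom.ind with
    | h f'' => exact (WebHom.mk_castHom _ _ _).symm.trans (WebHom.sound (.tensor_assoc f f' f''))
  unit_tensor f := by
    induction f using WebHom.ind with | h f => exact WebHom.sound (.unit_tensor f)
  tensor_unit f := by
    induction f using WebHom.ind with
    | h f => exact (WebHom.mk_castHom _ _ _).symm.trans (WebHom.sound (.tensor_unit f))
  add_tensor f g h := by
    induction f using WebHom.ind with | h f => induction g using WebHom.ind with
    | h g => induction h using WebHom.ind with | h h => exact WebHom.sound (.add_tensor f g h)
  tensor_add f g h := by
    induction f using WebHom.ind with | h f => induction g using WebHom.ind with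
    | h g => induction h using WebHom.ind with | h h => exact WebHom.sound (.tensor_add f g h)
  smul_tensor r f g := by
    induction f using WebHom.ind with | h f => induction g using WebHom.ind with
    | h g => exact WebHom.sound (.smul_tensor r f g)
  tensor_smul r f g := by
    induction f using WebHom.ind with | h f => induction g using WebHom.ind with
    | h g => exact WebHom.sound (.tensor_smul r f g)

/-- The polynomial web category. -/
abbrev Web (k : Type u) [CommRing k] : Type := (webCat k).Obj

/-- The morphism of the web category represented by an expression. -/
def Term.toWeb {k : Type u} [CommRing k] {X Y : Comp} (f : Term k X Y) :
    (webCat k).of X ⟶ (webCat k).of Y :=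
  (webCat k).hom (WebHom.mk f)

/-! The Schur category -/

/-- The set of matrices with non-negative integer entries, with row sums given by `la` and column
sums given by `mu`. -/
structure Mat (la mu : Comp) where
  val : Matrix (Fin la.length) (Fin mu.length) ℕ
  row_sum : ∀ i, ∑ j, val i j = (la.get i : ℕ)
  col_sum : ∀ j, ∑ i, val i j = (mu.get j : ℕ)

namespace Mat

theorem ext_val {la mu : Comp} {A B : Mat la mu} (h : A.1 = B.1) : A = B := by
  cases A; cases B; cases h; rfl

theorem ext {la mu : Comp} {A B : Mat la mu} (h : ∀ i j, A.1 i j = B.1 i j) : A = B :=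
  ext_val (funext fun i => funext fun j => h i j)

theorem entry_le {la mu : Comp} (A : Mat la mu) (i : Fin la.length) (j : Fin mu.length) :
    A.1 i j ≤ (la.get i : ℕ) :=
  (A.row_sum i) ▸ Finset.single_le_sum (f := fun j => A.1 i j) (fun _ _ => Nat.zero_le _)
    (Finset.mem_univ j)

instance (la mu : Comp) : Finite (Mat la mu) := by
  refine Finite.of_injective (β := ∀ i : Fin la.length, Fin mu.length → Fin ((la.get i : ℕ) + 1))
    (fun A i j => ⟨A.1 i j, Nat.lt_succ_of_le (A.entry_le i j)⟩) ?_
  intro A B h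
  refine ext fun i j => ?_
  have := congrFun (congrFun h i) j
  simpa using this

noncomputable instance (la mu : Comp) : Fintype (Mat la mu) := Fintype.ofFinite _

/-- The diagonal matrix with diagonal entries `la`. -/
def diag (la : Comp) : Mat la la :=
  ⟨Matrix.diagonal fun i => (la.get i : ℕ), by
    intro i; simp [Matrix.diagonal_apply], by
    intro i; simp [Matrix.diagonal_apply]⟩

/-- The bijection between indices of the parts of `la` and of `la'`, and indices of the parts of
`la ++ la'`. -/
def appendIdx (la la' : Comp) : Fin la.length ⊕ Fin la'.length ≃ Fin (la ++ la').length :=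
  finSumFinEquiv.trans (finCongr List.length_append.symm)

theorem appendIdx_inl_val {la la' : Comp} (i : Fin la.length) :
    (appendIdx la la' (.inl i)).val = i.val := by
  simp [appendIdx]

theorem appendIdx_inr_val {la la' : Comp} (i : Fin la'.length) :
    (appendIdx la la' (.inr i)).val = la.length + i.val := by
  simp [appendIdx]

theorem get_appendIdx_inl {la la' : Comp} (i : Fin la.length) :
    (la ++ la').get (appendIdx la la' (.inl i)) = la.get i := by
  simp [appendIdx]

theorem get_appendIdx_inr {la la' : Comp} (i : Fin la'.length) :
    (la ++ la').get (appendIdx la la' (.inr i)) = la'.get i := by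
  simp [appendIdx]

/-- The block diagonal matrix `diag(A, B)`. -/
def blockDiag {la mu la' mu' : Comp} (A : Mat la mu) (B : Mat la' mu') :
    Mat (la ++ la') (mu ++ mu') :=
  ⟨(Matrix.fromBlocks A.1 0 0 B.1).submatrix (appendIdx la la').symm (appendIdx mu mu').symm, by
    · intro i
      obtain ⟨i, rfl⟩ := (appendIdx la la').surjective i
      rw [← (appendIdx mu mu').sum_comp]
      rcases i with i | i
      · rw [Mat.get_appendIdx_inl, ← A.row_sum i]
        simp
      · rw [Mat.get_appendIdx_inr, ← B.row_sum i]
        simp, by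
    · intro i
      obtain ⟨i, rfl⟩ := (appendIdx mu mu').surjective i
      rw [← (appendIdx la la').sum_comp]
      rcases i with i | i
      · rw [Mat.get_appendIdx_inl, ← A.col_sum i]
        simp
      · rw [Mat.get_appendIdx_inr, ← B.col_sum i]
        simp⟩

theorem blockDiag_apply {la mu la' mu' : Comp} (A : Mat la mu) (B : Mat la' mu') (x y) :
    (blockDiag A B).1 (appendIdx la la' x) (appendIdx mu mu' y) =
      Matrix.fromBlocks A.1 0 0 B.1 x y := by
  simp [blockDiag]

end Mat

/-- For finite tuples `i` and `j` indexed by the same set, the pair `(i, j)` lies in the orbit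
labelled by the matrix `A` if for all `a, b` there are exactly `A a b` indices `r` with
`(i r, j r) = (a, b)`. -/
def InOrbit {R ι κ : Type} (A : Matrix ι κ ℕ) (i : R → ι) (j : R → κ) : Prop :=
  ∀ a b, Nat.card {r : R // i r = a ∧ j r = b} = A a b

namespace InOrbit

variable {R R' ι κ : Type}

theorem comp_equiv (e : R' ≃ R) (A : Matrix ι κ ℕ) (i : R → ι) (j : R → κ) :
    InOrbit A (i ∘ e) (j ∘ e) ↔ InOrbit A i j := by
  refine forall_congr' fun a => forall_congr' fun b => ?_
  rw [Nat.card_congr (e.subtypeEquiv (p := fun r => (i ∘ e) r = a ∧ (j ∘ e) r = b)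
    (q := fun r => i r = a ∧ j r = b) fun r => Iff.rfl)]

theorem unique {A B : Matrix ι κ ℕ} {i : R → ι} {j : R → κ} (hA : InOrbit A i j)
    (hB : InOrbit B i j) : A = B :=
  funext fun a => funext fun b => (hA a b).symm.trans (hB a b)

theorem ne_zero [Finite R] {A : Matrix ι κ ℕ} {i : R → ι} {j : R → κ} (hA : InOrbit A i j)
    (r : R) : A (i r) (j r) ≠ 0 := by
  rw [← hA]
  have : Nonempty {s : R // i s = i r ∧ j s = j r} := ⟨⟨r, rfl, rfl⟩⟩
  exact Nat.card_pos.ne'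

theorem exists_equiv [Finite R] [Finite R'] {A : Matrix ι κ ℕ} {i : R → ι} {j : R → κ}
    {i' : R' → ι} {j' : R' → κ} (h : InOrbit A i j) (h' : InOrbit A i' j') :
    ∃ e : R ≃ R', i' ∘ e = i ∧ j' ∘ e = j := by
  have key : ∀ p : ι × κ, Nonempty ({r // (i r, j r) = p} ≃ {r // (i' r, j' r) = p}) := by
    rintro ⟨a, b⟩
    simp only [Prod.mk.injEq]
    exact ⟨(Finite.equivFinOfCardEq (h a b)).trans (Finite.equivFinOfCardEq (h' a b)).symm⟩
  let e : R ≃ R' := (Equiv.sigmaFiberEquiv fun r => (i r, j r)).symm.trans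
    ((Equiv.sigmaCongrRight fun p => (key p).some).trans
      (Equiv.sigmaFiberEquiv fun r => (i' r, j' r)))
  have he : ∀ r, (i' (e r), j' (e r)) = (i r, j r) := fun r =>
    ((key (i r, j r)).some ⟨r, rfl⟩).2
  exact ⟨e, funext fun r => congrArg Prod.fst (he r), funext fun r => congrArg Prod.snd (he r)⟩

theorem card_left [Finite R] [Fintype κ] {A : Matrix ι κ ℕ} {i : R → ι} {j : R → κ}
    (h : InOrbit A i j) (a : ι) : Nat.card {r // i r = a} = ∑ b, A a b := by
  classical
  simp_rw [← h a]
  rw [← Nat.card_sigma]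
  exact Nat.card_congr
    { toFun := fun r => ⟨j r.1, r.1, r.2, rfl⟩
      invFun := fun x => ⟨x.2.1, x.2.2.1⟩
      left_inv := fun r => rfl
      right_inv := by rintro ⟨b, r, h1, rfl⟩; rfl }

theorem card_right [Finite R] [Fintype ι] {A : Matrix ι κ ℕ} {i : R → ι} {j : R → κ}
    (h : InOrbit A i j) (b : κ) : Nat.card {r // j r = b} = ∑ a, A a b := by
  classical
  simp_rw [← h _ b]
  rw [← Nat.card_sigma]
  exact Nat.card_congr
    { toFun := fun r => ⟨i r.1, r.1, rfl, r.2⟩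
      invFun := fun x => ⟨x.2.1, x.2.2.2⟩
      left_inv := fun r => rfl
      right_inv := by rintro ⟨b, r, rfl, h1⟩; rfl }

end InOrbit

/-- The sum of the parts of a composition. -/
def size (la : Comp) : ℕ := (la.map PNat.val).sum

theorem sum_get (la : Comp) : ∑ i, (la.get i : ℕ) = size la := by
  induction la with
  | nil => rfl
  | cons a la ih =>
    rw [size, List.map_cons, List.sum_cons, ← size, ← ih]
    exact Fin.sum_univ_succ (fun i : Fin (la.length + 1) => ((a :: la).get i : ℕ))

theorem exists_inOrbit_aux {m n d : ℕ} (c : Fin m → Fin n → ℕ) (hc : ∑ a, ∑ b, c a b = d) :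
    ∃ p : (Fin d → Fin m) × (Fin d → Fin n), InOrbit c p.1 p.2 := by
  let R := Σ a, Σ b, Fin (c a b)
  have hR : Nat.card R = d := by
    rw [← hc, Nat.card_sigma]
    refine Finset.sum_congr rfl fun a _ => ?_
    rw [Nat.card_sigma]
    simp only [Nat.card_fin]
  have h2 : Finite R := Finite.of_fintype (Σ a, Σ b, Fin (c a b))
  let e : Fin d ≃ R := (Finite.equivFinOfCardEq hR).symm
  refine ⟨⟨fun r => (e r).1, fun r => (e r).2.1⟩, ?_⟩
  refine (InOrbit.comp_equiv e c (fun r : R => r.1) (fun r : R => r.2.1)).2 ?_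
  intro a b
  rw [← Nat.card_fin (c a b)]
  exact Nat.card_congr
    { toFun := fun r => cast (congrArg₂ (fun x y => Fin (c x y)) r.2.1 r.2.2) r.1.2.2
      invFun := fun t => ⟨⟨a, b, t⟩, rfl, rfl⟩
      left_inv := by rintro ⟨⟨a, b, t⟩, rfl, rfl⟩; rfl
      right_inv := fun t => rfl }

/-- Every matrix labels a non-empty orbit of pairs of `d`-tuples. -/
theorem Mat.exists_inOrbit {la mu : Comp} (C : Mat la mu) :
    ∃ p : (Fin (size la) → Fin la.length) × (Fin (size la) → Fin mu.length),
      InOrbit C.1 p.1 p.2 :=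
  exists_inOrbit_aux C.1 (by rw [← sum_get]; exact Finset.sum_congr rfl fun a _ => C.row_sum a)

/-- The structure constant `Z(A, B, C)`: the number of tuples `j` such that `(i, j)` lies in the
orbit of `A` and `(j, l)` lies in the orbit of `B`, where `(i, l)` is some chosen element of the
orbit of `C`. -/
noncomputable def structConst {la mu nu : Comp} (A : Mat la mu) (B : Mat mu nu) (C : Mat la nu) :
    ℕ :=
  Nat.card {j : Fin (size la) → Fin mu.length //
    InOrbit A.1 (Classical.choose C.exists_inOrbit).1 j ∧
      InOrbit B.1 j (Classical.choose C.exists_inOrbit).2}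

/-- The structure constants do not depend on the choice. -/
theorem structConst_eq {R : Type} [Finite R] {la mu nu : Comp} (A : Mat la mu) (B : Mat mu nu)
    (C : Mat la nu) {i : R → Fin la.length} {l : R → Fin nu.length} (h : InOrbit C.1 i l) :
    structConst A B C =
      Nat.card {j : R → Fin mu.length // InOrbit A.1 i j ∧ InOrbit B.1 j l} := by
  obtain ⟨e, h1, h2⟩ := h.exists_equiv (Classical.choose_spec C.exists_inOrbit)
  unfold structConst
  refine Nat.card_congr (Equiv.subtypeEquiv (e.symm.arrowCongr (Equiv.refl _)) fun j => ?_)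
  rw [← InOrbit.comp_equiv e A.1, ← InOrbit.comp_equiv e B.1, h1, h2]
  rfl

/-- Morphisms from `mu` to `la` in the Schur category: the free module with basis the matrices
with row sums `la` and column sums `mu`. -/
abbrev SchurHom (k : Type u) [CommRing k] (mu la : Comp) : Type u := Mat la mu →₀ k

namespace SchurHom

variable {k : Type u} [CommRing k]

/-- The basis element labelled by a matrix. -/
noncomputable def xi {la mu : Comp} (A : Mat la mu) : SchurHom k mu la := Finsupp.single A 1

/-- Schur's product rule: the product of two basis elements. -/
noncomputable def mulBasis {la mu nu : Comp} (A : Mat la mu) (B : Mat mu nu) :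
    SchurHom k nu la :=
  ∑ C : Mat la nu, (structConst A B C : k) • xi C

/-- Composition (`comp f g` is `f` followed by `g`), the bilinear extension of Schur's product
rule. -/
noncomputable def comp {nu mu la : Comp} (f : SchurHom k nu mu) (g : SchurHom k mu la) :
    SchurHom k nu la :=
  f.sum fun B b => g.sum fun A a => (a * b) • mulBasis A B

/-- Tensor product, the bilinear extension of the formation of block diagonal matrices. -/
noncomputable def tensor {mu la mu' la' : Comp} (f : SchurHom k mu la)
    (f' : SchurHom k mu' la') : SchurHom k (mu ++ mu') (la ++ la') :=
  f.sum fun A a => f'.sum fun B b => (a * b) • xi (A.blockDiag B)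

section bilinear

variable {nu mu la mu' la' : Comp}

theorem comp_eq (f : SchurHom k nu mu) (g : SchurHom k mu la) :
    comp f g = ∑ B, ∑ A, (g A * f B) • mulBasis A B := by
  unfold comp
  rw [Finsupp.sum_fintype _ _ (by simp [Finsupp.sum])]
  refine Finset.sum_congr rfl fun B _ => ?_
  rw [Finsupp.sum_fintype _ _ (by simp)]

theorem tensor_eq (f : SchurHom k mu la) (f' : SchurHom k mu' la') :
    tensor f f' = ∑ A, ∑ B, (f A * f' B) • xi (A.blockDiag B) := by
  unfold tensor
  rw [Finsupp.sum_fintype _ _ (by simp [Finsupp.sum])]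
  refine Finset.sum_congr rfl fun B _ => ?_
  rw [Finsupp.sum_fintype _ _ (by simp)]

theorem add_comp (f f' : SchurHom k nu mu) (g : SchurHom k mu la) :
    comp (f + f') g = comp f g + comp f' g := by
  simp only [comp_eq, Finsupp.add_apply, mul_add, add_smul, Finset.sum_add_distrib]

theorem comp_add (f : SchurHom k nu mu) (g g' : SchurHom k mu la) :
    comp f (g + g') = comp f g + comp f g' := by
  simp only [comp_eq, Finsupp.add_apply, add_mul, add_smul, Finset.sum_add_distrib]

theorem smul_comp (r : k) (f : SchurHom k nu mu) (g : SchurHom k mu la) :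
    comp (r • f) g = r • comp f g := by
  simp only [comp_eq, Finsupp.smul_apply, Finset.smul_sum, smul_smul, smul_eq_mul]
  refine Finset.sum_congr rfl fun B _ => Finset.sum_congr rfl fun A _ => ?_
  congr 1; ring

theorem comp_smul (r : k) (f : SchurHom k nu mu) (g : SchurHom k mu la) :
    comp f (r • g) = r • comp f g := by
  simp only [comp_eq, Finsupp.smul_apply, Finset.smul_sum, smul_smul, smul_eq_mul, mul_assoc]

theorem add_tensor (f g : SchurHom k mu la) (f' : SchurHom k mu' la') :
    tensor (f + g) f' = tensor f f' + tensor g f' := by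
  simp only [tensor_eq, Finsupp.add_apply, add_mul, add_smul, Finset.sum_add_distrib]

theorem tensor_add (f : SchurHom k mu la) (f' g' : SchurHom k mu' la') :
    tensor f (f' + g') = tensor f f' + tensor f g' := by
  simp only [tensor_eq, Finsupp.add_apply, mul_add, add_smul, Finset.sum_add_distrib]

theorem smul_tensor (r : k) (f : SchurHom k mu la) (f' : SchurHom k mu' la') :
    tensor (r • f) f' = r • tensor f f' := by
  simp only [tensor_eq, Finsupp.smul_apply, Finset.smul_sum, smul_smul, smul_eq_mul, mul_assoc]

theorem tensor_smul (r : k) (f : SchurHom k mu la) (f' : SchurHom k mu' la') :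
    tensor f (r • f') = r • tensor f f' := by
  simp only [tensor_eq, Finsupp.smul_apply, Finset.smul_sum, smul_smul, smul_eq_mul]
  refine Finset.sum_congr rfl fun B _ => Finset.sum_congr rfl fun A _ => ?_
  congr 1; ring

theorem tensor_xi (A : Mat la mu) (B : Mat la' mu') :
    tensor (k := k) (xi A) (xi B) = xi (A.blockDiag B) := by
  rw [tensor, xi, xi, Finsupp.sum_single_index (by simp), Finsupp.sum_single_index (by simp),
    one_mul, one_smul]

end bilinear

section ev

variable {R R' : Type} {nu mu la mu' la' : Comp}

open Classical in
/-- The matrix coefficient of a morphism, regarded as an operator on tensor space, at a pair of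
tuples. -/
noncomputable def ev (i : R → Fin la.length) (j : R → Fin mu.length) :
    SchurHom k mu la →ₗ[k] k :=
  Finsupp.lsum k fun A => if InOrbit A.1 i j then LinearMap.id else 0

open Classical in
theorem ev_xi (i : R → Fin la.length) (j : R → Fin mu.length) (A : Mat la mu) :
    ev (k := k) i j (xi A) = if InOrbit A.1 i j then 1 else 0 := by
  simp only [ev, xi, Finsupp.lsum_single]
  split_ifs <;> simp

theorem ev_eq_zero {i : R → Fin la.length} {j : R → Fin mu.length} (f : SchurHom k mu la)
    (h : ∀ A : Mat la mu, ¬ InOrbit A.1 i j) : ev i j f = 0 := by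
  simp [ev, h, Finsupp.lsum_apply, Finsupp.sum]

theorem ev_eq {i : R → Fin la.length} {j : R → Fin mu.length} (f : SchurHom k mu la)
    {A : Mat la mu} (h : InOrbit A.1 i j) : ev i j f = f A := by
  classical
  have key : ∀ B : Mat la mu, InOrbit B.1 i j ↔ B = A := fun B =>
    ⟨fun hB => Mat.ext_val (hB.unique h), fun hB => hB ▸ h⟩
  simp only [ev, Finsupp.lsum_apply, key]
  rw [Finsupp.sum_fintype _ _ (by simp), Finset.sum_eq_single A]
  · simp
  · intro B _ hB; simp [hB]
  · simp

theorem ev_comp_equiv (e : R' ≃ R) (i : R → Fin la.length) (j : R → Fin mu.length)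
    (f : SchurHom k mu la) : ev (i ∘ e) (j ∘ e) f = ev i j f := by
  classical
  rw [ev, ev, Finsupp.lsum_apply, Finsupp.lsum_apply]
  refine Finset.sum_congr rfl fun A _ => ?_
  simp only []
  rw [if_congr (InOrbit.comp_equiv e A.1 i j) rfl rfl]

theorem ext_ev {f g : SchurHom k mu la}
    (h : ∀ (i : Fin (size la) → Fin la.length) (j : Fin (size la) → Fin mu.length),
      ev i j f = ev i j g) : f = g := by
  ext A
  obtain ⟨p, hp⟩ := A.exists_inOrbit
  have := h p.1 p.2
  rwa [ev_eq f hp, ev_eq g hp] at this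

theorem ev_mulBasis [Fintype R] [DecidableEq R] (i : R → Fin la.length) (l : R → Fin nu.length)
    (A : Mat la mu) (B : Mat mu nu) :
    ev (k := k) i l (mulBasis A B) = ∑ j, ev i j (xi A : SchurHom k mu la) * ev j l (xi B) := by
  classical
  have hR : ∑ j : R → Fin mu.length,
      ev (k := k) i j (xi A : SchurHom k mu la) * ev j l (xi B) =
      (Nat.card {j : R → Fin mu.length // InOrbit A.1 i j ∧ InOrbit B.1 j l} : k) := by
    rw [Nat.card_eq_fintype_card, Fintype.card_subtype, Finset.card_eq_sum_ones,
      Finset.sum_filter, Nat.cast_sum]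
    refine Finset.sum_congr rfl fun j _ => ?_
    rw [ev_xi, ev_xi]
    split_ifs <;> simp_all
  rw [hR]
  by_cases hC : ∃ C : Mat la nu, InOrbit C.1 i l
  · obtain ⟨C, hC⟩ := hC
    rw [ev_eq _ hC, ← structConst_eq A B C hC]
    simp [mulBasis, xi, Finsupp.finsetSum_apply, Finsupp.single_apply]
  · rw [ev_eq_zero _ (by simpa using hC)]
    have : IsEmpty {j : R → Fin mu.length // InOrbit A.1 i j ∧ InOrbit B.1 j l} := by
      refine ⟨fun ⟨j, h1, h2⟩ => hC ?_⟩
      have h3 : InOrbit (fun a b => Nat.card {r // i r = a ∧ l r = b}) i l := fun _ _ => rfl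
      refine ⟨⟨fun a b => Nat.card {r // i r = a ∧ l r = b}, fun a => ?_, fun b => ?_⟩, h3⟩
      · rw [← A.row_sum a, ← h1.card_left a]
        exact (h3.card_left a).symm
      · rw [← B.col_sum b, ← h2.card_right b]
        exact (h3.card_right b).symm
    simp

theorem comp_xi (A : Mat la mu) (B : Mat mu nu) :
    comp (k := k) (xi B) (xi A) = mulBasis A B := by
  simp [comp, xi]

theorem ev_comp [Fintype R] [DecidableEq R] (i : R → Fin la.length) (l : R → Fin nu.length)
    (f : SchurHom k nu mu) (g : SchurHom k mu la) :
    ev i l (comp f g) = ∑ j, ev i j g * ev j l f := by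
  induction f using Finsupp.induction_linear with
  | zero =>
    have : comp (0 : SchurHom k nu mu) g = 0 := by simp [comp]
    simp [this]
  | add f f' hf hf' => simp [add_comp, hf, hf', mul_add, Finset.sum_add_distrib]
  | single B b =>
    induction g using Finsupp.induction_linear with
    | zero =>
      have : comp (Finsupp.single B b : SchurHom k nu mu) (0 : SchurHom k mu la) = 0 := by
        simp [comp, Finsupp.sum]
      simp [this]
    | add g g' hg hg' => simp [comp_add, hg, hg', add_mul, Finset.sum_add_distrib]
    | single A a =>
      have hA : (Finsupp.single A a : SchurHom k mu la) = a • xi A := by simp [xi]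
      have hB : (Finsupp.single B b : SchurHom k nu mu) = b • xi B := by simp [xi]
      rw [hA, hB, smul_comp, comp_smul, comp_xi, map_smul, map_smul, ev_mulBasis]
      simp only [map_smul, smul_eq_mul, Finset.mul_sum]
      refine Finset.sum_congr rfl fun j _ => ?_
      ring

theorem comp_assoc {ka : Comp} (f : SchurHom k ka nu) (g : SchurHom k nu mu)
    (h : SchurHom k mu la) : comp (comp f g) h = comp f (comp g h) := by
  refine ext_ev fun i j => ?_
  simp only [ev_comp, Finset.sum_mul, Finset.mul_sum]
  rw [Finset.sum_comm]
  simp only [mul_assoc]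

/-- The identity morphism. -/
noncomputable def id (la : Comp) : SchurHom k la la := xi (Mat.diag la)

theorem eq_of_inOrbit_diag [Finite R] {i j : R → Fin la.length}
    (h : InOrbit (Mat.diag la).1 i j) : i = j := by
  funext r
  by_contra hne
  exact h.ne_zero r (Matrix.diagonal_apply_ne _ hne)

theorem inOrbit_diag [Finite R] {j : R → Fin la.length}
    (h : ∀ a, Nat.card {r // j r = a} = (la.get a : ℕ)) : InOrbit (Mat.diag la).1 j j := by
  intro a b
  by_cases hab : a = b
  · subst hab
    simp only [and_self, h]
    simp [Mat.diag]
  · have : IsEmpty {r // j r = a ∧ j r = b} := ⟨fun ⟨r, h1, h2⟩ => hab (h1.symm.trans h2)⟩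
    simp [Mat.diag, hab]

theorem id_comp (f : SchurHom k mu la) : comp (id mu) f = f := by
  classical
  refine ext_ev fun i l => ?_
  rw [ev_comp, Finset.sum_eq_single l]
  · by_cases h : ∃ A : Mat la mu, InOrbit A.1 i l
    · obtain ⟨A, hA⟩ := h
      have : InOrbit (Mat.diag mu).1 l l :=
        inOrbit_diag fun a => by rw [hA.card_right a, A.col_sum a]
      rw [id, ev_xi, if_pos this, mul_one]
    · rw [ev_eq_zero f (by simpa using h), zero_mul]
  · intro j _ hj
    rw [id, ev_xi, if_neg fun h => hj (eq_of_inOrbit_diag h), mul_zero]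
  · simp

theorem comp_id (f : SchurHom k mu la) : comp f (id la) = f := by
  classical
  refine ext_ev fun i l => ?_
  rw [ev_comp, Finset.sum_eq_single i]
  · by_cases h : ∃ A : Mat la mu, InOrbit A.1 i l
    · obtain ⟨A, hA⟩ := h
      have : InOrbit (Mat.diag la).1 i i :=
        inOrbit_diag fun a => by rw [hA.card_left a, A.row_sum a]
      rw [id, ev_xi, if_pos this, one_mul]
    · rw [ev_eq_zero f (by simpa using h), mul_zero]
  · intro j _ hj
    rw [id, ev_xi, if_neg fun h => hj (eq_of_inOrbit_diag h).symm, zero_mul]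
  · simp

end ev

section interchange

variable {R R₁ R₂ : Type} {nu mu la nu' mu' la' : Comp}

/-- The concatenation of two tuples. -/
def join (i₁ : R₁ → Fin la.length) (i₂ : R₂ → Fin la'.length) :
    R₁ ⊕ R₂ → Fin (la ++ la').length :=
  fun r => Mat.appendIdx la la' (Sum.map i₁ i₂ r)

theorem join_injective :
    Function.Injective fun p : (R₁ → Fin la.length) × (R₂ → Fin la'.length) =>
      (join p.1 p.2 : R₁ ⊕ R₂ → Fin (la ++ la').length) := by
  rintro ⟨i₁, i₂⟩ ⟨j₁, j₂⟩ h
  refine Prod.ext (funext fun r => ?_) (funext fun r => ?_)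
  · have := (Mat.appendIdx la la').injective (congrFun h (.inl r))
    simpa using this
  · have := (Mat.appendIdx la la').injective (congrFun h (.inr r))
    simpa using this

theorem exists_join [Fintype R] (i : R → Fin (la ++ la').length) :
    ∃ (R₁ R₂ : Type) (_ : Fintype R₁) (_ : Fintype R₂) (e : R₁ ⊕ R₂ ≃ R)
      (i₁ : R₁ → Fin la.length) (i₂ : R₂ → Fin la'.length), i ∘ e = join i₁ i₂ := by
  classical
  let p : R → Prop := fun r => ((Mat.appendIdx la la').symm (i r)).isLeft
  have h1 : ∀ r : {r // p r}, ∃ a, i r.1 = Mat.appendIdx la la' (.inl a) := fun r => by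
    obtain ⟨a, ha⟩ := Sum.isLeft_iff.1 r.2
    exact ⟨a, by rw [← ha, Equiv.apply_symm_apply]⟩
  have h2 : ∀ r : {r // ¬ p r}, ∃ a, i r.1 = Mat.appendIdx la la' (.inr a) := fun r => by
    obtain ⟨a, ha⟩ := Sum.isRight_iff.1 (Sum.not_isLeft.1 r.2)
    exact ⟨a, by rw [← ha, Equiv.apply_symm_apply]⟩
  choose i₁ hi₁ using h1
  choose i₂ hi₂ using h2
  refine ⟨{r // p r}, {r // ¬ p r}, inferInstance, inferInstance, Equiv.sumCompl p, i₁, i₂, ?_⟩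
  funext r
  rcases r with r | r
  · exact hi₁ r
  · exact hi₂ r

theorem inOrbit_join [Finite R₁] [Finite R₂] (A : Mat la mu) (B : Mat la' mu')
    (i₁ : R₁ → Fin la.length) (i₂ : R₂ → Fin la'.length) (j₁ : R₁ → Fin mu.length)
    (j₂ : R₂ → Fin mu'.length) :
    InOrbit (A.blockDiag B).1 (join i₁ i₂) (join j₁ j₂) ↔ InOrbit A.1 i₁ j₁ ∧ InOrbit B.1 i₂ j₂ := by
  have key : ∀ x y, Nat.card {r : R₁ ⊕ R₂ // join i₁ i₂ r = Mat.appendIdx la la' x ∧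
      join j₁ j₂ r = Mat.appendIdx mu mu' y} =
      Nat.card {r : R₁ // Sum.inl (i₁ r) = x ∧ Sum.inl (j₁ r) = y} +
      Nat.card {r : R₂ // Sum.inr (i₂ r) = x ∧ Sum.inr (j₂ r) = y} := by
    intro x y
    rw [← Nat.card_sum]
    refine Nat.card_congr ((Equiv.subtypeSum).trans (Equiv.sumCongr ?_ ?_)) <;>
    · refine Equiv.subtypeEquivRight fun r => ?_
      simp [join]
  constructor
  · intro h
    constructor
    · intro a b
      have := h (Mat.appendIdx la la' (.inl a)) (Mat.appendIdx mu mu' (.inl b))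
      rw [Mat.blockDiag_apply, key] at this
      simpa using this
    · intro a b
      have := h (Mat.appendIdx la la' (.inr a)) (Mat.appendIdx mu mu' (.inr b))
      rw [Mat.blockDiag_apply, key] at this
      simpa using this
  · rintro ⟨h1, h2⟩ a b
    obtain ⟨x, rfl⟩ := (Mat.appendIdx la la').surjective a
    obtain ⟨y, rfl⟩ := (Mat.appendIdx mu mu').surjective b
    rw [Mat.blockDiag_apply, key]
    rcases x with x | x <;> rcases y with y | y
    · simpa using h1 x y
    · simp
    · simp
    · simpa using h2 x y

theorem exists_join_right [Finite R₁] [Finite R₂] {A : Mat la mu} {B : Mat la' mu'}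
    {i₁ : R₁ → Fin la.length} {i₂ : R₂ → Fin la'.length} {j : R₁ ⊕ R₂ → Fin (mu ++ mu').length}
    (h : InOrbit (A.blockDiag B).1 (join i₁ i₂) j) : ∃ j₁ j₂, j = join j₁ j₂ := by
  have h1 : ∀ r : R₁, ∃ a, j (.inl r) = Mat.appendIdx mu mu' (.inl a) := fun r => by
    obtain ⟨y, hy⟩ := (Mat.appendIdx mu mu').surjective (j (.inl r))
    have := h.ne_zero (.inl r)
    rw [← hy, join, Mat.blockDiag_apply] at this
    rcases y with y | y
    · exact ⟨y, hy.symm⟩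
    · simp at this
  have h2 : ∀ r : R₂, ∃ a, j (.inr r) = Mat.appendIdx mu mu' (.inr a) := fun r => by
    obtain ⟨y, hy⟩ := (Mat.appendIdx mu mu').surjective (j (.inr r))
    have := h.ne_zero (.inr r)
    rw [← hy, join, Mat.blockDiag_apply] at this
    rcases y with y | y
    · simp at this
    · exact ⟨y, hy.symm⟩
  choose j₁ hj₁ using h1
  choose j₂ hj₂ using h2
  refine ⟨j₁, j₂, funext fun r => ?_⟩
  rcases r with r | r
  · exact hj₁ r
  · exact hj₂ r

theorem ev_tensor [Finite R] (i : R → Fin (la ++ la').length) (j : R → Fin (mu ++ mu').length)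
    (f : SchurHom k mu la) (f' : SchurHom k mu' la') :
    ev i j (tensor f f') = ∑ A, ∑ B, f A * f' B * ev i j (xi (A.blockDiag B)) := by
  simp [tensor_eq, map_sum]

theorem ev_tensor_join [Finite R₁] [Finite R₂]
    (i₁ : R₁ → Fin la.length) (i₂ : R₂ → Fin la'.length) (j₁ : R₁ → Fin mu.length)
    (j₂ : R₂ → Fin mu'.length) (f : SchurHom k mu la) (f' : SchurHom k mu' la') :
    ev (join i₁ i₂) (join j₁ j₂) (tensor f f') = ev i₁ j₁ f * ev i₂ j₂ f' := by
  classical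
  have e1 : ev i₁ j₁ f = ∑ A, f A * ev i₁ j₁ (xi A : SchurHom k mu la) := by
    conv_lhs => rw [← Finsupp.sum_single f, Finsupp.sum_fintype _ _ (by simp), map_sum]
    refine Finset.sum_congr rfl fun A _ => ?_
    rw [← smul_eq_mul, ← map_smul]
    simp [xi]
  have e2 : ev i₂ j₂ f' = ∑ A, f' A * ev i₂ j₂ (xi A : SchurHom k mu' la') := by
    conv_lhs => rw [← Finsupp.sum_single f', Finsupp.sum_fintype _ _ (by simp), map_sum]
    refine Finset.sum_congr rfl fun A _ => ?_
    rw [← smul_eq_mul, ← map_smul]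
    simp [xi]
  rw [ev_tensor, e1, e2, Finset.sum_mul_sum]
  refine Finset.sum_congr rfl fun A _ => Finset.sum_congr rfl fun B _ => ?_
  simp only [ev_xi, inOrbit_join]
  split_ifs <;> simp_all

theorem ev_tensor_eq_zero [Finite R₁] [Finite R₂] (i₁ : R₁ → Fin la.length)
    (i₂ : R₂ → Fin la'.length) (j : R₁ ⊕ R₂ → Fin (mu ++ mu').length)
    (hj : ¬ ∃ j₁ j₂, j = join j₁ j₂) (f : SchurHom k mu la) (f' : SchurHom k mu' la') :
    ev (join i₁ i₂) j (tensor f f') = 0 := by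
  classical
  rw [ev_tensor]
  refine Finset.sum_eq_zero fun A _ => Finset.sum_eq_zero fun B _ => ?_
  rw [ev_xi, if_neg fun h => hj (exists_join_right h), mul_zero]

theorem interchange (f : SchurHom k nu mu) (g : SchurHom k mu la) (f' : SchurHom k nu' mu')
    (g' : SchurHom k mu' la') :
    comp (tensor f f') (tensor g g') = tensor (comp f g) (comp f' g') := by
  classical
  refine ext_ev fun i l => ?_
  obtain ⟨R₁, R₂, _, _, e, i₁, i₂, hi⟩ := exists_join i
  rw [← ev_comp_equiv e, ← ev_comp_equiv e i l, hi]
  generalize l ∘ e = l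
  have key : ev (join i₁ i₂) l (comp (tensor f f') (tensor g g')) =
      ∑ p : (R₁ → Fin mu.length) × (R₂ → Fin mu'.length),
        ev (join i₁ i₂) (join p.1 p.2) (tensor g g') * ev (join p.1 p.2) l (tensor f f') := by
    rw [ev_comp]
    symm
    refine Finset.sum_of_injOn (fun p => join p.1 p.2) (join_injective.injOn) (by simp) ?_
      (fun _ _ => rfl)
    intro j _ hj
    rw [ev_tensor_eq_zero, zero_mul]
    rintro ⟨j₁, j₂, rfl⟩
    exact hj ⟨(j₁, j₂), by simp, rfl⟩
  rw [key]
  by_cases hl : ∃ l₁ l₂, l = join l₁ l₂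
  · obtain ⟨l₁, l₂, rfl⟩ := hl
    rw [ev_tensor_join, ev_comp, ev_comp, Finset.sum_mul_sum, Fintype.sum_prod_type]
    refine Finset.sum_congr rfl fun j₁ _ => Finset.sum_congr rfl fun j₂ _ => ?_
    rw [ev_tensor_join, ev_tensor_join]
    ring
  · rw [ev_tensor_eq_zero _ _ _ hl]
    refine Finset.sum_eq_zero fun p _ => ?_
    rw [ev_tensor_eq_zero _ _ _ hl, mul_zero]

end interchange

section strict

variable {mu la mu' la' mu'' la'' : Comp}

theorem ext_tensor {f g : SchurHom k mu la} (h : ∀ A, f A = g A) : f = g := Finsupp.ext h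

/-- Transport of matrices. -/
def castMat (hm : mu = mu') (hl : la = la') (A : Mat la mu) : Mat la' mu' :=
  hm ▸ hl ▸ A

theorem castMat_apply (hm : mu = mu') (hl : la = la') (A : Mat la mu) (i j) :
    (castMat hm hl A).1 i j =
      A.1 (Fin.cast (congrArg _ hl.symm) i) (Fin.cast (congrArg _ hm.symm) j) := by
  subst hm hl
  rfl

theorem castHom_xi (hm : mu = mu') (hl : la = la') (A : Mat la mu) :
    castHom (H := SchurHom k) hm hl (xi A) = xi (castMat hm hl A) := by
  subst hm hl
  rfl

theorem castHom_add (hm : mu = mu') (hl : la = la') (f g : SchurHom k mu la) :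
    castHom (H := SchurHom k) hm hl (f + g) = castHom hm hl f + castHom hm hl g := by
  subst hm hl
  rfl

theorem castHom_smul (hm : mu = mu') (hl : la = la') (r : k) (f : SchurHom k mu la) :
    castHom (H := SchurHom k) hm hl (r • f) = r • castHom (H := SchurHom k) hm hl f := by
  subst hm hl
  rfl

theorem castHom_zero (hm : mu = mu') (hl : la = la') :
    castHom (H := SchurHom k) hm hl 0 = 0 := by
  subst hm hl
  rfl

theorem zero_tensor (f' : SchurHom k mu' la') : tensor (0 : SchurHom k mu la) f' = 0 := by
  simp [tensor]

theorem tensor_zero (f : SchurHom k mu la) : tensor f (0 : SchurHom k mu' la') = 0 := by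
  simp [tensor, Finsupp.sum]

theorem induction_xi {p : SchurHom k mu la → Prop} (f : SchurHom k mu la) (h0 : p 0)
    (hadd : ∀ f g, p f → p g → p (f + g)) (hsmul : ∀ (r : k) (f), p f → p (r • f))
    (hxi : ∀ A, p (xi A)) : p f := by
  induction f using Finsupp.induction_linear with
  | zero => exact h0
  | add f g hf hg => exact hadd f g hf hg
  | single A a =>
    have hA : (Finsupp.single A a : SchurHom k mu la) = a • xi A := by simp [xi]
    rw [hA]
    exact hsmul _ _ (hxi A)

theorem blockDiag_assoc (A : Mat la mu) (B : Mat la' mu') (C : Mat la'' mu'') :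
    castMat (List.append_assoc _ _ _) (List.append_assoc _ _ _) ((A.blockDiag B).blockDiag C) =
      A.blockDiag (B.blockDiag C) := by
  have key : ∀ (x y z : Comp) (i : Fin (x ++ (y ++ z)).length), ∃ s : Fin x.length ⊕
      (Fin y.length ⊕ Fin z.length),
      i = Mat.appendIdx x (y ++ z) (Sum.map _root_.id (Mat.appendIdx y z) s) ∧
      Fin.cast (congrArg List.length (List.append_assoc x y z).symm) i =
        Mat.appendIdx (x ++ y) z
          (Sum.map (Mat.appendIdx x y) _root_.id ((Equiv.sumAssoc _ _ _).symm s)) := by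
    intro x y z i
    obtain ⟨i, rfl⟩ := (Mat.appendIdx x (y ++ z)).surjective i
    rcases i with i | i
    · refine ⟨.inl i, rfl, Fin.ext ?_⟩
      simp [Mat.appendIdx_inl_val]
    · obtain ⟨i, rfl⟩ := (Mat.appendIdx y z).surjective i
      rcases i with i | i
      · refine ⟨.inr (.inl i), rfl, Fin.ext ?_⟩
        simp [Mat.appendIdx_inl_val, Mat.appendIdx_inr_val]
      · refine ⟨.inr (.inr i), rfl, Fin.ext ?_⟩
        simp [Mat.appendIdx_inr_val, Nat.add_assoc]
  refine Mat.ext fun i j => ?_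
  rw [castMat_apply]
  obtain ⟨s, rfl, hs⟩ := key la la' la'' i
  obtain ⟨t, rfl, ht⟩ := key mu mu' mu'' j
  rw [hs, ht, Mat.blockDiag_apply, Mat.blockDiag_apply]
  rcases s with s | s | s <;> rcases t with t | t | t <;> simp [Mat.blockDiag_apply]

theorem tensor_assoc (f : SchurHom k mu la) (f' : SchurHom k mu' la')
    (f'' : SchurHom k mu'' la'') :
    castHom (H := SchurHom k) (List.append_assoc _ _ _) (List.append_assoc _ _ _)
      (tensor (tensor f f') f'') = tensor f (tensor f' f'') := by
  induction f using induction_xi with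
  | h0 => simp only [zero_tensor, castHom_zero]
  | hadd f g hf hg => simp only [add_tensor, castHom_add, hf, hg]
  | hsmul r f hf => simp only [smul_tensor, castHom_smul, hf]
  | hxi A =>
    induction f' using induction_xi with
    | h0 => simp only [zero_tensor, tensor_zero, castHom_zero]
    | hadd f g hf hg => simp only [add_tensor, tensor_add, castHom_add, hf, hg]
    | hsmul r f hf => simp only [smul_tensor, tensor_smul, castHom_smul, hf]
    | hxi B =>
      induction f'' using induction_xi with
      | h0 => simp only [tensor_zero, castHom_zero]
      | hadd f g hf hg => simp only [tensor_add, castHom_add, hf, hg]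
      | hsmul r f hf => simp only [tensor_smul, castHom_smul, hf]
      | hxi C => rw [tensor_xi, tensor_xi, tensor_xi, tensor_xi, castHom_xi, blockDiag_assoc]

theorem id_tensor_id (la la' : Comp) :
    tensor (k := k) (id la) (id la') = id (la ++ la') := by
  rw [id, id, id, tensor_xi]
  congr 1
  refine Mat.ext fun i j => ?_
  obtain ⟨i, rfl⟩ := (Mat.appendIdx la la').surjective i
  obtain ⟨j, rfl⟩ := (Mat.appendIdx la la').surjective j
  rw [Mat.blockDiag_apply]
  have h : (Mat.diag (la ++ la')).1 (Mat.appendIdx la la' i) (Mat.appendIdx la la' j) =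
      if i = j then ((la ++ la').get (Mat.appendIdx la la' i) : ℕ) else 0 := by
    simp only [Mat.diag, Matrix.diagonal_apply, EmbeddingLike.apply_eq_iff_eq]
  rw [h]
  rcases i with i | i <;> rcases j with j | j
  · rw [Mat.get_appendIdx_inl]; simp [Mat.diag, Matrix.diagonal_apply]
  · simp
  · simp
  · rw [Mat.get_appendIdx_inr]; simp [Mat.diag, Matrix.diagonal_apply]

theorem unit_tensor (f : SchurHom k mu la) : tensor (id []) f = f := by
  induction f using induction_xi with
  | h0 => exact tensor_zero _
  | hadd f g hf hg => exact (tensor_add _ _ _).trans (congrArg₂ _ hf hg)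
  | hsmul r f hf => exact (tensor_smul _ _ _).trans (congrArg _ hf)
  | hxi A =>
    rw [id, tensor_xi]
    refine congrArg xi (Mat.ext fun i j => ?_)
    have hi : i = Mat.appendIdx [] la (.inr i) := Fin.ext (by rw [Mat.appendIdx_inr_val]; simp)
    have hj : j = Mat.appendIdx [] mu (.inr j) := Fin.ext (by rw [Mat.appendIdx_inr_val]; simp)
    exact (congrArg₂ (Mat.blockDiag (Mat.diag []) A).1 hi hj).trans (Mat.blockDiag_apply _ _ _ _)

theorem tensor_unit (f : SchurHom k mu la) :
    castHom (H := SchurHom k) (List.append_nil _) (List.append_nil _) (tensor f (id [])) = f := by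
  induction f using induction_xi with
  | h0 => simp only [zero_tensor, castHom_zero]
  | hadd f g hf hg => simp only [add_tensor, castHom_add, hf, hg]
  | hsmul r f hf => simp only [smul_tensor, castHom_smul, hf]
  | hxi A =>
    rw [id, tensor_xi, castHom_xi]
    congr 1
    refine Mat.ext fun i j => ?_
    rw [castMat_apply]
    have hi : Fin.cast (congrArg List.length (List.append_nil la).symm) i =
        Mat.appendIdx la [] (.inl i) := Fin.ext (by rw [Mat.appendIdx_inl_val]; simp)
    have hj : Fin.cast (congrArg List.length (List.append_nil mu).symm) j =
        Mat.appendIdx mu [] (.inl j) := Fin.ext (by rw [Mat.appendIdx_inl_val]; simp)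
    rw [hi, hj, Mat.blockDiag_apply]
    rfl

end strict

end SchurHom

/-- The Schur category, as a strict monoidal category. -/
noncomputable def schurCat (k : Type u) [CommRing k] : CompCat k where
  Hom := SchurHom k
  id := SchurHom.id
  comp := SchurHom.comp
  tensor := SchurHom.tensor
  id_comp := SchurHom.id_comp
  comp_id := SchurHom.comp_id
  assoc := SchurHom.comp_assoc
  add_comp := SchurHom.add_comp
  comp_add := SchurHom.comp_add
  smul_comp := SchurHom.smul_comp
  comp_smul := SchurHom.comp_smul
  id_tensor_id := SchurHom.id_tensor_id
  interchange := SchurHom.interchange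
  tensor_assoc := SchurHom.tensor_assoc
  unit_tensor := SchurHom.unit_tensor
  tensor_unit := SchurHom.tensor_unit
  add_tensor := SchurHom.add_tensor
  tensor_add := SchurHom.tensor_add
  smul_tensor := SchurHom.smul_tensor
  tensor_smul := SchurHom.tensor_smul

/-- The Schur category. -/
abbrev Schur (k : Type u) [CommRing k] : Type := (schurCat k).Obj

/-- Schur's basis element labelled by `A`, as a morphism of the Schur category. -/
noncomputable def xi (k : Type u) [CommRing k] {la mu : Comp} (A : Mat la mu) :
    (schurCat k).of mu ⟶ (schurCat k).of la :=
  (schurCat k).hom (SchurHom.xi A : SchurHom k mu la)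

/-! Chicken foot diagrams -/

/-- A non-empty sequence of thicknesses, i.e., of the strings meeting at one vertex. -/
abbrev Block : Type := ℕ+ × List ℕ+

namespace Block

/-- The sum of the thicknesses `a, l`. -/
def total : ℕ+ → List ℕ+ → ℕ+
  | a, [] => a
  | a, b :: l => a + total b l

/-- The composition recording the thicknesses at the vertices. -/
def totals : List Block → Comp
  | [] => []
  | (a, l) :: B => [total a l] ++ totals B

/-- The composition recording the thicknesses of all of the thinner strings. -/
def flat : List Block → Comp
  | [] => []
  | (a, l) :: B => (a :: l) ++ flat B

/-- For each of the thinner strings in order, the index of its vertex, when the first vertex has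
index `n`. -/
def vertices : ℕ → List Block → List ℕ
  | _, [] => []
  | n, (_, l) :: B => List.replicate (l.length + 1) n ++ vertices (n + 1) B

end Block

namespace Term

variable {k : Type u}

/-- The `n`-fold merge. -/
def mergeFold : (a : ℕ+) → (l : List ℕ+) → Term k (a :: l) [Block.total a l]
  | a, [] => id [a]
  | a, b :: l =>
      comp (Y := [a, Block.total b l]) (tensor (id [a]) (mergeFold b l))
        (merge a (Block.total b l))

/-- The `n`-fold split. -/
def splitFold : (a : ℕ+) → (l : List ℕ+) → Term k [Block.total a l] (a :: l)
  | a, [] => id [a]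
  | a, b :: l =>
      comp (Y := [a, Block.total b l]) (split a (Block.total b l))
        (tensor (id [a]) (splitFold b l))

/-- The tensor product of the `n`-fold merges of all blocks. -/
def merges : (B : List Block) → Term k (Block.flat B) (Block.totals B)
  | [] => id []
  | (a, l) :: B => tensor (mergeFold a l) (merges B)

/-- The tensor product of the `n`-fold splits of all blocks. -/
def splits : (B : List Block) → Term k (Block.totals B) (Block.flat B)
  | [] => id []
  | (a, l) :: B => tensor (splitFold a l) (splits B)

end Term

/-- Swap the entries of a list in positions `p` and `p + 1` (counted from zero). -/
def swapAt {α : Type} : ℕ → List α → List α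
  | 0, a :: b :: l => b :: a :: l
  | p + 1, a :: l => a :: swapAt p l
  | _, l => l

/-- Perform successively the swaps in the positions listed in a word. -/
def applyWord {α : Type} : List ℕ → List α → List α
  | [], l => l
  | p :: w, l => applyWord w (swapAt p l)

/-- The list of pairs of labels of strings that cross, one pair for each of the crossings in the
diagram of a word, when the strings at the bottom are labelled by the entries of a list. -/
def crossings : List ℕ → List ℕ → List (Sym2 ℕ)
  | [], _ => []
  | p :: w, l => s(l.getD p 0, l.getD (p + 1) 0) :: crossings w (swapAt p l)

namespace Term

variable {k : Type u}

/-- The thick crossing of the strings in positions `p` and `p + 1`. -/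
def crossAt : (p : ℕ) → (X : Comp) → Term k X (swapAt p X)
  | 0, a :: b :: X => tensor (cross a b) (id X)
  | p + 1, a :: X => tensor (id [a]) (crossAt p X)
  | 0, [] => id []
  | 0, [a] => id [a]
  | _ + 1, [] => id []

/-- The generalized permutation diagram of a word in the positions of the crossings, read from
bottom to top. -/
def crossWord : (w : List ℕ) → (X : Comp) → Term k X (applyWord w X)
  | [], X => id X
  | p :: w, X => comp (crossAt p X) (crossWord w (swapAt p X))

end Term

/-- A chicken foot diagram from `mu` (at the bottom) to `la` (at the top): the strings of
thicknesses `mu` split into thinner strings, which cross each other according to a word recording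
the positions of the successive crossings, and then merge into the strings of thicknesses `la`. -/
structure ChickenFoot (mu la : Comp) where
  bottom : List Block
  word : List ℕ
  top : List Block
  bottom_eq : Block.totals bottom = mu
  top_eq : Block.totals top = la
  word_lt : ∀ p ∈ word, p + 1 < (Block.flat bottom).length
  word_eq : applyWord word (Block.flat bottom) = Block.flat top

namespace ChickenFoot

variable {mu la : Comp} (D : ChickenFoot mu la)

/-- The expression given by a chicken foot diagram. -/
def term (k : Type u) : Term k mu la :=
  castHom D.bottom_eq D.top_eq <|
    .comp (.splits D.bottom) <|
      .comp (castHom rfl D.word_eq (.crossWord D.word (Block.flat D.bottom))) <|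
        .merges D.top

/-- The morphism of the web category defined by a chicken foot diagram. -/
def toWeb (k : Type u) [CommRing k] : (webCat k).of mu ⟶ (webCat k).of la :=
  (D.term k).toWeb

/-- The number of thinner strings. They are numbered from left to right as they appear at the
bottom, starting from zero. -/
def numStrings : ℕ := (Block.flat D.bottom).length

/-- The thickness of the string number `p`. -/
def thickness (p : ℕ) : ℕ := ((Block.flat D.bottom).map PNat.val).getD p 0

/-- The index of the vertex at the bottom to which string number `p` is attached. -/
def bottomVertex (p : ℕ) : ℕ := (Block.vertices 0 D.bottom).getD p 0

/-- The index of the vertex at the top to which string number `p` is attached, which is obtained by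
following the strings from the top down to the bottom. -/
def topVertex (p : ℕ) : ℕ := (applyWord D.word.reverse (Block.vertices 0 D.top)).getD p 0

/-- The number of crossings between strings number `p` and `q`. -/
def numCrossings (p q : ℕ) : ℕ :=
  (crossings D.word (List.range D.numStrings)).count s(p, q)

/-- A chicken foot diagram is reduced if there is at most one intersection or join between every
pair of distinct thinner strings. -/
def IsReduced : Prop :=
  ∀ p q, p < q → q < D.numStrings →
    D.numCrossings p q + (if D.bottomVertex p = D.bottomVertex q then 1 else 0) +
      (if D.topVertex p = D.topVertex q then 1 else 0) ≤ 1

/-- A chicken foot diagram is of type `A` if for all `i, j` the entry of `A` at `(i, j)` is the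
(total) thickness of the strings connecting the vertex `i` at the top to the vertex `j` at the
bottom. In a reduced diagram there is at most one such string. -/
def HasType (A : Mat la mu) : Prop :=
  ∀ i j, A.val i j = ∑ p ∈ Finset.range D.numStrings,
    if D.topVertex p = i.val ∧ D.bottomVertex p = j.val then D.thickness p else 0

end ChickenFoot

/-- The matrix `(a b)`. -/
def mergeMat (a b : ℕ+) : Mat [a + b] [a, b] where
  val := !![(a : ℕ), (b : ℕ)]
  row_sum := by
    change ∀ i : Fin 1, ∑ j : Fin 2, !![(a : ℕ), (b : ℕ)] i j = (([a + b] : Comp).get i : ℕ)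
    intro i; fin_cases i; simp [Fin.sum_univ_two]
  col_sum := by
    change ∀ j : Fin 2, ∑ i : Fin 1, !![(a : ℕ), (b : ℕ)] i j = (([a, b] : Comp).get j : ℕ)
    intro j; fin_cases j <;> simp

/-- The column matrix with entries `a, b`. -/
def splitMat (a b : ℕ+) : Mat [a, b] [a + b] where
  val := !![(a : ℕ); (b : ℕ)]
  row_sum := by
    change ∀ i : Fin 2, ∑ j : Fin 1, !![(a : ℕ); (b : ℕ)] i j = (([a, b] : Comp).get i : ℕ)
    intro i; fin_cases i <;> simp
  col_sum := by
    change ∀ j : Fin 1, ∑ i : Fin 2, !![(a : ℕ); (b : ℕ)] i j = (([a + b] : Comp).get j : ℕ)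
    intro j; fin_cases j; simp [Fin.sum_univ_two]

/-- The matrix with rows `(0 b)` and `(a 0)`. -/
def crossMat (a b : ℕ+) : Mat [b, a] [a, b] where
  val := !![0, (b : ℕ); (a : ℕ), 0]
  row_sum := by
    change ∀ i : Fin 2, ∑ j : Fin 2, !![0, (b : ℕ); (a : ℕ), 0] i j =
      (([b, a] : Comp).get i : ℕ)
    intro i; fin_cases i <;> simp [Fin.sum_univ_two]
  col_sum := by
    change ∀ j : Fin 2, ∑ i : Fin 2, !![0, (b : ℕ); (a : ℕ), 0] i j =
      (([a, b] : Comp).get j : ℕ)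
    intro j; fin_cases j <;> simp [Fin.sum_univ_two]

end SchurWeb

open SchurWeb

/-!
The functor `F` is evaluation: a diagram is an expression in merges, splits and crossings, and each
of these has a prescribed value in the Schur category. It has to be shown that evaluation respects
the defining relations of webs, that it takes reduced chicken foot diagrams to the basis elements
`ξ_A`, and that it is bijective on morphism spaces.

*Values.* A morphism of the Schur category is tested on pairs of tuples of strings. Merges and
crossings are given by maps from the strings at the bottom to those at the top
(`SchurHom.IsFun`), splits by maps in the other direction (`SchurHom.IsCofun`), and both kinds are
closed under composition and tensor product. A split followed by a map which separates strings with
the same source has a single basis element as its value (`SchurHom.IsCofun.comp_isFun`), since the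
tuple in the middle of Schur's product rule is unique. This applies to the ladders of the
merge-split relation, which leads to `Term.eval_eq`, and to all reduced chicken foot diagrams
(`ChickenFoot.IsReduced.eval_term`).

*Surjectivity.* A reduced diagram of type `A` has one string for each nonzero entry of `A`. The
strings are ordered by columns at the bottom and by rows at the top, and insertion sort provides
the crossings (`exists_reduced`). So every `ξ_A` is a value.

*Injectivity.* It suffices that the morphisms from `mu` to `la` in the web category are spanned by
a family indexed by the matrices with row sums `la` and column sums `mu`
(`WebHom.exists_span_eq_top`). This is proved in an abstract `WebModel`, in which strings of
thickness zero are allowed and the relations take a uniform shape. Associativity and the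
merge-split relation force crossings to slide through merges and splits (`WebModel.sliders`): a
double merge followed by a split has two expansions, whose terms agree in pairs by induction on the
thickness, except for one pair, which then agrees as well. Likewise a crossing is absorbed by the
merge of its strings (`WebModel.X_M`), by Vandermonde's identity. The normal form of a matrix
extracts its rows one after the other from the strings at the bottom (`WebModel.extract`,
`WebModel.normalForm`). By the sliding relations the span of the normal forms is preserved by
composition with splits and merges (`WebModel.stable_S`, `WebModel.stable_M`), hence with
crossings (`WebModel.stable_X`). It contains the identities, so it is everything. A surjection
onto a space whose dimension is the number of these matrices is then bijective.
-/

namespace SchurWeb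

/-! ### Webs with strings of thickness zero -/

/-- The part of the structure of the web category that the spanning argument uses, with strings of
thickness zero allowed. An object is a list of thicknesses; `comp f g` is `f` followed by `g`;
`wl a` juxtaposes a string of thickness `a` on the left. The merges `M a b n Z`, the splits
`S n a b Z` and the crossings `X a b Z` act on the leftmost strings and leave the strings of `Z`
alone. The thickness `n` of the thick string is an independent parameter, so that no composition
has to be transported along an equality of thicknesses: a merge or split with `a + b ≠ n` is zero.
The mutually inverse `del` and `ins` remove and create a leftmost string of thickness zero. The
relations between merges and splits are required for positive thicknesses only. -/
structure WebModel (k : Type u) [CommRing k] where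
  Hom : List ℕ → List ℕ → Type u
  [addCommGroup : ∀ X Y, AddCommGroup (Hom X Y)]
  [module : ∀ X Y, Module k (Hom X Y)]
  id : ∀ X, Hom X X
  comp : ∀ {X Y Z}, Hom X Y → Hom Y Z → Hom X Z
  id_comp : ∀ {X Y} (f : Hom X Y), comp (id X) f = f
  comp_id : ∀ {X Y} (f : Hom X Y), comp f (id Y) = f
  assoc : ∀ {X Y Z W} (f : Hom X Y) (g : Hom Y Z) (h : Hom Z W),
    comp (comp f g) h = comp f (comp g h)
  add_comp : ∀ {X Y Z} (f f' : Hom X Y) (g : Hom Y Z),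
    comp (f + f') g = comp f g + comp f' g
  comp_add : ∀ {X Y Z} (f : Hom X Y) (g g' : Hom Y Z),
    comp f (g + g') = comp f g + comp f g'
  smul_comp : ∀ {X Y Z} (r : k) (f : Hom X Y) (g : Hom Y Z),
    comp (r • f) g = r • comp f g
  comp_smul : ∀ {X Y Z} (r : k) (f : Hom X Y) (g : Hom Y Z),
    comp f (r • g) = r • comp f g
  wl : ∀ (a : ℕ) {X Y}, Hom X Y → Hom (a :: X) (a :: Y)
  wl_id : ∀ a X, wl a (id X) = id (a :: X)
  wl_comp : ∀ a {X Y Z} (f : Hom X Y) (g : Hom Y Z), wl a (comp f g) = comp (wl a f) (wl a g)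
  wl_add : ∀ a {X Y} (f g : Hom X Y), wl a (f + g) = wl a f + wl a g
  wl_smul : ∀ a {X Y} (r : k) (f : Hom X Y), wl a (r • f) = r • wl a f
  del : ∀ Z, Hom (0 :: Z) Z
  ins : ∀ Z, Hom Z (0 :: Z)
  del_ins : ∀ Z, comp (del Z) (ins Z) = id _
  ins_del : ∀ Z, comp (ins Z) (del Z) = id _
  del_nat : ∀ {Z Z'} (f : Hom Z Z'), comp (del Z) f = comp (wl 0 f) (del Z')
  M : ∀ a b n Z, Hom (a :: b :: Z) (n :: Z)
  S : ∀ n a b Z, Hom (n :: Z) (a :: b :: Z)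
  X : ∀ a b Z, Hom (a :: b :: Z) (b :: a :: Z)
  M_nat : ∀ a b n {Z Z'} (f : Hom Z Z'),
    comp (M a b n Z) (wl n f) = comp (wl a (wl b f)) (M a b n Z')
  S_nat : ∀ n a b {Z Z'} (f : Hom Z Z'),
    comp (S n a b Z) (wl a (wl b f)) = comp (wl n f) (S n a b Z')
  X_nat : ∀ a b {Z Z'} (f : Hom Z Z'),
    comp (X a b Z) (wl b (wl a f)) = comp (wl a (wl b f)) (X a b Z')
  M_ne : ∀ a b n Z, a + b ≠ n → M a b n Z = 0
  S_ne : ∀ n a b Z, a + b ≠ n → S n a b Z = 0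
  M_zero_left : ∀ b Z, M 0 b b Z = del (b :: Z)
  M_zero_right : ∀ a Z, M a 0 a Z = wl a (del Z)
  S_zero_left : ∀ b Z, S b 0 b Z = ins (b :: Z)
  S_zero_right : ∀ a Z, S a a 0 Z = wl a (ins Z)
  X_zero_left : ∀ b Z, X 0 b Z = comp (del (b :: Z)) (wl b (ins Z))
  X_zero_right : ∀ a Z, X a 0 Z = comp (wl a (del Z)) (ins (a :: Z))
  M_assoc_pos : ∀ a b c e f n Z, 0 < a → 0 < b → 0 < c → a + b = e → b + c = f →
    comp (M a b e (c :: Z)) (M e c n Z) = comp (wl a (M b c f Z)) (M a f n Z)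
  S_assoc_pos : ∀ a b c e f n Z, 0 < a → 0 < b → 0 < c → a + b = e → b + c = f →
    comp (S n e c Z) (S e a b (c :: Z)) = comp (S n a f Z) (wl a (S f b c Z))
  digon_pos : ∀ n a b Z, 0 < a → 0 < b → a + b = n →
    comp (S n a b Z) (M a b n Z) = (Nat.choose n a : k) • id (n :: Z)
  merge_split_pos : ∀ a c n b d Z, 0 < a → 0 < b → 0 < c → 0 < d → a + c = n → b + d = n →
    comp (M a c n Z) (S n b d Z) =
      ∑ P ∈ Finset.HasAntidiagonal.antidiagonal a, ∑ Q ∈ Finset.HasAntidiagonal.antidiagonal c,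
        comp (S a P.1 P.2 (c :: Z)) (comp (wl P.1 (wl P.2 (S c Q.1 Q.2 Z)))
          (comp (wl P.1 (X P.2 Q.1 (Q.2 :: Z))) (comp (M P.1 Q.1 b (P.2 :: Q.2 :: Z))
            (wl b (M P.2 Q.2 d Z)))))

namespace WebModel

variable {k : Type u} [CommRing k] (W : WebModel k)

attribute [instance] addCommGroup module

local notation:80 f:81 " ⋗ " g:80 => WebModel.comp _ f g

variable {W}

theorem reassoc {X Y Z : List ℕ} {f : W.Hom X Y} {g : W.Hom Y Z} {h : W.Hom X Z}
    (e : f ⋗ g = h) {V : List ℕ} (t : W.Hom Z V) : f ⋗ g ⋗ t = h ⋗ t := by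
  rw [← e, W.assoc]

theorem comp_zero {X Y Z : List ℕ} (f : W.Hom X Y) : f ⋗ (0 : W.Hom Y Z) = 0 := by
  simpa using W.comp_smul 0 f 0

theorem zero_comp {X Y Z : List ℕ} (f : W.Hom Y Z) : (0 : W.Hom X Y) ⋗ f = 0 := by
  simpa using W.smul_comp 0 0 f

theorem wl_zero (a : ℕ) {X Y : List ℕ} : W.wl a (0 : W.Hom X Y) = 0 := by
  simpa using W.wl_smul a 0 (0 : W.Hom X Y)

/-- Postcomposition as a linear map. -/
def compRight {X Y Z : List ℕ} (g : W.Hom Y Z) : W.Hom X Y →ₗ[k] W.Hom X Z where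
  toFun f := f ⋗ g
  map_add' f f' := W.add_comp f f' g
  map_smul' r f := W.smul_comp r f g

/-- Precomposition as a linear map. -/
def compLeft {X Y Z : List ℕ} (f : W.Hom X Y) : W.Hom Y Z →ₗ[k] W.Hom X Z where
  toFun g := f ⋗ g
  map_add' g g' := W.comp_add f g g'
  map_smul' r g := W.comp_smul r f g

/-- Juxtaposition of a string on the left as a linear map. -/
def wlLin (a : ℕ) {X Y : List ℕ} : W.Hom X Y →ₗ[k] W.Hom (a :: X) (a :: Y) where
  toFun f := W.wl a f
  map_add' f g := W.wl_add a f g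
  map_smul' r f := W.wl_smul a r f

theorem sum_comp {ι : Type*} (s : Finset ι) {X Y Z : List ℕ} (f : ι → W.Hom X Y) (g : W.Hom Y Z) :
    (∑ i ∈ s, f i) ⋗ g = ∑ i ∈ s, f i ⋗ g := map_sum (compRight g) f s

theorem comp_sum {ι : Type*} (s : Finset ι) {X Y Z : List ℕ} (f : W.Hom X Y) (g : ι → W.Hom Y Z) :
    f ⋗ (∑ i ∈ s, g i) = ∑ i ∈ s, f ⋗ g i := map_sum (compLeft f) g s

theorem wl_sum {ι : Type*} (s : Finset ι) (a : ℕ) {X Y : List ℕ} (f : ι → W.Hom X Y) :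
    W.wl a (∑ i ∈ s, f i) = ∑ i ∈ s, W.wl a (f i) := map_sum (wlLin a) f s

theorem ins_nat {Z Z' : List ℕ} (f : W.Hom Z Z') : f ⋗ W.ins Z' = W.ins Z ⋗ W.wl 0 f := by
  have h := congrArg (fun t => W.ins Z ⋗ t ⋗ W.ins Z') (W.del_nat f)
  simp only [W.assoc, W.del_ins, W.comp_id] at h
  rwa [reassoc (W.ins_del Z), W.id_comp] at h

theorem ins_ins (Z : List ℕ) : W.ins (0 :: Z) = W.wl 0 (W.ins Z) := by
  have h := congrArg (fun t => W.del Z ⋗ t) (ins_nat (W.ins Z))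
  simp only [← W.assoc, W.del_ins, W.id_comp] at h
  exact h

/-- The reflection of a ladder in a horizontal line is the ladder with `p'` and `q` interchanged,
up to the order in which distant merges and splits are performed. -/
theorem ladder_reflect (a b c d p p' q q' : ℕ) (Z : List ℕ) :
    W.S b p p' (d :: Z) ⋗ W.wl p (W.wl p' (W.S d q q' Z)) ⋗ W.wl p (W.X p' q (q' :: Z)) ⋗
      W.M p q a (p' :: q' :: Z) ⋗ W.wl a (W.M p' q' c Z) =
    (((W.wl b (W.S d q q' Z) ⋗ W.S b p p' (q :: q' :: Z)) ⋗ W.wl p (W.X p' q (q' :: Z))) ⋗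
      W.wl p (W.wl q (W.M p' q' c Z))) ⋗ W.M p q a (c :: Z) := by
  simp only [W.assoc]
  rw [W.M_nat, reassoc (W.S_nat _ _ _ _), W.assoc]

/-- The model in which all diagrams are reflected in a horizontal line. -/
def op (W : WebModel k) : WebModel k where
  Hom X Y := W.Hom Y X
  addCommGroup X Y := W.addCommGroup Y X
  module X Y := W.module Y X
  id := W.id
  comp f g := W.comp g f
  id_comp f := W.comp_id f
  comp_id f := W.id_comp f
  assoc f g h := (W.assoc h g f).symm
  add_comp f f' g := W.comp_add g f f'
  comp_add f g g' := W.add_comp g g' f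
  smul_comp r f g := W.comp_smul r g f
  comp_smul r f g := W.smul_comp r g f
  wl a _ _ f := W.wl a f
  wl_id := W.wl_id
  wl_comp a _ _ _ f g := W.wl_comp a g f
  wl_add a _ _ := W.wl_add a
  wl_smul a _ _ := W.wl_smul a
  del := W.ins
  ins := W.del
  del_ins := W.del_ins
  ins_del := W.ins_del
  del_nat f := ins_nat (W := W) f
  M a b n Z := W.S n a b Z
  S n a b Z := W.M a b n Z
  X a b Z := W.X b a Z
  M_nat a b n _ _ f := (W.S_nat n a b f).symm
  S_nat n a b _ _ f := (W.M_nat a b n f).symm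
  X_nat a b _ _ f := (W.X_nat b a f).symm
  M_ne a b n Z h := W.S_ne n a b Z h
  S_ne n a b Z h := W.M_ne a b n Z h
  M_zero_left := W.S_zero_left
  M_zero_right := W.S_zero_right
  S_zero_left := W.M_zero_left
  S_zero_right := W.M_zero_right
  X_zero_left := W.X_zero_right
  X_zero_right := W.X_zero_left
  M_assoc_pos := W.S_assoc_pos
  S_assoc_pos := W.M_assoc_pos
  digon_pos := W.digon_pos
  merge_split_pos a c n b d Z ha hb hc hd h h' := by
    refine (W.merge_split_pos b d n a c Z hb ha hd hc h' h).trans ?_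
    rw [← Finset.sum_product', ← Finset.sum_product']
    refine Finset.sum_bij_ne_zero (fun T _ _ => ((T.1.1, T.2.1), (T.1.2, T.2.2))) ?_ ?_ ?_ ?_
    -- A nonzero summand has the right thicknesses at the top as well as at the bottom.
    · rintro ⟨⟨p, p'⟩, ⟨q, q'⟩⟩ _ h0
      simp only [Finset.mem_product, Finset.HasAntidiagonal.mem_antidiagonal]
      refine ⟨?_, ?_⟩ <;> by_contra h1 <;> apply h0
      · rw [W.M_ne _ _ _ _ h1]; simp only [zero_comp, comp_zero]
      · rw [W.M_ne _ _ _ _ h1]; simp only [wl_zero, comp_zero]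
    · rintro ⟨⟨p, p'⟩, ⟨q, q'⟩⟩ _ _ ⟨⟨r, r'⟩, ⟨s, s'⟩⟩ _ _ h2
      simp only [Prod.mk.injEq] at h2 ⊢
      tauto
    · rintro ⟨⟨p, q⟩, ⟨p', q'⟩⟩ hm h0
      have e := (ladder_reflect (W := W) a b c d p p' q q' Z).symm
      refine ⟨((p, p'), (q, q')), ?_, fun h1 => h0 (e.trans h1), rfl⟩
      simp only [Finset.mem_product, Finset.HasAntidiagonal.mem_antidiagonal]
      refine ⟨?_, ?_⟩ <;> by_contra h1 <;> apply h0 <;> refine e.trans ?_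
      · rw [W.S_ne _ _ _ _ h1]; simp only [zero_comp]
      · rw [W.S_ne _ _ _ _ h1]; simp only [wl_zero, zero_comp, comp_zero]
    · rintro ⟨⟨p, p'⟩, ⟨q, q'⟩⟩ hm h0
      exact ladder_reflect (W := W) a b c d p p' q q' Z

theorem M_assoc {a b c e f : ℕ} (n : ℕ) (Z : List ℕ) (h : a + b = e) (h' : b + c = f) :
    W.M a b e (c :: Z) ⋗ W.M e c n Z = W.wl a (W.M b c f Z) ⋗ W.M a f n Z := by
  by_cases hn : e + c = n
  swap
  · rw [W.M_ne _ _ _ _ hn, W.M_ne a f n Z (by omega), comp_zero, comp_zero]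
  rcases Nat.eq_zero_or_pos a with rfl | ha
  · obtain rfl : b = e := by omega
    obtain rfl : f = n := by omega
    rw [W.M_zero_left, W.M_zero_left, W.del_nat]
  rcases Nat.eq_zero_or_pos b with rfl | hb
  · obtain rfl : a = e := by omega
    obtain rfl : c = f := by omega
    rw [W.M_zero_left, W.M_zero_right]
  rcases Nat.eq_zero_or_pos c with rfl | hc
  · obtain rfl : b = f := by omega
    obtain rfl : e = n := by omega
    rw [W.M_zero_right, W.M_zero_right, W.M_nat]
  exact W.M_assoc_pos a b c _ _ _ Z ha hb hc h h'

theorem S_assoc {a b c e f : ℕ} (n : ℕ) (Z : List ℕ) (h : a + b = e) (h' : b + c = f) :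
    W.S n e c Z ⋗ W.S e a b (c :: Z) = W.S n a f Z ⋗ W.wl a (W.S f b c Z) :=
  M_assoc (W := W.op) n Z h h'

theorem digon (n a b : ℕ) (Z : List ℕ) (h : a + b = n) :
    W.S n a b Z ⋗ W.M a b n Z = (Nat.choose n a : k) • W.id (n :: Z) := by
  rcases Nat.eq_zero_or_pos a with rfl | ha
  · obtain rfl : b = n := by omega
    rw [W.M_zero_left, W.S_zero_left, W.ins_del]; simp
  rcases Nat.eq_zero_or_pos b with rfl | hb
  · obtain rfl : a = n := by omega
    rw [W.M_zero_right, W.S_zero_right, ← W.wl_comp, W.ins_del, W.wl_id]; simp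
  exact W.digon_pos _ _ _ _ ha hb h

/-- The summand of the merge-split relation in which the strings `a` and `c` at the bottom split as
`a = p + p'` and `c = q + q'`, the strings `p'` and `q` cross, and the four strings merge to
`b = p + q` and `d = p' + q'` at the top. It is zero unless these four equations hold. -/
def ladder (W : WebModel k) (a c b d p p' q q' : ℕ) (Z : List ℕ) :
    W.Hom (a :: c :: Z) (b :: d :: Z) :=
  W.S a p p' (c :: Z) ⋗ W.wl p (W.wl p' (W.S c q q' Z)) ⋗ W.wl p (W.X p' q (q' :: Z)) ⋗
    W.M p q b (p' :: q' :: Z) ⋗ W.wl b (W.M p' q' d Z)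

theorem ladder_ne {a c b d p p' q q' : ℕ} (Z : List ℕ)
    (h : ¬ (p + p' = a ∧ q + q' = c ∧ p + q = b ∧ p' + q' = d)) :
    W.ladder a c b d p p' q q' Z = 0 := by
  unfold ladder
  by_cases h1 : p + p' = a
  · by_cases h2 : q + q' = c
    · by_cases h3 : p + q = b
      · rw [W.M_ne p' q' d Z (by tauto), wl_zero]; simp only [comp_zero]
      · rw [W.M_ne p q b _ h3]; simp only [comp_zero, zero_comp]
    · rw [W.S_ne _ _ _ _ h2]; simp only [comp_zero, zero_comp, wl_zero]
  · rw [W.S_ne _ _ _ _ h1]; simp only [zero_comp]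

theorem ladder_left {a c n : ℕ} (Z : List ℕ) :
    W.ladder a c 0 n 0 a 0 c Z = W.M a c n Z ⋗ W.ins (n :: Z) := by
  rw [ladder, S_zero_left, S_zero_left, X_zero_right, M_zero_left, reassoc (ins_nat _).symm,
    W.wl_comp, W.assoc, W.assoc, reassoc (ins_nat _).symm, W.assoc, reassoc (ins_nat _).symm,
    W.assoc, reassoc (W.ins_del _), W.id_comp, reassoc (W.wl_comp _ _ _).symm, W.ins_del, W.wl_id,
    W.id_comp, ins_nat]

theorem ladder_right {a c n : ℕ} (Z : List ℕ) :
    W.ladder a c n 0 a 0 c 0 Z = W.M a c n Z ⋗ W.wl n (W.ins Z) := by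
  rw [ladder, S_zero_right, S_zero_right, X_zero_left, M_zero_left, M_nat, M_nat]
  rw [reassoc (W.wl_comp _ _ _).symm, reassoc (W.wl_comp _ _ _).symm,
    reassoc (W.wl_comp _ _ _).symm]
  congr 2
  simp only [W.assoc]
  rw [← W.wl_comp, W.ins_del, W.wl_id, W.comp_id, reassoc (ins_nat _).symm, W.assoc,
    W.ins_del, W.comp_id]

theorem ladder_X {a c : ℕ} (Z : List ℕ) : W.ladder a c c a 0 a c 0 Z = W.X a c Z := by
  rw [ladder, S_zero_left, S_zero_right, M_zero_left, M_zero_right, reassoc (ins_nat _).symm,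
    W.assoc, reassoc (ins_nat _).symm, W.assoc, reassoc (W.ins_del _), W.id_comp, W.X_nat,
    reassoc (W.wl_comp _ _ _).symm, ← W.wl_comp, W.ins_del, W.wl_id, W.wl_id, W.id_comp]

/-- The merge-split relation, with all thicknesses allowed to be zero. As the ladders with wrong
thicknesses vanish, the sum may range over all splittings of the two bottom strings. -/
theorem merge_split (a c n b d : ℕ) (Z : List ℕ) (h : a + c = n) :
    W.M a c n Z ⋗ W.S n b d Z =
      ∑ T ∈ Finset.HasAntidiagonal.antidiagonal a ×ˢ Finset.HasAntidiagonal.antidiagonal c,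
        W.ladder a c b d T.1.1 T.1.2 T.2.1 T.2.2 Z := by
  by_cases h' : b + d = n
  swap
  · rw [W.S_ne _ _ _ _ h', comp_zero, Finset.sum_eq_zero]
    rintro ⟨⟨p, p'⟩, ⟨q, q'⟩⟩ hT
    simp only [Finset.mem_product, Finset.HasAntidiagonal.mem_antidiagonal] at hT
    exact ladder_ne Z (by simp only; omega)
  -- If one of the four outer thicknesses is zero, only one ladder has the right thicknesses.
  have one : ∀ p p' q q', p + p' = a → q + q' = c →
      (∀ r r' s s', r + r' = a → s + s' = c → r + s = b → r' + s' = d → r = p ∧ s = q) →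
      ∑ T ∈ Finset.HasAntidiagonal.antidiagonal a ×ˢ Finset.HasAntidiagonal.antidiagonal c,
        W.ladder a c b d T.1.1 T.1.2 T.2.1 T.2.2 Z = W.ladder a c b d p p' q q' Z := by
    intro p p' q q' h1 h2 h3
    rw [Finset.sum_eq_single ((p, p'), (q, q'))]
    · rintro ⟨⟨r, r'⟩, ⟨s, s'⟩⟩ hT hne
      simp only [Finset.mem_product, Finset.HasAntidiagonal.mem_antidiagonal] at hT
      refine ladder_ne Z fun h4 => hne ?_
      have := h3 r r' s s' hT.1 hT.2 h4.2.2.1 h4.2.2.2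
      simp only [Prod.mk.injEq]
      simp only at h4
      omega
    · intro h4
      simp only [Finset.mem_product, Finset.HasAntidiagonal.mem_antidiagonal, h1, h2] at h4
      tauto
  rcases Nat.eq_zero_or_pos a with rfl | ha
  · obtain rfl : c = n := by omega
    rw [one 0 0 b d rfl h' (by intros; omega), ladder, S_zero_left, W.X_zero_left, M_zero_left,
      M_zero_left, M_zero_left]
    rw [reassoc (ins_nat _).symm, W.wl_comp, W.assoc, W.assoc, reassoc (ins_nat _).symm, W.assoc,
      reassoc (ins_nat _).symm, W.assoc, reassoc (W.ins_del _), W.id_comp, ← W.wl_comp, W.ins_del,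
      W.wl_id, W.comp_id, W.del_nat]
  rcases Nat.eq_zero_or_pos b with rfl | hb
  · obtain rfl : d = n := by omega
    rw [one 0 a 0 c (by omega) (by omega) (by intros; omega), ladder_left, S_zero_left]
  rcases Nat.eq_zero_or_pos c with rfl | hc
  · obtain rfl : a = n := by omega
    rw [one b d 0 0 (by omega) (by omega) (by intros; omega), ladder, S_zero_left, X_zero_right,
      M_zero_right, M_zero_right, M_zero_right, ← W.S_nat]
    simp only [← W.wl_comp]
    rw [W.assoc, reassoc (W.ins_del _), W.id_comp, reassoc (W.wl_comp _ _ _).symm, W.ins_del,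
      W.wl_id, W.id_comp]
  rcases Nat.eq_zero_or_pos d with rfl | hd
  · obtain rfl : b = n := by omega
    rw [one a 0 c 0 (by omega) (by omega) (by intros; omega), ladder_right, S_zero_right]
  rw [W.merge_split_pos a c n b d Z ha hb hc hd h h', ← Finset.sum_product']
  rfl

end WebModel
end SchurWeb

namespace SchurWeb

/-! ### Crossings slide through merges and splits -/
namespace WebModel

variable {k : Type u} [CommRing k] {W : WebModel k}
local notation:80 f:81 " ⋗ " g:80 => WebModel.comp _ f g

/-- A double sum collapses if its summand vanishes unless the first index is the value of `φ` at
the second. -/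
theorem sum_sum_eq_of_ne {α β γ A : Type*} [AddCommMonoid A] (s : Finset α)
    (t : Finset β) (r : Finset γ) (F : α → β → γ → A) (φ : β → α) (hφ : ∀ b ∈ t, φ b ∈ s)
    (h0 : ∀ a b c, b ∈ t → a ≠ φ b → F a b c = 0) :
    ∑ R ∈ s ×ˢ r, ∑ T ∈ t, F R.1 T R.2 = ∑ T ∈ t, ∑ V ∈ r, F (φ T) T V := by
  classical
  rw [Finset.sum_comm]
  refine Finset.sum_congr rfl fun T hT => ?_
  rw [Finset.sum_product, Finset.sum_eq_single_of_mem (φ T) (hφ T hT)]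
  exact fun a _ ha => Finset.sum_eq_zero fun c _ => h0 a T c hT ha

theorem wl_reassoc {X Y Z : List ℕ} {f : W.Hom X Y} {g : W.Hom Y Z} {h : W.Hom X Z}
    (e : f ⋗ g = h) (p : ℕ) {V : List ℕ} (t : W.Hom (p :: Z) V) :
    W.wl p f ⋗ W.wl p g ⋗ t = W.wl p h ⋗ t := by
  rw [← e, W.wl_comp, W.assoc]

theorem wl_reassoc₂ {X Y Y' Z : List ℕ} {f : W.Hom X Y} {g : W.Hom Y Z} {f' : W.Hom X Y'}
    {g' : W.Hom Y' Z} (e : f ⋗ g = f' ⋗ g') (p : ℕ) {V : List ℕ} (t : W.Hom (p :: Z) V) :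
    W.wl p f ⋗ W.wl p g ⋗ t = W.wl p f' ⋗ W.wl p g' ⋗ t := by
  rw [wl_reassoc e, W.wl_comp, W.assoc]

theorem wl_ins_del (a : ℕ) (Z : List ℕ) : W.wl a (W.ins Z) ⋗ W.wl a (W.del Z) = W.id _ := by
  rw [← W.wl_comp, W.ins_del, W.wl_id]

/-- The diagram that merges `a`, `b`, `c` to `g`, `h` after splitting them as `P`, `Q`, `V`, where
`a` and `b` first meet in a ladder with top thicknesses `s`, `u`, and `c` joins afterwards. -/
def leftTerm (W : WebModel k) (a b c g h : ℕ) (P Q V : ℕ × ℕ) (s u : ℕ) (Z : List ℕ) :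
    W.Hom (a :: b :: c :: Z) (g :: h :: Z) :=
  W.ladder a b s u P.1 P.2 Q.1 Q.2 (c :: Z) ⋗ W.wl s (W.wl u (W.S c V.1 V.2 Z)) ⋗
    W.wl s (W.X u V.1 (V.2 :: Z)) ⋗ W.M s V.1 g (u :: V.2 :: Z) ⋗ W.wl g (W.M u V.2 h Z)

/-- The diagram that merges `a`, `b`, `c` to `g`, `h` after splitting them as `P`, `Q`, `V`, where
`b` and `c` first meet in a ladder with top thicknesses `w`, `y`, and `a` joins afterwards. -/
def rightTerm (W : WebModel k) (a b c g h : ℕ) (P Q V : ℕ × ℕ) (w y : ℕ) (Z : List ℕ) :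
    W.Hom (a :: b :: c :: Z) (g :: h :: Z) :=
  W.S a P.1 P.2 (b :: c :: Z) ⋗ W.wl P.1 (W.wl P.2 (W.ladder b c w y Q.1 Q.2 V.1 V.2 Z)) ⋗
    W.wl P.1 (W.X P.2 w (y :: Z)) ⋗ W.M P.1 w g (P.2 :: y :: Z) ⋗ W.wl g (W.M P.2 y h Z)

open Finset.HasAntidiagonal in
/-- Two merges on the left followed by a split, expanded by using the merge-split relation
twice. -/
theorem merge_merge_split_left (a b c e n g h : ℕ) (Z : List ℕ) (he : a + b = e) (hn : e + c = n) :
    W.M a b e (c :: Z) ⋗ W.M e c n Z ⋗ W.S n g h Z =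
      ∑ P ∈ antidiagonal a, ∑ Q ∈ antidiagonal b, ∑ V ∈ antidiagonal c,
        W.leftTerm a b c g h P Q V (P.1 + Q.1) (P.2 + Q.2) Z := by
  rw [merge_split e c n g h Z hn, comp_sum]
  have key : ∀ R ∈ antidiagonal e ×ˢ antidiagonal c,
      W.M a b e (c :: Z) ⋗ W.ladder e c g h R.1.1 R.1.2 R.2.1 R.2.2 Z =
      ∑ T ∈ antidiagonal a ×ˢ antidiagonal b,
        W.leftTerm a b c g h T.1 T.2 R.2 R.1.1 R.1.2 Z := by
    intro R _
    rw [ladder, reassoc (merge_split a b e R.1.1 R.1.2 (c :: Z) he), sum_comp]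
    rfl
  rw [Finset.sum_congr rfl key, sum_sum_eq_of_ne (antidiagonal e) (antidiagonal a ×ˢ antidiagonal b)
    (antidiagonal c) (fun R T V => W.leftTerm a b c g h T.1 T.2 V R.1 R.2 Z)
    (fun T => (T.1.1 + T.2.1, T.1.2 + T.2.2)), Finset.sum_product]
  · rintro ⟨⟨p, p'⟩, ⟨q, q'⟩⟩ hT
    simp only [Finset.mem_product, mem_antidiagonal] at hT ⊢
    omega
  · rintro ⟨s, u⟩ ⟨⟨p, p'⟩, ⟨q, q'⟩⟩ V _ hne
    rw [leftTerm, ladder_ne, zero_comp]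
    rintro ⟨-, -, h1, h2⟩
    exact hne (Prod.ext h1.symm h2.symm)

open Finset.HasAntidiagonal in
/-- Two merges on the right followed by a split, expanded by using the merge-split relation
twice. -/
theorem merge_merge_split_right (a b c f n g h : ℕ) (Z : List ℕ) (hf : b + c = f)
    (hn : a + f = n) :
    W.wl a (W.M b c f Z) ⋗ W.M a f n Z ⋗ W.S n g h Z =
      ∑ P ∈ antidiagonal a, ∑ Q ∈ antidiagonal b, ∑ V ∈ antidiagonal c,
        W.rightTerm a b c g h P Q V (Q.1 + V.1) (Q.2 + V.2) Z := by
  rw [merge_split a f n g h Z hn, comp_sum, Finset.sum_product]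
  refine Finset.sum_congr rfl fun P _ => ?_
  have key : ∀ R ∈ antidiagonal f,
      W.wl a (W.M b c f Z) ⋗ W.ladder a f g h P.1 P.2 R.1 R.2 Z =
      ∑ T ∈ antidiagonal b ×ˢ antidiagonal c,
        W.rightTerm a b c g h P T.1 T.2 R.1 R.2 Z := by
    intro R _
    rw [ladder, reassoc (W.S_nat _ _ _ _).symm, W.assoc, reassoc (W.wl_comp _ _ _).symm,
      ← W.wl_comp, merge_split b c f R.1 R.2 Z hf, wl_sum, wl_sum, sum_comp, comp_sum]
    rfl
  have := sum_sum_eq_of_ne (antidiagonal f) (antidiagonal b ×ˢ antidiagonal c)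
    {()} (fun R T _ => W.rightTerm a b c g h P T.1 T.2 R.1 R.2 Z)
    (fun T => (T.1.1 + T.2.1, T.1.2 + T.2.2)) ?_ ?_
  · rw [Finset.sum_congr rfl key]
    rw [Finset.sum_product] at this
    simpa [Finset.sum_product] using this
  · rintro ⟨⟨p, p'⟩, ⟨q, q'⟩⟩ hT
    simp only [Finset.mem_product, mem_antidiagonal] at hT ⊢
    omega
  · rintro ⟨s, u⟩ ⟨⟨p, p'⟩, ⟨q, q'⟩⟩ V _ hne
    rw [rightTerm, ladder_ne, wl_zero, wl_zero, zero_comp, comp_zero]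
    rintro ⟨-, -, h1, h2⟩
    exact hne (Prod.ext h1.symm h2.symm)

/-- Corresponding terms of the two expansions agree as soon as the crossings that occur in them
slide through merges: both are then the diagram in which the strings cross before any merge. -/
theorem leftTerm_eq_rightTerm {a b c g h : ℕ} {P Q V : ℕ × ℕ} {s u w y : ℕ} {Z : List ℕ}
    (hs : P.1 + Q.1 = s) (hu : P.2 + Q.2 = u) (hw : Q.1 + V.1 = w) (hy : Q.2 + V.2 = y)
    (h1 : ∀ Z, W.M P.2 Q.2 u (V.1 :: Z) ⋗ W.X u V.1 Z =
      W.wl P.2 (W.X Q.2 V.1 Z) ⋗ W.X P.2 V.1 (Q.2 :: Z) ⋗ W.wl V.1 (W.M P.2 Q.2 u Z))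
    (h2 : ∀ Z, W.wl P.2 (W.M Q.1 V.1 w Z) ⋗ W.X P.2 w Z =
      W.X P.2 Q.1 (V.1 :: Z) ⋗ W.wl Q.1 (W.X P.2 V.1 Z) ⋗ W.M Q.1 V.1 w (P.2 :: Z)) :
    W.leftTerm a b c g h P Q V s u Z = W.rightTerm a b c g h P Q V w y Z := by
  obtain ⟨p, p'⟩ := P
  obtain ⟨q, q'⟩ := Q
  obtain ⟨v, t⟩ := V
  simp only at *
  unfold leftTerm rightTerm ladder
  -- The common value: split, perform the three crossings of single strings, then merge.
  trans W.S a p p' (b :: c :: Z) ⋗ W.wl p (W.wl p' (W.S b q q' (c :: Z) ⋗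
    W.wl q (W.wl q' (W.S c v t Z) ⋗ W.X q' v (t :: Z)))) ⋗
    W.wl p (W.X p' q (v :: q' :: t :: Z) ⋗ W.wl q (W.X p' v (q' :: t :: Z)) ⋗
      W.M q v w (p' :: q' :: t :: Z)) ⋗ W.M p w g (p' :: q' :: t :: Z) ⋗
      W.wl g (W.wl p' (W.M q' t y Z) ⋗ W.M p' y h Z)
  · simp only [W.assoc]
    rw [reassoc (W.wl_comp s _ _).symm, reassoc (W.wl_comp s _ _).symm, M_nat, W.assoc, h1,
      reassoc (M_nat _ _ _ _ _), W.assoc, reassoc (M_assoc g _ hs hw), W.assoc,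
      ← M_assoc h Z hu hy]
    simp only [W.wl_comp, W.assoc]
    rw [reassoc (W.M_nat p w g (W.M p' q' u (t :: Z))), W.assoc,
      reassoc (W.wl_comp p (W.M q v w _) _).symm, W.M_nat, W.wl_comp, W.assoc]
    rw [wl_reassoc₂ (W.X_nat p' q _), wl_reassoc₂ (W.X_nat p' q _),
      wl_reassoc₂ (W.M_nat q v w (W.M p' q' u _)).symm]
  · simp only [W.wl_comp, W.assoc]
    rw [wl_reassoc₂ (W.X_nat p' w _).symm, reassoc (W.M_nat p w g _).symm, W.assoc,
      wl_reassoc₂ (h2 _)]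
    simp only [W.wl_comp, W.assoc]

/-- This and the next three lemmas identify the extreme terms of the expansions: they are the two
sides of the relations by which crossings slide through merges. -/
theorem leftTerm_zero_left {a b e : ℕ} (c : ℕ) (Z : List ℕ) :
    W.leftTerm a b c c e (0, a) (0, b) (c, 0) 0 e Z = W.M a b e (c :: Z) ⋗ W.X e c Z := by
  rw [leftTerm, ladder_left, W.assoc]
  congr 1
  exact (congrArg (· ⋗ _) (W.S_zero_left _ _).symm).trans (ladder_X (W := W) Z)

theorem rightTerm_zero_left {a b e : ℕ} (c : ℕ) (Z : List ℕ) :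
    W.rightTerm a b c c e (0, a) (0, b) (c, 0) c b Z =
      W.wl a (W.X b c Z) ⋗ W.X a c (b :: Z) ⋗ W.wl c (W.M a b e Z) := by
  rw [rightTerm, ladder_X, S_zero_left, M_zero_left, reassoc (ins_nat _).symm, W.assoc,
    reassoc (ins_nat _).symm, W.assoc, reassoc (W.ins_del _), W.id_comp]

theorem leftTerm_zero_right {b c f : ℕ} (a : ℕ) (Z : List ℕ) :
    W.leftTerm a b c f a (0, a) (b, 0) (c, 0) b a Z =
      W.X a b (c :: Z) ⋗ W.wl b (W.X a c Z) ⋗ W.M b c f (a :: Z) := by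
  rw [leftTerm, ladder_X, S_zero_right, M_zero_right, M_nat, wl_reassoc₂ (W.X_nat a c _).symm,
    wl_reassoc (W.wl_comp _ _ _).symm, wl_ins_del, W.wl_id, W.wl_id, W.id_comp]

theorem rightTerm_zero_right {b c f : ℕ} (a : ℕ) (Z : List ℕ) :
    W.rightTerm a b c f a (0, a) (b, 0) (c, 0) f 0 Z = W.wl a (W.M b c f Z) ⋗ W.X a f Z := by
  rw [rightTerm, ladder_right, S_zero_left, M_zero_left, reassoc (ins_nat _).symm, W.assoc,
    reassoc (ins_nat _).symm, W.assoc, reassoc (W.ins_del _), W.id_comp, M_zero_right, W.X_nat,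
    W.wl_comp, W.assoc, wl_reassoc (wl_ins_del _ _), W.wl_id, W.id_comp]

theorem eq_of_sum_eq_of_ne {ι A : Type*} [AddCommGroup A] {s : Finset ι} {f g : ι → A} {i : ι}
    (hi : i ∈ s) (h : ∑ j ∈ s, f j = ∑ j ∈ s, g j) (hne : ∀ j ∈ s, j ≠ i → f j = g j) :
    f i = g i := by
  classical
  rw [← Finset.add_sum_erase s f hi, ← Finset.add_sum_erase s g hi,
    Finset.sum_congr rfl fun j hj => hne j (Finset.mem_of_mem_erase hj) (Finset.ne_of_mem_erase hj)]
    at h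
  exact add_right_cancel h

theorem leftTerm_ne {a b c g h : ℕ} {P Q V : ℕ × ℕ} {s u : ℕ} {Z : List ℕ} (hg : s + V.1 ≠ g) :
    W.leftTerm a b c g h P Q V s u Z = 0 := by
  rw [leftTerm, W.M_ne _ _ _ _ hg, zero_comp, comp_zero, comp_zero, comp_zero]

theorem rightTerm_ne {a b c g h : ℕ} {P Q V : ℕ × ℕ} {w y : ℕ} {Z : List ℕ} (hg : P.1 + w ≠ g) :
    W.rightTerm a b c g h P Q V w y Z = 0 := by
  rw [rightTerm, W.M_ne _ _ _ _ hg, zero_comp, comp_zero, comp_zero, comp_zero]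

open Finset.HasAntidiagonal in
/-- Crossings slide through merges, on either side, by induction on the total thickness `a + b + c`.
By associativity, the two expansions of a double merge followed by a split have the same sum. All
terms but one involve only crossings of smaller total thickness, so they agree in pairs by
induction; hence the remaining two terms agree, and for a suitable split these are the two sides
of the relation. -/
theorem sliders (N : ℕ) : ∀ a b c : ℕ, a + b + c = N →
    (∀ e Z, a + b = e → W.M a b e (c :: Z) ⋗ W.X e c Z =
      W.wl a (W.X b c Z) ⋗ W.X a c (b :: Z) ⋗ W.wl c (W.M a b e Z)) ∧
    (∀ f Z, b + c = f → W.wl a (W.M b c f Z) ⋗ W.X a f Z =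
      W.X a b (c :: Z) ⋗ W.wl b (W.X a c Z) ⋗ W.M b c f (a :: Z)) := by
  induction N using Nat.strong_induction_on with
  | _ N ih =>
  intro a b c hN
  rcases Nat.eq_zero_or_pos b with rfl | hb
  · constructor
    · rintro e Z h
      obtain rfl : a = e := by omega
      rw [M_zero_right, M_zero_right, X_zero_left, X_nat, W.wl_comp, W.assoc,
        wl_reassoc (wl_ins_del _ _), W.wl_id, W.id_comp]
    · rintro f Z h
      obtain rfl : c = f := by omega
      rw [M_zero_left, M_zero_left, X_zero_right, W.assoc, reassoc (ins_nat _).symm, W.assoc,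
        W.ins_del, W.comp_id]
  -- The two expansions of a double merge followed by a split agree up to one term.
  have key : ∀ (g h e f : ℕ) (Z) (i : (ℕ × ℕ) × (ℕ × ℕ) × (ℕ × ℕ)), a + b = e → b + c = f →
      i ∈ antidiagonal a ×ˢ antidiagonal b ×ˢ antidiagonal c →
      (∀ p p' q q' v t, p + p' = a → q + q' = b → v + t = c → p + q + v = g →
        ((p, p'), (q, q'), (v, t)) ≠ i → p' + q' + v < N ∧ p' + q + v < N) →
      W.leftTerm a b c g h i.1 i.2.1 i.2.2 (i.1.1 + i.2.1.1) (i.1.2 + i.2.1.2) Z =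
      W.rightTerm a b c g h i.1 i.2.1 i.2.2 (i.2.1.1 + i.2.2.1) (i.2.1.2 + i.2.2.2) Z := by
    intro g h e f Z i he hf hi hlt
    refine eq_of_sum_eq_of_ne
      (f := fun T : (ℕ × ℕ) × (ℕ × ℕ) × (ℕ × ℕ) => W.leftTerm a b c g h T.1 T.2.1 T.2.2
        (T.1.1 + T.2.1.1) (T.1.2 + T.2.1.2) Z)
      (g := fun T => W.rightTerm a b c g h T.1 T.2.1 T.2.2 (T.2.1.1 + T.2.2.1)
        (T.2.1.2 + T.2.2.2) Z) hi ?_ ?_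
    · simp only [Finset.sum_product]
      rw [← merge_merge_split_left a b c e (e + c) g h Z he rfl,
        ← merge_merge_split_right a b c f (e + c) g h Z hf (by omega),
        reassoc (M_assoc _ _ he hf), W.assoc]
    · rintro ⟨⟨p, p'⟩, ⟨q, q'⟩, ⟨v, t⟩⟩ hT hne
      simp only [Finset.mem_product, mem_antidiagonal] at hT
      by_cases hg : p + q + v = g
      · have := hlt p p' q q' v t hT.1 hT.2.1 hT.2.2 hg hne
        exact leftTerm_eq_rightTerm rfl rfl rfl rfl (fun Z => (ih _ this.1 p' q' v rfl).1 _ Z rfl)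
          (fun Z => (ih _ this.2 p' q v rfl).2 _ Z rfl)
      · rw [leftTerm_ne (by simpa using hg), rightTerm_ne (by simpa [← add_assoc] using hg)]
  constructor
  · intro e Z he
    have := key c e e (b + c) Z ((0, a), (0, b), (c, 0)) he rfl (by simp) ?_
    · simp only [zero_add, add_zero, he] at this
      rwa [leftTerm_zero_left, rightTerm_zero_left] at this
    · intro p p' q q' v t h1 h2 h3 h4 hne
      have : p ≠ 0 ∨ q ≠ 0 := by
        by_contra! h5
        apply hne
        simp only [Prod.mk.injEq]
        omega
      omega
  · intro f Z hf
    have := key f a (a + b) f Z ((0, a), (b, 0), (c, 0)) rfl hf (by simp) ?_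
    · simp only [zero_add, add_zero, hf] at this
      rw [leftTerm_zero_right, rightTerm_zero_right] at this
      exact this.symm
    · intro p p' q q' v t h1 h2 h3 h4 hne
      have : p ≠ 0 := by
        by_contra! h5
        apply hne
        simp only [Prod.mk.injEq]
        omega
      omega

/-- A crossing slides through a merge on its left strand. -/
theorem M_X_left {a b e : ℕ} (c : ℕ) (Z : List ℕ) (h : a + b = e) :
    W.M a b e (c :: Z) ⋗ W.X e c Z =
      W.wl a (W.X b c Z) ⋗ W.X a c (b :: Z) ⋗ W.wl c (W.M a b e Z) :=
  (sliders _ a b c rfl).1 e Z h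

theorem M_X_right {b c f : ℕ} (a : ℕ) (Z : List ℕ) (h : b + c = f) :
    W.wl a (W.M b c f Z) ⋗ W.X a f Z =
      W.X a b (c :: Z) ⋗ W.wl b (W.X a c Z) ⋗ W.M b c f (a :: Z) :=
  (sliders _ a b c rfl).2 f Z h

theorem X_S_right {a b e : ℕ} (c : ℕ) (Z : List ℕ) (h : a + b = e) :
    W.X c e Z ⋗ W.S e a b (c :: Z) =
      W.wl c (W.S e a b Z) ⋗ W.X c a (b :: Z) ⋗ W.wl a (W.X c b Z) :=
  (M_X_left (W := W.op) c Z h).trans (W.assoc _ _ _)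

theorem X_S_left {b c f : ℕ} (a : ℕ) (Z : List ℕ) (h : b + c = f) :
    W.X f a Z ⋗ W.wl a (W.S f b c Z) =
      W.S f b c (a :: Z) ⋗ W.wl b (W.X c a Z) ⋗ W.X b a (c :: Z) :=
  (M_X_right (W := W.op) a Z h).trans (W.assoc _ _ _)

open Finset.HasAntidiagonal in
theorem sum_choose_mul_choose (a b : ℕ) :
    ∑ T ∈ antidiagonal a ×ˢ antidiagonal b,
      (if T.1.1 + T.2.1 = b then a.choose T.1.1 * b.choose T.2.1 else 0) = (a + b).choose b := by
  rw [Nat.add_choose_eq]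
  refine Finset.sum_bij_ne_zero (fun T _ _ => (T.1.1, T.2.1)) ?_ ?_ ?_ ?_
  · rintro ⟨⟨p, p'⟩, ⟨q, q'⟩⟩ hm h0
    simp only [mem_antidiagonal]
    by_contra h1
    exact h0 (if_neg h1)
  · rintro ⟨⟨p, p'⟩, ⟨q, q'⟩⟩ h1 _ ⟨⟨r, r'⟩, ⟨s, s'⟩⟩ h2 _ h3
    simp only [Finset.mem_product, mem_antidiagonal, Prod.mk.injEq] at h1 h2 h3 ⊢
    omega
  · rintro ⟨p, q⟩ hm h0
    simp only [mem_antidiagonal] at hm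
    simp only [ne_eq, mul_eq_zero, not_or, Nat.choose_eq_zero_iff, not_lt] at h0
    have h1 : p + (a - p) = a := by omega
    have h2 : q + (b - q) = b := by omega
    refine ⟨((p, a - p), (q, b - q)), by simp [h1, h2], ?_, rfl⟩
    simp only [hm, if_true, ne_eq, mul_eq_zero, not_or, Nat.choose_eq_zero_iff, not_lt]
    exact h0
  · rintro ⟨⟨p, p'⟩, ⟨q, q'⟩⟩ hm h0
    simp only at h0 ⊢
    exact if_pos (by by_contra h1; exact h0 (if_neg h1))

/-- A ladder followed by the merge of its two top strings. By associativity the crossed strings can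
be merged first, where the crossing is absorbed; then the two digons contribute binomial
coefficients. -/
theorem ladder_M {a b n p p' q q' : ℕ} (Z : List ℕ) (hp : p + p' = a) (hq : q + q' = b)
    (hb : p + q = b)
    (h : ∀ Z, W.X p' q Z ⋗ W.M q p' (p' + q) Z = W.M p' q (p' + q) Z) :
    W.ladder a b b a p p' q q' Z ⋗ W.M b a n Z =
      ((a.choose p * b.choose q : ℕ) : k) • W.M a b n Z := by
  rw [ladder]
  simp only [W.assoc]
  rw [← M_assoc (a := b) (b := p') (c := q') (e := b + p') n Z rfl (by omega),
    reassoc (M_assoc (f := p' + q) (b + p') (q' :: Z) hb (by omega)), W.assoc,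
    wl_reassoc (h _), reassoc (M_assoc (b + p') (q' :: Z) hp rfl).symm, W.assoc,
    M_assoc n Z (by omega) hq, reassoc (W.M_nat p p' a _).symm, W.assoc,
    reassoc (digon _ _ _ _ hp), W.smul_comp, W.id_comp, reassoc (W.wl_comp _ _ _).symm,
    digon _ _ _ _ hq, W.wl_smul, W.wl_id, W.smul_comp, W.id_comp, smul_smul, Nat.cast_mul]

open Finset.HasAntidiagonal in
/-- A crossing is absorbed by the merge of its strings, by induction on `n`. Merging the result of
the merge-split relation multiplies by the binomial coefficient of `n` over `b` on one side. On
the other side every ladder with a smaller crossing contributes a product of two binomial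
coefficients, and by Vandermonde's identity the coefficient left for the ladder that is the
crossing itself is one. -/
theorem X_M (N : ℕ) : ∀ a b n Z, a + b = N → a + b = n → W.X a b Z ⋗ W.M b a n Z = W.M a b n Z := by
  induction N using Nat.strong_induction_on with
  | _ N ih =>
  intro a b n Z hN hn
  have h := congrArg (· ⋗ W.M b a n Z) (merge_split a b n b a Z hn)
  have h2 := eq_of_sum_eq_of_ne (s := antidiagonal a ×ˢ antidiagonal b) (i := ((0, a), (b, 0)))
      (f := fun T => W.ladder a b b a T.1.1 T.1.2 T.2.1 T.2.2 Z ⋗ W.M b a n Z)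
      (g := fun T => ((if T.1.1 + T.2.1 = b then a.choose T.1.1 * b.choose T.2.1 else 0 : ℕ) : k) •
        W.M a b n Z) (by simp) ?_ ?_
  · simpa [ladder_X] using h2
  · rw [← sum_comp, ← merge_split a b n b a Z hn, W.assoc, digon _ _ _ _ (by omega), W.comp_smul,
      W.comp_id, ← Finset.sum_smul, ← Nat.cast_sum, sum_choose_mul_choose, hn]
  · rintro ⟨⟨p, p'⟩, ⟨q, q'⟩⟩ hm hne
    simp only [Finset.mem_product, mem_antidiagonal] at hm ⊢
    split_ifs with hb
    · refine ladder_M Z hm.1 hm.2 hb fun Z => ih (p' + q) ?_ p' q _ Z rfl rfl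
      have : p ≠ 0 := by
        by_contra! h5
        apply hne
        simp only [Prod.mk.injEq]
        omega
      omega
    · rw [ladder_ne Z (by tauto), zero_comp, Nat.cast_zero, zero_smul]

end WebModel
end SchurWeb

namespace SchurWeb

/-! ### Normal forms span -/
namespace WebModel

variable {k : Type u} [CommRing k] {W : WebModel k}
local notation:80 f:81 " ⋗ " g:80 => WebModel.comp _ f g

/-- The diagram that extracts from every string of `mu` a string whose thickness is the entry of `v`
in its place, moves the extracted strings to the left and merges them to one string `l`; the rest
of the strings of `mu` are `r`. It is zero unless `mu`, `v`, `l`, `r` fit together. -/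
def extract (W : WebModel k) : (mu v : List ℕ) → (l : ℕ) → (r : List ℕ) → W.Hom mu (l :: r)
  | [], [], 0, [] => W.ins []
  | n :: mu, p :: v, l, q :: r =>
      W.S n p q mu ⋗ W.wl p (W.wl q (extract W mu v v.sum r)) ⋗ W.wl p (W.X q v.sum r) ⋗
        W.M p v.sum l (q :: r)
  | _, _, _, _ => 0

theorem extract_cons (n p l q : ℕ) (mu v r : List ℕ) :
    W.extract (n :: mu) (p :: v) l (q :: r) =
      W.S n p q mu ⋗ W.wl p (W.wl q (W.extract mu v v.sum r)) ⋗ W.wl p (W.X q v.sum r) ⋗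
        W.M p v.sum l (q :: r) := by
  rw [extract]

/-- Induction over the data for which `extract` can be nonzero. -/
theorem extract_induction {motive : (mu v : List ℕ) → (l : ℕ) → (r : List ℕ) → Prop}
    (zero : ∀ mu v l r, W.extract mu v l r = 0 → motive mu v l r)
    (nil : motive [] [] 0 [])
    (cons : ∀ n mu p v q r, p + q = n → motive mu v v.sum r →
      motive (n :: mu) (p :: v) (p + v.sum) (q :: r)) (mu v : List ℕ) (l : ℕ) (r : List ℕ) :
    motive mu v l r := by
  induction mu generalizing v l r with
  | nil =>
    rcases v with _ | ⟨p, v⟩ <;> rcases r with _ | ⟨q, r⟩ <;> rcases l with _ | l <;>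
      first | exact nil | exact zero _ _ _ _ (by simp [extract])
  | cons n mu ih =>
    rcases v with _ | ⟨p, v⟩ <;> rcases r with _ | ⟨q, r⟩ <;>
      try (refine zero _ _ _ _ ?_; simp [extract]; done)
    by_cases h : p + v.sum = l
    · by_cases h' : p + q = n
      · subst h
        exact cons _ _ _ _ _ _ h' (ih _ _ _)
      · refine zero _ _ _ _ ?_
        rw [extract_cons, W.S_ne _ _ _ _ h', zero_comp]
    · refine zero _ _ _ _ ?_
      rw [extract_cons, W.M_ne _ _ _ _ h, comp_zero, comp_zero, comp_zero]

theorem of_extract_ne_zero (mu v : List ℕ) (l : ℕ) (r : List ℕ) :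
    W.extract mu v l r ≠ 0 → v.sum = l ∧ v.length = mu.length ∧ r.length = mu.length ∧
      ∀ i, v.getD i 0 + r.getD i 0 = mu.getD i 0 := by
  induction mu, v, l, r using extract_induction (W := W) with
  | zero mu v l r h => exact fun h' => absurd h h'
  | nil => simp
  | cons n mu p v q r h ih =>
    intro h'
    have : W.extract mu v v.sum r ≠ 0 := by
      intro h0
      apply h'
      rw [extract_cons, h0]
      simp only [wl_zero, zero_comp, comp_zero]
    obtain ⟨h1, h2, h3, h4⟩ := ih this
    refine ⟨by simp, by simp [h2], by simp [h3], fun i => ?_⟩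
    rcases i with _ | i
    · simpa using h
    · simpa using h4 i

/-- The diagram in which a string `n` splits into `p₁`, `p₂`, `q` while `x` takes place to its
right; then `q` crosses the strings `w₁`, `w₂` produced by `x`, and `p₁`, `p₂` are merged with
`w₁`, `w₂` to `b`, `d`. It is linear in `x`. -/
def frame (W : WebModel k) (n p₁ p₂ q f w₁ w₂ b d : ℕ) (mu r : List ℕ) :
    W.Hom mu (w₁ :: w₂ :: r) →ₗ[k] W.Hom (n :: mu) (b :: d :: q :: r) where
  toFun x := W.S n p₁ f mu ⋗ W.wl p₁ (W.S f p₂ q mu) ⋗ W.wl p₁ (W.wl p₂ (W.wl q x)) ⋗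
    W.wl p₁ (W.wl p₂ (W.X q w₁ (w₂ :: r) ⋗ W.wl w₁ (W.X q w₂ r))) ⋗
    W.wl p₁ (W.X p₂ w₁ (w₂ :: q :: r)) ⋗ W.M p₁ w₁ b (p₂ :: w₂ :: q :: r) ⋗
    W.wl b (W.M p₂ w₂ d (q :: r))
  map_add' x y := by simp only [W.wl_add, W.comp_add, W.add_comp]
  map_smul' c x := by simp only [W.wl_smul, W.comp_smul, W.smul_comp, RingHom.id_apply]

theorem frame_apply (n p₁ p₂ q f w₁ w₂ b d : ℕ) (mu r : List ℕ) (x : W.Hom mu (w₁ :: w₂ :: r)) :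
    W.frame n p₁ p₂ q f w₁ w₂ b d mu r x =
    W.S n p₁ f mu ⋗ W.wl p₁ (W.S f p₂ q mu) ⋗ W.wl p₁ (W.wl p₂ (W.wl q x)) ⋗
    W.wl p₁ (W.wl p₂ (W.X q w₁ (w₂ :: r) ⋗ W.wl w₁ (W.X q w₂ r))) ⋗
    W.wl p₁ (W.X p₂ w₁ (w₂ :: q :: r)) ⋗ W.M p₁ w₁ b (p₂ :: w₂ :: q :: r) ⋗
    W.wl b (W.M p₂ w₂ d (q :: r)) := rfl

/-- Two successive extractions, with the contribution of the first string isolated. -/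
theorem extract_extract (n p₁ p₂ q f b d : ℕ) (mu r' r v' v'' : List ℕ) (hf : p₂ + q = f) :
    W.extract (n :: mu) (p₁ :: v') b (f :: r') ⋗
      W.wl b (W.extract (f :: r') (p₂ :: v'') d (q :: r)) =
    W.frame n p₁ p₂ q f v'.sum v''.sum b d mu r
      (W.extract mu v' v'.sum r' ⋗ W.wl v'.sum (W.extract r' v'' v''.sum r)) := by
  rw [extract_cons, extract_cons, frame_apply]
  generalize W.extract mu v' v'.sum r' = e'
  generalize W.extract r' v'' v''.sum r = e''
  generalize v'.sum = w₁ at *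
  generalize v''.sum = w₂ at *
  simp only [W.assoc, W.wl_comp]
  rw [reassoc (W.M_nat _ _ _ _), W.assoc, reassoc (W.M_nat _ _ _ _), W.assoc,
    reassoc (W.M_nat _ _ _ _), W.assoc, wl_reassoc (X_S_left w₁ r' hf)]
  simp only [W.assoc, W.wl_comp]
  rw [wl_reassoc₂ (W.X_nat p₂ w₁ _), wl_reassoc₂ (W.X_nat p₂ w₁ _),
    wl_reassoc₂ (W.S_nat f p₂ q e').symm]
  have := congrArg (W.wl p₂) (W.X_nat q w₁ e'')
  simp only [W.wl_comp] at this
  rw [wl_reassoc₂ this]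

/-- An extraction followed by a split of the extracted string is a linear combination of two
successive extractions. At each bottom string the merge-split relation is applied to the merge of
its contribution with the rest. -/
theorem extract_S (mu v : List ℕ) (l : ℕ) (r : List ℕ) : ∀ b d,
    W.extract mu v l r ⋗ W.S l b d r ∈ Submodule.span k
      {f | ∃ v' r' v'', f = W.extract mu v' b r' ⋗ W.wl b (W.extract r' v'' d r)} := by
  induction mu, v, l, r using extract_induction (W := W) with
  | zero mu v l r h => intro b d; rw [h, zero_comp]; exact zero_mem _
  | nil =>
    intro b d
    by_cases h : b = 0 ∧ d = 0
    · obtain ⟨rfl, rfl⟩ := h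
      refine Submodule.subset_span ⟨[], [], [], ?_⟩
      simp only [extract]
      rw [W.S_zero_left, ins_ins]
    · rw [W.S_ne _ _ _ _ (by omega), comp_zero]
      exact zero_mem _
  | cons n mu p v q r h ih =>
    intro b d
    have hs : ∀ P Q : ℕ × ℕ, P.1 + P.2 = p → Q.1 + Q.2 = v.sum →
        (W.S n p q mu ⋗ W.wl p (W.wl q (W.extract mu v v.sum r)) ⋗ W.wl p (W.X q v.sum r)) ⋗
          W.ladder p v.sum b d P.1 P.2 Q.1 Q.2 (q :: r) =
        W.frame n P.1 P.2 q (P.2 + q) Q.1 Q.2 b d mu r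
          (W.extract mu v v.sum r ⋗ W.S v.sum Q.1 Q.2 r) := by
      rintro ⟨p₁, p₂⟩ ⟨w₁, w₂⟩ h1 h2
      simp only at h1 h2 ⊢
      rw [frame_apply, ladder]
      generalize W.extract mu v v.sum r = e
      generalize v.sum = w at *
      simp only [W.assoc, W.wl_comp]
      rw [reassoc (W.S_nat _ _ _ _).symm, W.assoc, reassoc (W.S_nat _ _ _ _).symm, W.assoc,
        reassoc (S_assoc n mu h1 rfl), W.assoc]
      have := congrArg (W.wl p₂) (X_S_right (W := W) q r h2)
      simp only [W.wl_comp] at this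
      rw [wl_reassoc₂ this]
      simp only [W.wl_comp, W.assoc]
    rw [extract_cons]
    simp only [W.assoc]
    rw [merge_split _ _ _ _ _ _ rfl]
    simp only [← W.assoc]
    rw [comp_sum]
    refine Submodule.sum_mem _ fun T hT => ?_
    simp only [Finset.mem_product, Finset.HasAntidiagonal.mem_antidiagonal] at hT
    rw [W.assoc (W.S n p q mu), hs _ _ hT.1 hT.2]
    refine Submodule.span_induction (p := fun x _ => W.frame n T.1.1 T.1.2 q (T.1.2 + q) T.2.1 T.2.2
      b d mu r x ∈ _) ?_ ?_ ?_ ?_ (ih T.2.1 T.2.2)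
    · rintro _ ⟨v', r', v'', rfl⟩
      by_cases h1 : v'.sum = T.2.1
      · by_cases h2 : v''.sum = T.2.2
        · rw [← h1, ← h2, ← extract_extract _ _ _ _ _ _ _ _ _ _ _ _ rfl]
          exact Submodule.subset_span ⟨_, _, _, rfl⟩
        · have : W.extract r' v'' T.2.2 r = 0 := by
            by_contra h0; exact h2 (of_extract_ne_zero _ _ _ _ h0).1
          rw [this, wl_zero, comp_zero, map_zero]
          exact zero_mem _
      · have : W.extract mu v' T.2.1 r' = 0 := by
          by_contra h0; exact h1 (of_extract_ne_zero _ _ _ _ h0).1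
        rw [this, zero_comp, map_zero]
        exact zero_mem _
    · rw [map_zero]; exact zero_mem _
    · intro x y _ _ hx hy; rw [map_add]; exact add_mem hx hy
    · intro c x _ hx; rw [map_smul]; exact Submodule.smul_mem _ _ hx

/-- Merging the two strings collected in a `frame` merges the strings collected by `x`, and the two
parts taken from the first string form a digon. -/
theorem frame_M {n p₁ p₂ q f w₁ w₂ b d p w l : ℕ} {mu r : List ℕ} (hp : p₁ + p₂ = p)
    (hw : w₁ + w₂ = w) (hb : p₁ + w₁ = b) (hd : p₂ + w₂ = d) (hf : p₂ + q = f)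
    (x : W.Hom mu (w₁ :: w₂ :: r)) :
    W.frame n p₁ p₂ q f w₁ w₂ b d mu r x ⋗ W.M b d l (q :: r) =
      (p.choose p₁ : k) • (W.S n p q mu ⋗ W.wl p (W.wl q (x ⋗ W.M w₁ w₂ w r)) ⋗
        W.wl p (W.X q w r) ⋗ W.M p w l (q :: r)) := by
  rw [frame_apply]
  simp only [W.assoc]
  rw [← M_assoc (e := b + p₂) l _ rfl hd, reassoc (M_assoc (f := p₂ + w₁) (b + p₂) _ hb (by omega)),
    W.assoc, wl_reassoc (X_M _ p₂ w₁ _ _ rfl rfl), reassoc (M_assoc _ _ hp rfl).symm, W.assoc,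
    M_assoc l _ (by omega) hw, reassoc (W.M_nat p₁ p₂ p _).symm, W.assoc,
    reassoc (W.M_nat p₁ p₂ p _).symm, W.assoc, reassoc (S_assoc n mu hp hf).symm, W.assoc,
    reassoc (digon _ _ _ _ hp), W.smul_comp, W.id_comp, W.comp_smul]
  congr 2
  simp only [W.wl_comp, W.assoc]
  have := congrArg (W.wl p) (M_X_right (W := W) q r hw)
  simp only [W.wl_comp] at this
  rw [reassoc this]
  simp only [W.assoc]

/-- Two successive extractions followed by the merge of the extracted strings are a multiple of a
single extraction. -/
theorem extract_M (mu v₁ : List ℕ) (b : ℕ) (r' : List ℕ) : ∀ (v₂ r : List ℕ) (d l : ℕ),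
    ∃ (c : k) (v : List ℕ), W.extract mu v₁ b r' ⋗ W.wl b (W.extract r' v₂ d r) ⋗ W.M b d l r =
      c • W.extract mu v l r := by
  induction mu, v₁, b, r' using extract_induction (W := W) with
  | zero mu v l r h => intros; exact ⟨0, [], by rw [h, zero_comp, zero_smul]⟩
  | nil =>
    intro v₂ r d l
    by_cases h0 : W.extract [] v₂ d r = 0
    · exact ⟨0, [], by rw [h0, wl_zero, zero_comp, comp_zero, zero_smul]⟩
    obtain ⟨h1, h2, h3, -⟩ := of_extract_ne_zero _ _ _ _ h0
    obtain rfl := List.length_eq_zero_iff.1 h2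
    obtain rfl := List.length_eq_zero_iff.1 h3
    obtain rfl : 0 = d := h1
    by_cases hl : l = 0
    · subst hl
      refine ⟨1, [], ?_⟩
      simp only [extract]
      rw [M_zero_left, ← ins_ins, W.ins_del, W.comp_id, one_smul]
    · exact ⟨0, [], by rw [W.M_ne _ _ _ _ (Ne.symm hl), comp_zero, comp_zero, zero_smul]⟩
  | cons n mu p₁ v' f r' h ih =>
    intro v₂ r d l
    by_cases h0 : W.extract (f :: r') v₂ d r = 0
    · exact ⟨0, [], by rw [h0, wl_zero, zero_comp, comp_zero, zero_smul]⟩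
    obtain ⟨h1, h2, h3, h4⟩ := of_extract_ne_zero _ _ _ _ h0
    obtain _ | ⟨p₂, v''⟩ := v₂
    · simp at h2
    obtain _ | ⟨q, r⟩ := r
    · simp at h3
    have hf : p₂ + q = f := by simpa using h4 0
    have hd : p₂ + v''.sum = d := by simpa using h1
    obtain ⟨c, v, hv⟩ := ih v'' r v''.sum (v'.sum + v''.sum)
    rw [← W.assoc, extract_extract _ _ _ _ _ _ _ _ _ _ _ _ hf, frame_M rfl rfl rfl hd hf, W.assoc,
      hv]
    by_cases hs : v.sum = v'.sum + v''.sum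
    · refine ⟨(p₁ + p₂).choose p₁ * c, (p₁ + p₂) :: v, ?_⟩
      rw [extract_cons, hs, W.wl_smul, W.wl_smul, W.smul_comp, W.comp_smul, smul_smul]
    · refine ⟨0, [], ?_⟩
      have : W.extract mu v (v'.sum + v''.sum) r = 0 := by
        by_contra h5; exact hs (of_extract_ne_zero _ _ _ _ h5).1
      rw [this, smul_zero, wl_zero, wl_zero, zero_comp, comp_zero, smul_zero, zero_smul]

/-- Removal of all strings, if they have thickness zero; zero otherwise. -/
def delAll (W : WebModel k) : (mu : List ℕ) → W.Hom mu []
  | [] => W.id []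
  | 0 :: mu => W.del mu ⋗ delAll W mu
  | _ :: _ => 0

/-- The diagram that extracts from `mu` successively the strings with thicknesses given by the rows
of `A`, and merges those of each row to a string of `la`. It is zero unless `A` has row sums `la`
and column sums `mu`. -/
def normalForm (W : WebModel k) : (mu : List ℕ) → (A : List (List ℕ)) → (la : List ℕ) → W.Hom mu la
  | mu, [], [] => W.delAll mu
  | mu, v :: A, l :: la =>
      W.extract mu v l (List.zipWith (· - ·) mu v) ⋗ W.wl l (normalForm W _ A la)
  | _, _, _ => 0

/-- The span of the normal forms from `mu` to `la`. -/
def normalSpan (W : WebModel k) (mu la : List ℕ) : Submodule k (W.Hom mu la) :=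
  Submodule.span k (Set.range fun A => W.normalForm mu A la)

theorem extract_mem {mu v r la : List ℕ} {l : ℕ} {f : W.Hom r la} (hf : f ∈ W.normalSpan r la) :
    W.extract mu v l r ⋗ W.wl l f ∈ W.normalSpan mu (l :: la) := by
  by_cases h0 : W.extract mu v l r = 0
  · rw [h0, zero_comp]; exact zero_mem _
  obtain ⟨h1, h2, h3, h4⟩ := of_extract_ne_zero _ _ _ _ h0
  obtain rfl : r = List.zipWith (· - ·) mu v := by
    refine List.ext_getElem (by simp [h2, h3]) fun i hi hi' => ?_
    have := h4 i
    simp only [List.length_zipWith] at hi'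
    rw [List.getD_eq_getElem _ _ (by omega), List.getD_eq_getElem _ _ (by omega),
      List.getD_eq_getElem _ _ (by omega)] at this
    simp only [List.getElem_zipWith]
    omega
  have : W.normalSpan (List.zipWith (· - ·) mu v) la ≤ (W.normalSpan mu (l :: la)).comap
      ((compLeft (W.extract mu v l (List.zipWith (· - ·) mu v))).comp (wlLin l)) := by
    refine Submodule.span_le.2 ?_
    rintro _ ⟨A, rfl⟩
    exact Submodule.subset_span ⟨v :: A, rfl⟩
  exact this hf

theorem normalSpan_cons_induction {mu la : List ℕ} {l : ℕ}
    {p : (f : W.Hom mu (l :: la)) → f ∈ W.normalSpan mu (l :: la) → Prop}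
    (zero : p 0 (zero_mem _))
    (add : ∀ f g hf hg, p f hf → p g hg → p (f + g) (add_mem hf hg))
    (smul : ∀ (c : k) f hf, p f hf → p (c • f) (Submodule.smul_mem _ c hf))
    (ext : ∀ v r f (hf : f ∈ W.normalSpan r la), p (W.extract mu v l r ⋗ W.wl l f) (extract_mem hf))
    {f : W.Hom mu (l :: la)} (hf : f ∈ W.normalSpan mu (l :: la)) : p f hf := by
  refine Submodule.span_induction (p := fun f hf => p f hf) ?_ zero add smul hf
  rintro _ ⟨A, rfl⟩
  rcases A with _ | ⟨v, A⟩
  · simpa only [normalForm] using zero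
  · simp only [normalForm]
    exact ext _ _ _ (Submodule.subset_span ⟨A, rfl⟩)

/-- A morphism is stable if postcomposition with it preserves the spans of the normal forms. -/
def Stable {X Y : List ℕ} (g : W.Hom X Y) : Prop :=
  ∀ mu, ∀ f ∈ W.normalSpan mu X, f ⋗ g ∈ W.normalSpan mu Y

namespace Stable

theorem id (X : List ℕ) : Stable (W.id X) := fun _ f hf => by rwa [W.comp_id]

theorem comp {X Y Z : List ℕ} {f : W.Hom X Y} {g : W.Hom Y Z} (hf : Stable f) (hg : Stable g) :
    Stable (f ⋗ g) := fun mu h hh => by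
  rw [← W.assoc]; exact hg mu _ (hf mu h hh)

theorem zero (X Y : List ℕ) : Stable (0 : W.Hom X Y) := fun _ f _ => by
  rw [comp_zero]; exact zero_mem _

theorem add {X Y : List ℕ} {f g : W.Hom X Y} (hf : Stable f) (hg : Stable g) : Stable (f + g) :=
  fun mu h hh => by rw [W.comp_add]; exact add_mem (hf mu h hh) (hg mu h hh)

theorem smul {X Y : List ℕ} (c : k) {f : W.Hom X Y} (hf : Stable f) : Stable (c • f) :=
  fun mu h hh => by rw [W.comp_smul]; exact Submodule.smul_mem _ _ (hf mu h hh)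

theorem sum {ι : Type*} {X Y : List ℕ} (s : Finset ι) (f : ι → W.Hom X Y)
    (h : ∀ i ∈ s, Stable (f i)) : Stable (∑ i ∈ s, f i) :=
  Finset.sum_induction f Stable (fun _ _ => add) (zero X Y) h

end Stable

theorem stable_wl {X Y : List ℕ} {g : W.Hom X Y}
    (hg : Stable g) (a : ℕ) : Stable (W.wl a g) := by
  intro mu f hf
  induction hf using normalSpan_cons_induction with
  | zero => rw [zero_comp]; exact zero_mem _
  | add f g _ _ hf hg => rw [W.add_comp]; exact add_mem hf hg
  | smul c f _ hf => rw [W.smul_comp]; exact Submodule.smul_mem _ _ hf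
  | ext v r f hf =>
    rw [W.assoc, ← W.wl_comp]
    exact extract_mem (hg r f hf)

/-- Splitting a string of a normal form: only the extraction that produced the string is affected,
by `extract_S`. -/
theorem stable_S (n a b : ℕ) (Z : List ℕ) : Stable (W.S n a b Z) := by
  intro mu f hf
  induction hf using normalSpan_cons_induction with
  | zero => rw [zero_comp]; exact zero_mem _
  | add f g _ _ hf hg => rw [W.add_comp]; exact add_mem hf hg
  | smul c f _ hf => rw [W.smul_comp]; exact Submodule.smul_mem _ _ hf
  | ext v r f hf =>
    rw [W.assoc, ← W.S_nat, ← W.assoc]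
    have : Submodule.span k {g : W.Hom mu (a :: b :: r) | ∃ v' r' v'',
        g = W.extract mu v' a r' ⋗ W.wl a (W.extract r' v'' b r)} ≤
        (W.normalSpan mu (a :: b :: Z)).comap (compRight (W.wl a (W.wl b f))) := by
      refine Submodule.span_le.2 ?_
      rintro _ ⟨v', r', v'', rfl⟩
      change (W.extract mu v' a r' ⋗ W.wl a (W.extract r' v'' b r)) ⋗ W.wl a (W.wl b f) ∈
        W.normalSpan mu (a :: b :: Z)
      rw [W.assoc, ← W.wl_comp]
      exact extract_mem (extract_mem hf)
    exact this (extract_S (W := W) mu v n r a b)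

/-- Merging two strings of a normal form: only the two extractions that produced the strings are
affected, by `extract_M`. -/
theorem stable_M (a b n : ℕ) (Z : List ℕ) : Stable (W.M a b n Z) := by
  intro mu f hf
  induction hf using normalSpan_cons_induction with
  | zero => rw [zero_comp]; exact zero_mem _
  | add f g _ _ hf hg => rw [W.add_comp]; exact add_mem hf hg
  | smul c f _ hf => rw [W.smul_comp]; exact Submodule.smul_mem _ _ hf
  | ext v r f hf =>
    induction hf using normalSpan_cons_induction with
    | zero => rw [wl_zero, comp_zero, zero_comp]; exact zero_mem _
    | add f g _ _ hf hg => rw [W.wl_add, W.comp_add, W.add_comp]; exact add_mem hf hg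
    | smul c f _ hf => rw [W.wl_smul, W.comp_smul, W.smul_comp]; exact Submodule.smul_mem _ _ hf
    | ext v' r' f hf =>
      obtain ⟨c, v'', h⟩ := extract_M (W := W) mu v a r v' r' b n
      rw [W.wl_comp, W.assoc, W.assoc, ← W.M_nat]
      simp only [← W.assoc] at h ⊢
      rw [h, W.smul_comp]
      exact Submodule.smul_mem _ _ (extract_mem hf)

open Finset.HasAntidiagonal in
/-- The merge-split relation expresses a crossing as the merge of its strings followed by a split,
minus ladders with thinner crossings. Hence stability for crossings follows by induction from that
for merges and splits. -/
theorem stable_X (N : ℕ) : ∀ a b Z, a + b = N → Stable (W.X a b Z) := by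
  induction N using Nat.strong_induction_on with
  | _ N ih =>
  intro a b Z hN
  have h := merge_split (W := W) a b (a + b) b a Z rfl
  rw [← Finset.add_sum_erase _ _ (a := ((0, a), (b, 0))) (by simp), ladder_X,
    ← sub_eq_iff_eq_add] at h
  rw [← h, sub_eq_add_neg, ← neg_one_smul k]
  refine ((stable_M _ _ _ _).comp (stable_S _ _ _ _)).add (Stable.smul _ (Stable.sum _ _ ?_))
  rintro ⟨⟨p, p'⟩, ⟨q, q'⟩⟩ hT
  simp only [Finset.mem_erase, Finset.mem_product, mem_antidiagonal] at hT
  by_cases hq : p + q = b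
  · refine (stable_S _ _ _ _).comp ((stable_wl (stable_wl (stable_S _ _ _ _) _) _).comp
      ((stable_wl (ih _ ?_ _ _ _ rfl) _).comp ((stable_M _ _ _ _).comp
        (stable_wl (stable_M _ _ _ _) _))))
    have : p ≠ 0 := by
      by_contra! h5
      apply hT.1
      simp only [Prod.mk.injEq]
      omega
    change p' + q < N
    omega
  · rw [ladder_ne Z (by tauto)]
    exact Stable.zero _ _

theorem del_comp_mem_normalSpan {mu la : List ℕ} {f : W.Hom mu la} (hf : f ∈ W.normalSpan mu la) :
    W.del mu ⋗ f ∈ W.normalSpan (0 :: mu) la := by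
  induction la generalizing mu with
  | nil =>
    refine Submodule.span_induction (p := fun f _ => W.del mu ⋗ f ∈ W.normalSpan (0 :: mu) [])
      ?_ ?_ ?_ ?_ hf
    · rintro _ ⟨A, rfl⟩
      rcases A with _ | ⟨v, A⟩
      · exact Submodule.subset_span ⟨[], by simp only [normalForm, delAll]⟩
      · simp only [normalForm, comp_zero]; exact zero_mem _
    · rw [comp_zero]; exact zero_mem _
    · intro f g _ _ hf hg; rw [W.comp_add]; exact add_mem hf hg
    · intro c f _ hf; rw [W.comp_smul]; exact Submodule.smul_mem _ _ hf
  | cons l la ih =>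
    induction hf using normalSpan_cons_induction with
    | zero => rw [comp_zero]; exact zero_mem _
    | add f g _ _ hf hg => rw [W.comp_add]; exact add_mem hf hg
    | smul c f _ hf => rw [W.comp_smul]; exact Submodule.smul_mem _ _ hf
    | ext v r f hf =>
      have e : W.del mu ⋗ W.extract mu v l r =
          W.extract (0 :: mu) (0 :: v) l (0 :: r) ⋗ W.wl l (W.del r) := by
        rw [extract_cons]
        by_cases hv : v.sum = l
        · rw [S_zero_left, X_zero_left, hv, M_zero_left]
          simp only [W.assoc, W.wl_comp]
          rw [reassoc (ins_nat _).symm, W.assoc, reassoc (ins_nat _).symm, W.assoc,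
            reassoc (ins_nat _).symm, W.assoc, reassoc (W.ins_del _), W.id_comp, wl_ins_del,
            W.comp_id, W.del_nat]
        · have : W.extract mu v l r = 0 := by
            by_contra h0; exact hv (of_extract_ne_zero _ _ _ _ h0).1
          rw [this, comp_zero, W.M_ne _ _ _ _ (by omega)]
          simp only [comp_zero, zero_comp]
      rw [← W.assoc, e, W.assoc, ← W.wl_comp]
      exact extract_mem (ih hf)

theorem extract_zero (mu : List ℕ) :
    W.extract mu (List.replicate mu.length 0) 0 mu = W.ins mu := by
  induction mu with
  | nil => simp only [List.length_nil, List.replicate_zero, extract]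
  | cons n mu ih =>
    rw [List.length_cons, List.replicate_succ, extract_cons, List.sum_replicate, smul_zero, ih,
      S_zero_left, X_zero_right, M_zero_left, wl_reassoc (W.assoc _ _ _).symm, wl_ins_del,
      W.id_comp, ← ins_ins, W.ins_del, W.comp_id]

theorem extract_self (n : ℕ) (mu : List ℕ) :
    W.extract (n :: mu) (n :: List.replicate mu.length 0) n (0 :: mu) = W.wl n (W.ins mu) := by
  rw [extract_cons, List.sum_replicate, smul_zero, extract_zero, S_zero_right, X_zero_left,
    M_zero_right, ← W.wl_comp, ← W.wl_comp, ← W.wl_comp]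
  congr 1
  rw [W.assoc, ← ins_ins, W.ins_del, W.comp_id, W.ins_del, W.comp_id]

/-- The identity is the normal form that extracts the strings one by one as a whole, up to strings
of thickness zero. -/
theorem id_mem_normalSpan (mu : List ℕ) : W.id mu ∈ W.normalSpan mu mu := by
  induction mu with
  | nil => exact Submodule.subset_span ⟨[], by simp only [normalForm, delAll]⟩
  | cons n mu ih =>
    rw [← wl_ins_del, ← extract_self]
    exact extract_mem (by simpa only [W.comp_id] using del_comp_mem_normalSpan ih)

theorem Stable.mem_normalSpan {mu la : List ℕ} {f : W.Hom mu la} (hf : Stable f) :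
    f ∈ W.normalSpan mu la := by
  simpa only [W.id_comp] using hf mu _ (id_mem_normalSpan mu)

theorem of_delAll_ne_zero (mu : List ℕ) : W.delAll mu ≠ 0 → ∀ j, mu.getD j 0 = 0 := by
  induction mu with
  | nil => simp
  | cons n mu ih =>
    intro h j
    rcases n with _ | n
    · rcases j with _ | j
      · rfl
      · refine ih (fun h0 => h ?_) j
        rw [delAll, h0, comp_zero]
    · exact absurd (by rw [delAll]; simp) h

theorem of_normalForm_ne_zero (mu : List ℕ) (A : List (List ℕ)) (la : List ℕ) :
    W.normalForm mu A la ≠ 0 → A.length = la.length ∧ (∀ v ∈ A, v.length = mu.length) ∧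
      A.map List.sum = la ∧ ∀ j, (A.map fun v => v.getD j 0).sum = mu.getD j 0 := by
  induction A generalizing mu la with
  | nil =>
    rcases la with _ | ⟨l, la⟩
    · intro h
      rw [normalForm] at h
      simpa [eq_comm] using of_delAll_ne_zero mu h
    · intro h
      exact absurd (by simp [normalForm]) h
  | cons v A ih =>
    rcases la with _ | ⟨l, la⟩
    · intro h
      exact absurd (by simp [normalForm]) h
    · intro h
      rw [normalForm] at h
      have h1 : W.extract mu v l (List.zipWith (· - ·) mu v) ≠ 0 := fun h0 => h (by
        rw [h0, zero_comp])
      have h2 : W.normalForm (List.zipWith (· - ·) mu v) A la ≠ 0 := fun h0 => h (by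
        rw [h0, wl_zero, comp_zero])
      obtain ⟨h3, h4, h5, h6⟩ := of_extract_ne_zero _ _ _ _ h1
      obtain ⟨h7, h8, h9, h10⟩ := ih _ _ h2
      refine ⟨by simp [h7], ?_, by simp [h3, h9], fun j => ?_⟩
      · intro u hu
        rcases List.mem_cons.1 hu with rfl | hu
        · exact h4
        · rw [h8 u hu, h5]
      · rw [List.map_cons, List.sum_cons, h10, h6]

/-- The rows of a matrix, from top to bottom, as lists. -/
def rows {la mu : Comp} (A : Mat la mu) : List (List ℕ) :=
  List.ofFn fun i => List.ofFn fun j => A.val i j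

/-- The nonzero normal forms are indexed by matrices with the right row and column sums. -/
theorem normalSpan_eq (la mu : Comp) :
    W.normalSpan (mu.map PNat.val) (la.map PNat.val) = Submodule.span k
      (Set.range fun A : Mat la mu =>
        W.normalForm (mu.map PNat.val) (rows A) (la.map PNat.val)) := by
  refine le_antisymm (Submodule.span_le.2 ?_) (Submodule.span_le.2 ?_)
  · rintro _ ⟨A, rfl⟩
    by_cases h : W.normalForm (mu.map PNat.val) A (la.map PNat.val) = 0
    · simp only [h]; exact zero_mem _
    obtain ⟨h1, h2, h3, h4⟩ := of_normalForm_ne_zero _ _ _ h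
    rw [List.length_map] at h1
    simp only [List.length_map] at h2
    have hlen : ∀ i : Fin la.length, (A[i.val]'(by omega)).length = mu.length := fun i =>
      h2 _ (List.getElem_mem _)
    let B : Mat la mu :=
      { val := fun i j => (A[i.val]'(by omega))[j.val]'(by rw [hlen]; exact j.2)
        row_sum := by
          intro i
          have h5 : (A.map List.sum)[i.val]'(by simp [h1]) = la[i.val] := by
            simp only [h3, List.getElem_map]
          rw [List.getElem_map] at h5
          simp only [List.get_eq_getElem]
          rw [← h5, ← Fin.sum_univ_getElem]
          exact Fintype.sum_equiv (finCongr (hlen i).symm) _ _ fun j => rfl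
        col_sum := by
          intro j
          have h5 := h4 j
          rw [List.getD_eq_getElem _ _ (by simp), List.getElem_map] at h5
          simp only [List.get_eq_getElem]
          rw [← h5, ← Fin.sum_univ_getElem]
          refine Fintype.sum_equiv (finCongr (by simp [h1])) _ _ fun i => ?_
          simp only [finCongr_apply, Fin.val_cast, List.getElem_map]
          rw [List.getD_eq_getElem] }
    have hB : rows B = A := by
      refine List.ext_getElem (by simp [rows, h1]) fun i hi hi' => ?_
      refine List.ext_getElem ?_ fun j hj hj' => ?_
      · simp [rows, h2]
      · simp [rows, B]
    exact Submodule.subset_span ⟨B, by simp only [hB]⟩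
  · rintro _ ⟨A, rfl⟩
    exact Submodule.subset_span ⟨_, rfl⟩

end WebModel
end SchurWeb

namespace SchurWeb

/-! ### The web category as a model -/

namespace CompCat

variable {k : Type u} [CommRing k] (S : CompCat k)

/-- The morphisms of a category on compositions, with arbitrary source and target. Since the tensor
product is strictly associative and unital only up to casts along equalities of lists, equations
between morphisms are checked here, where such casts disappear and the tensor product is the
multiplication of a monoid. -/
def Arr : Type u := Σ X Y : Comp, S.Hom X Y

variable {S}

/-- A morphism as an element of the monoid of all morphisms. -/
def arr {X Y : Comp} (f : S.Hom X Y) : S.Arr := ⟨X, Y, f⟩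

theorem arr_inj {X Y : Comp} {f g : S.Hom X Y} : S.arr f = S.arr g ↔ f = g :=
  ⟨fun h => eq_of_heq (Sigma.mk.inj (eq_of_heq (Sigma.mk.inj h).2)).2, fun h => h ▸ rfl⟩

theorem arr_castHom {X X' Y Y' : Comp} (hX : X = X') (hY : Y = Y') (f : S.Hom X Y) :
    S.arr (castHom hX hY f) = S.arr f := by
  subst hX hY
  rfl

theorem castHom_eq_iff {X X' Y Y' : Comp} (hX : X = X') (hY : Y = Y') (f : S.Hom X Y)
    (g : S.Hom X' Y') : castHom hX hY f = g ↔ S.arr f = S.arr g := by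
  rw [← arr_castHom hX hY, arr_inj]

instance : Monoid S.Arr where
  mul a b := S.arr (S.tensor a.2.2 b.2.2)
  one := S.arr (S.id [])
  mul_assoc := by
    rintro ⟨X, Y, f⟩ ⟨X', Y', f'⟩ ⟨X'', Y'', f''⟩
    exact (castHom_eq_iff _ _ _ _).1 (S.tensor_assoc f f' f'')
  one_mul := by
    rintro ⟨X, Y, f⟩
    exact arr_inj.2 (S.unit_tensor f)
  mul_one := by
    rintro ⟨X, Y, f⟩
    exact (castHom_eq_iff _ _ _ _).1 (S.tensor_unit f)

theorem arr_tensor {X Y X' Y' : Comp} (f : S.Hom X Y) (f' : S.Hom X' Y') :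
    S.arr (S.tensor f f') = S.arr f * S.arr f' := rfl

theorem arr_id_append (X Y : Comp) : S.arr (S.id (X ++ Y)) = S.arr (S.id X) * S.arr (S.id Y) := by
  rw [← S.id_tensor_id, arr_tensor]

theorem arr_id_congr {X Y : Comp} (h : X = Y) : S.arr (S.id X) = S.arr (S.id Y) := by rw [h]

theorem arr_comp_congr {X Y Z X' Y' Z' : Comp} {f : S.Hom X Y} {g : S.Hom Y Z}
    {f' : S.Hom X' Y'} {g' : S.Hom Y' Z'} (hf : S.arr f = S.arr f') (hg : S.arr g = S.arr g') :
    S.arr (S.comp f g) = S.arr (S.comp f' g') := by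
  obtain rfl : X = X' := congrArg Sigma.fst hf
  obtain rfl : Y = Y' := congrArg Sigma.fst hg
  obtain rfl : Z = Z' := congrArg (fun a : S.Arr => a.2.1) hg
  rw [arr_inj.1 hf, arr_inj.1 hg]

/-- The interchange law. -/
theorem arr_comp_eq_mul {U V T X Y Z X' Y' Z' : Comp} {F : S.Hom U V} {G : S.Hom V T}
    {f : S.Hom X Y} {g : S.Hom Y Z} {f' : S.Hom X' Y'} {g' : S.Hom Y' Z'}
    (hF : S.arr F = S.arr f * S.arr f') (hG : S.arr G = S.arr g * S.arr g') :
    S.arr (S.comp F G) = S.arr (S.comp f g) * S.arr (S.comp f' g') := by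
  rw [← arr_tensor, ← S.interchange]
  exact arr_comp_congr hF hG

/-- Juxtaposition of identity strings `Z` on the right, with prescribed source and target. -/
def whisk (Z : Comp) {X Y U V : Comp} (hX : X ++ Z = U) (hY : Y ++ Z = V) :
    S.Hom X Y →ₗ[k] S.Hom U V where
  toFun f := castHom hX hY (S.tensor f (S.id Z))
  map_add' f g := by subst hX hY; exact S.add_tensor f g _
  map_smul' r f := by subst hX hY; exact S.smul_tensor r f _

theorem arr_whisk (Z : Comp) {X Y U V : Comp} (hX : X ++ Z = U) (hY : Y ++ Z = V)
    (f : S.Hom X Y) : S.arr (whisk Z hX hY f) = S.arr f * S.arr (S.id Z) :=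
  arr_castHom hX hY _

theorem arr_comp_left_right {U V T X Y X' Y' : Comp} {F : S.Hom U V} {G : S.Hom V T}
    {f : S.Hom X Y} {g : S.Hom X' Y'} (hF : S.arr F = S.arr f * S.arr (S.id X'))
    (hG : S.arr G = S.arr (S.id Y) * S.arr g) : S.arr (S.comp F G) = S.arr f * S.arr g := by
  rw [arr_comp_eq_mul hF hG, S.comp_id, S.id_comp]

theorem arr_comp_right_left {U V T X Y X' Y' : Comp} {F : S.Hom U V} {G : S.Hom V T}
    {f : S.Hom X Y} {g : S.Hom X' Y'} (hF : S.arr F = S.arr (S.id X) * S.arr g)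
    (hG : S.arr G = S.arr f * S.arr (S.id Y')) : S.arr (S.comp F G) = S.arr f * S.arr g := by
  rw [arr_comp_eq_mul hF hG, S.comp_id, S.id_comp]

theorem arr_comp_mul_id {U V T X Y Z Z' : Comp} {F : S.Hom U V} {G : S.Hom V T}
    {f : S.Hom X Y} {g : S.Hom Y Z} (hF : S.arr F = S.arr f * S.arr (S.id Z'))
    (hG : S.arr G = S.arr g * S.arr (S.id Z')) :
    S.arr (S.comp F G) = S.arr (S.comp f g) * S.arr (S.id Z') := by
  rw [arr_comp_eq_mul hF hG, S.comp_id]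

theorem comp_zero {X Y Z : Comp} (f : S.Hom X Y) : S.comp f (0 : S.Hom Y Z) = 0 := by
  simpa using S.comp_smul 0 f (0 : S.Hom Y Z)

theorem zero_comp {X Y Z : Comp} (f : S.Hom Y Z) : S.comp (0 : S.Hom X Y) f = 0 := by
  simpa using S.smul_comp 0 (0 : S.Hom X Y) f

end CompCat

open CompCat

/-- Omission of the entries that are zero. -/
def squash : List ℕ → Comp
  | [] => []
  | a :: X => Term.strand a ++ squash X

theorem strand_coe (a : ℕ+) : Term.strand (a : ℕ) = [a] := by
  obtain ⟨n, rfl⟩ : ∃ n : ℕ, n.succPNat = a := ⟨a.natPred, PNat.succPNat_natPred a⟩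
  rfl

theorem squash_map (X : Comp) : squash (X.map PNat.val) = X := by
  induction X with
  | nil => rfl
  | cons a X ih => rw [List.map_cons, squash, ih, strand_coe]; rfl

namespace Term

variable {k : Type u} [CommRing k]

/-- The morphism of the web category represented by an expression. -/
def cls {X Y : Comp} (f : Term k X Y) : (webCat k).Hom X Y := WebHom.mk f

theorem cls_comp {X Y Z : Comp} (f : Term k X Y) (g : Term k Y Z) :
    (comp f g).cls = (webCat k).comp f.cls g.cls := rfl

theorem cls_tensor {X Y X' Y' : Comp} (f : Term k X Y) (g : Term k X' Y') :
    (tensor f g).cls = (webCat k).tensor f.cls g.cls := rfl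

theorem cls_eq {X Y : Comp} {f g : Term k X Y} (h : Rel f g) : f.cls = g.cls := WebHom.sound h

theorem cls_sum {X Y : Comp} (l : List (Term k X Y)) : (sum l).cls = (l.map cls).sum := by
  induction l with
  | nil => rfl
  | cons f l ih => rw [List.map_cons, List.sum_cons, ← ih]; rfl

theorem arr_cls_castHom {X X' Y Y' : Comp} (hX : X = X') (hY : Y = Y') (f : Term k X Y) :
    arr (castHom hX hY f : Term k X' Y').cls = arr f.cls := by
  subst hX hY
  rfl

/-- The double sum over a list of lists that occurs in `ladderSum`, as a sum over a finite set. -/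
theorem sum_flatMap_range {M : Type*} [AddCommMonoid M] (g : ℕ → ℕ → M) (m n : ℕ) :
    ((List.range m).flatMap fun s => (List.range n).map (g s)).sum =
      ∑ T ∈ Finset.range m ×ˢ Finset.range n, g T.1 T.2 := by
  have key : ∀ s, ((List.range n).map (g s)).sum = ∑ t ∈ Finset.range n, g s t := by
    intro s
    induction n with
    | zero => rfl
    | succ n ih =>
      rw [List.range_succ, List.map_append, List.sum_append, ih, Finset.sum_range_succ]
      simp
  rw [Finset.sum_product]
  induction m with
  | zero => rfl
  | succ m ih =>
    rw [List.range_succ, List.flatMap_append, List.sum_append, ih, Finset.sum_range_succ, ← key]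
    simp

theorem cls_ladderSum (a b c d : ℕ+) (h : a + c = b + d) :
    (ladderSum (k := k) a b c d h).cls =
      ∑ T ∈ Finset.range (min (a : ℕ) b + 1) ×ˢ Finset.range (min (c : ℕ) d + 1),
        (ladderST a b c d h T.1 T.2).cls := by
  rw [ladderSum, cls_sum, List.map_flatMap]
  simp only [List.map_map]
  exact sum_flatMap_range _ _ _

end Term

namespace WebHom

variable (k : Type u) [CommRing k]

/-- The merge of strings that may have thickness zero, in which case it is an identity. It is zero
if `a + b ≠ n`. -/
def merge (a b n : ℕ) : (webCat k).Hom (Term.strand a ++ Term.strand b) (Term.strand n) :=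
  match n, a, b with
  | 0, 0, 0 => (webCat k).id []
  | 0, _ + 1, _ => 0
  | 0, _, _ + 1 => 0
  | n + 1, a, b => if h : a + b = n + 1 then (Term.mergeZ a b n.succPNat h).cls else 0

/-- The split into strings that may have thickness zero, in which case it is an identity. It is
zero if `a + b ≠ n`. -/
def split : ∀ n a b : ℕ, (webCat k).Hom (Term.strand n) (Term.strand a ++ Term.strand b)
  | 0, 0, 0 => (webCat k).id []
  | 0, _ + 1, _ => 0
  | 0, _, _ + 1 => 0
  | n + 1, a, b => if h : a + b = n + 1 then (Term.splitZ a b n.succPNat h).cls else 0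

variable {k}

theorem merge_ne : ∀ {a b n : ℕ}, a + b ≠ n → merge k a b n = 0
  | 0, 0, 0, h => absurd rfl h
  | _ + 1, _, 0, _ => rfl
  | 0, _ + 1, 0, _ => rfl
  | _, _, _ + 1, h => dif_neg h

theorem split_ne : ∀ {n a b : ℕ}, a + b ≠ n → split k n a b = 0
  | 0, 0, 0, h => absurd rfl h
  | 0, _ + 1, _, _ => rfl
  | 0, 0, _ + 1, _ => rfl
  | _ + 1, _, _, h => dif_neg h

theorem merge_eq {a b : ℕ} {x : ℕ+} (h : a + b = (x : ℕ)) :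
    arr (merge k a b (x : ℕ)) = arr (Term.mergeZ a b x h).cls := by
  obtain ⟨n, rfl⟩ : ∃ n : ℕ, n.succPNat = x := ⟨x.natPred, PNat.succPNat_natPred x⟩
  refine congrArg arr ?_
  rw [Nat.succPNat_coe] at h
  change merge k a b (n + 1) = _
  exact dif_pos h

theorem split_eq {a b : ℕ} {x : ℕ+} (h : a + b = (x : ℕ)) :
    arr (split k (x : ℕ) a b) = arr (Term.splitZ a b x h).cls := by
  obtain ⟨n, rfl⟩ : ∃ n : ℕ, n.succPNat = x := ⟨x.natPred, PNat.succPNat_natPred x⟩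
  refine congrArg arr ?_
  rw [Nat.succPNat_coe] at h
  change split k (n + 1) a b = _
  exact dif_pos h

theorem arr_merge_zero_left (b : ℕ) :
    arr (merge k 0 b b) = arr ((webCat k).id (Term.strand b)) := by
  rcases b with _ | b
  · rfl
  · refine (merge_eq (x := b.succPNat) (Nat.zero_add _)).trans ?_
    exact Term.arr_cls_castHom (by rfl) (by rfl) _

theorem arr_merge_zero_right (a : ℕ) :
    arr (merge k a 0 a) = arr ((webCat k).id (Term.strand a)) := by
  rcases a with _ | a
  · rfl
  · refine (merge_eq (x := a.succPNat) (Nat.add_zero _)).trans ?_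
    exact Term.arr_cls_castHom (by rfl) (by rfl) _

theorem arr_split_zero_left (b : ℕ) :
    arr (split k b 0 b) = arr ((webCat k).id (Term.strand b)) := by
  rcases b with _ | b
  · rfl
  · refine (split_eq (x := b.succPNat) (Nat.zero_add _)).trans ?_
    exact Term.arr_cls_castHom (by rfl) (by rfl) _

theorem arr_split_zero_right (a : ℕ) :
    arr (split k a a 0) = arr ((webCat k).id (Term.strand a)) := by
  rcases a with _ | a
  · rfl
  · refine (split_eq (x := a.succPNat) (Nat.add_zero _)).trans ?_
    exact Term.arr_cls_castHom (by rfl) (by rfl) _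

theorem arr_cross_zero_left (b : ℕ) :
    arr (Term.crossZ (k := k) 0 b).cls = arr ((webCat k).id (Term.strand b)) := by
  rcases b with _ | b <;> rfl

theorem arr_cross_zero_right (a : ℕ) :
    arr (Term.crossZ (k := k) a 0).cls = arr ((webCat k).id (Term.strand a)) := by
  rcases a with _ | a <;> rfl

theorem arr_merge_coe {a b : ℕ+} {n : ℕ} (h : (a + b : ℕ) = n) :
    arr (merge k a b n) = arr (Term.merge (k := k) a b).cls := by
  obtain ⟨a, rfl⟩ : ∃ n : ℕ, n.succPNat = a := ⟨a.natPred, PNat.succPNat_natPred a⟩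
  obtain ⟨b, rfl⟩ : ∃ n : ℕ, n.succPNat = b := ⟨b.natPred, PNat.succPNat_natPred b⟩
  subst h
  refine (merge_eq (x := a.succPNat + b.succPNat) rfl).trans ?_
  exact Term.arr_cls_castHom (by rfl) (by rfl) _

theorem arr_split_coe {a b : ℕ+} {n : ℕ} (h : (a + b : ℕ) = n) :
    arr (split k n a b) = arr (Term.split (k := k) a b).cls := by
  obtain ⟨a, rfl⟩ : ∃ n : ℕ, n.succPNat = a := ⟨a.natPred, PNat.succPNat_natPred a⟩
  obtain ⟨b, rfl⟩ : ∃ n : ℕ, n.succPNat = b := ⟨b.natPred, PNat.succPNat_natPred b⟩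
  subst h
  refine (split_eq (x := a.succPNat + b.succPNat) rfl).trans ?_
  exact Term.arr_cls_castHom (by rfl) (by rfl) _

theorem arr_cross_coe (a b : ℕ+) :
    arr (Term.crossZ (k := k) a b).cls = arr (Term.cross (k := k) a b).cls := by
  obtain ⟨a, rfl⟩ : ∃ n : ℕ, n.succPNat = a := ⟨a.natPred, PNat.succPNat_natPred a⟩
  obtain ⟨b, rfl⟩ : ∃ n : ℕ, n.succPNat = b := ⟨b.natPred, PNat.succPNat_natPred b⟩
  rfl

theorem arr_id_strand_coe (a : ℕ+) :
    arr ((webCat k).id (Term.strand a)) = arr ((webCat k).id [a]) := by rw [strand_coe]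

/-- The merge of the two leftmost strings. -/
def wM (a b n : ℕ) (Z : List ℕ) : (webCat k).Hom (squash (a :: b :: Z)) (squash (n :: Z)) :=
  whisk (S := webCat k) (squash Z) (List.append_assoc _ _ _) rfl (merge k a b n)

/-- The split of the leftmost string. -/
def wS (n a b : ℕ) (Z : List ℕ) : (webCat k).Hom (squash (n :: Z)) (squash (a :: b :: Z)) :=
  whisk (S := webCat k) (squash Z) rfl (List.append_assoc _ _ _) (split k n a b)

/-- The crossing of the two leftmost strings. -/
def wX (a b : ℕ) (Z : List ℕ) : (webCat k).Hom (squash (a :: b :: Z)) (squash (b :: a :: Z)) :=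
  whisk (S := webCat k) (squash Z) (List.append_assoc _ _ _) (List.append_assoc _ _ _)
    (Term.crossZ a b).cls

/-- Juxtaposition of a string on the left. -/
def wl (a : ℕ) {X Y : List ℕ} (f : (webCat k).Hom (squash X) (squash Y)) :
    (webCat k).Hom (squash (a :: X)) (squash (a :: Y)) :=
  (webCat k).tensor ((webCat k).id (Term.strand a)) f

theorem arr_wl (a : ℕ) {X Y : List ℕ} (f : (webCat k).Hom (squash X) (squash Y)) :
    arr (wl a f) = arr ((webCat k).id (Term.strand a)) * arr f := rfl

theorem arr_id_cons (a : ℕ) (Z : List ℕ) : arr ((webCat k).id (squash (a :: Z))) =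
    arr ((webCat k).id (Term.strand a)) * arr ((webCat k).id (squash Z)) :=
  arr_id_append _ _

theorem arr_wM (a b n : ℕ) (Z : List ℕ) : arr (wM (k := k) a b n Z) =
    arr (merge k a b n) * arr ((webCat k).id (squash Z)) := arr_whisk _ _ _ _

theorem arr_wS (n a b : ℕ) (Z : List ℕ) : arr (wS (k := k) n a b Z) =
    arr (split k n a b) * arr ((webCat k).id (squash Z)) := arr_whisk _ _ _ _

theorem arr_wX (a b : ℕ) (Z : List ℕ) : arr (wX (k := k) a b Z) =
    arr (Term.crossZ (k := k) a b).cls * arr ((webCat k).id (squash Z)) := arr_whisk _ _ _ _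

theorem wM_ne {a b n : ℕ} (Z : List ℕ) (h : a + b ≠ n) : wM (k := k) a b n Z = 0 := by
  exact (congrArg (whisk (S := webCat k) _ _ _) (merge_ne h)).trans (map_zero _)

theorem wS_ne {a b n : ℕ} (Z : List ℕ) (h : a + b ≠ n) : wS (k := k) n a b Z = 0 := by
  exact (congrArg (whisk (S := webCat k) _ _ _) (split_ne h)).trans (map_zero _)

theorem wl_zero (a : ℕ) {X Y : List ℕ} :
    wl a (0 : (webCat k).Hom (squash X) (squash Y)) = 0 := (webCat k).tensor_zero' _

theorem wl_comp (a : ℕ) {X Y Z : List ℕ} (f : (webCat k).Hom (squash X) (squash Y))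
    (g : (webCat k).Hom (squash Y) (squash Z)) :
    wl a ((webCat k).comp f g) = (webCat k).comp (wl a f) (wl a g) := by
  refine arr_inj.1 ((arr_comp_eq_mul (arr_wl a f) (arr_wl a g)).trans ?_).symm
  rw [(webCat k).comp_id, arr_wl]

theorem arr_wl_wl (a b : ℕ) {X Y : List ℕ} (f : (webCat k).Hom (squash X) (squash Y)) :
    arr (wl a (wl b f)) = arr ((webCat k).id (Term.strand a ++ Term.strand b)) * arr f := by
  rw [arr_wl, arr_wl, arr_id_append, mul_assoc]

theorem wM_nat (a b n : ℕ) {Z Z' : List ℕ} (f : (webCat k).Hom (squash Z) (squash Z')) :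
    (webCat k).comp (wM a b n Z) (wl n f) = (webCat k).comp (wl a (wl b f)) (wM a b n Z') :=
  arr_inj.1 ((arr_comp_left_right (arr_wM a b n Z) (arr_wl n f)).trans
    (arr_comp_right_left (arr_wl_wl a b f) (arr_wM a b n Z')).symm)

theorem wS_nat (n a b : ℕ) {Z Z' : List ℕ} (f : (webCat k).Hom (squash Z) (squash Z')) :
    (webCat k).comp (wS n a b Z) (wl a (wl b f)) = (webCat k).comp (wl n f) (wS n a b Z') :=
  arr_inj.1 ((arr_comp_left_right (arr_wS n a b Z) (arr_wl_wl a b f)).trans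
    (arr_comp_right_left (arr_wl n f) (arr_wS n a b Z')).symm)

theorem wX_nat (a b : ℕ) {Z Z' : List ℕ} (f : (webCat k).Hom (squash Z) (squash Z')) :
    (webCat k).comp (wX a b Z) (wl b (wl a f)) = (webCat k).comp (wl a (wl b f)) (wX a b Z') :=
  arr_inj.1 ((arr_comp_left_right (arr_wX a b Z) (arr_wl_wl b a f)).trans
    (arr_comp_right_left (arr_wl_wl a b f) (arr_wX a b Z')).symm)

theorem arr_wM_cons (a b c e : ℕ+) (h : a + b = e) (Z : List ℕ) :
    arr (wM (k := k) a b e (c :: Z)) =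
      arr (Term.tensor (Term.merge (k := k) a b) (.id [c])).cls *
        arr ((webCat k).id (squash Z)) := by
  subst h
  rw [arr_wM, arr_merge_coe (by simp), arr_id_cons, ← mul_assoc, arr_id_strand_coe]
  rfl

theorem arr_wS_cons (a b c e : ℕ+) (h : a + b = e) (Z : List ℕ) :
    arr (wS (k := k) e a b (c :: Z)) =
      arr (Term.tensor (Term.split (k := k) a b) (.id [c])).cls *
        arr ((webCat k).id (squash Z)) := by
  subst h
  rw [arr_wS, arr_split_coe (by simp), arr_id_cons, ← mul_assoc, arr_id_strand_coe]
  rfl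

theorem arr_wl_wM (a b c e : ℕ+) (h : b + c = e) (Z : List ℕ) :
    arr (wl a (wM (k := k) b c e Z)) =
      arr (Term.tensor (.id [a]) (Term.merge (k := k) b c)).cls *
        arr ((webCat k).id (squash Z)) := by
  subst h
  rw [arr_wl, arr_wM, arr_merge_coe (by simp), ← mul_assoc, arr_id_strand_coe]
  rfl

theorem arr_wl_wS (a b c e : ℕ+) (h : b + c = e) (Z : List ℕ) :
    arr (wl a (wS (k := k) e b c Z)) =
      arr (Term.tensor (.id [a]) (Term.split (k := k) b c)).cls *
        arr ((webCat k).id (squash Z)) := by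
  subst h
  rw [arr_wl, arr_wS, arr_split_coe (by simp), ← mul_assoc, arr_id_strand_coe]
  rfl

theorem arr_wM_coe (a b n : ℕ+) (h : a + b = n) (Z : List ℕ) : arr (wM (k := k) a b n Z) =
    arr (Term.merge (k := k) a b).cls * arr ((webCat k).id (squash Z)) := by
  subst h
  rw [arr_wM, arr_merge_coe (by simp)]

theorem arr_wS_coe (a b n : ℕ+) (h : a + b = n) (Z : List ℕ) : arr (wS (k := k) n a b Z) =
    arr (Term.split (k := k) a b).cls * arr ((webCat k).id (squash Z)) := by
  subst h
  rw [arr_wS, arr_split_coe (by simp)]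

theorem wM_assoc (a b c : ℕ+) (Z : List ℕ) :
    (webCat k).comp (wM a b (a + b : ℕ+) (c :: Z)) (wM (a + b : ℕ+) c (a + b + c : ℕ+) Z) =
      (webCat k).comp (wl a (wM b c (b + c : ℕ+) Z)) (wM a (b + c : ℕ+) (a + b + c : ℕ+) Z) := by
  refine arr_inj.1 ((arr_comp_mul_id (arr_wM_cons a b c _ rfl Z) (arr_wM_coe _ _ _ rfl Z)).trans
    (.trans ?_ (arr_comp_mul_id (arr_wl_wM a b c _ rfl Z)
      (arr_wM_coe _ _ _ (add_assoc a b c).symm Z)).symm))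
  refine congrArg (· * _) ?_
  exact (arr_inj.2 (Term.cls_eq (.merge_assoc a b c))).trans (Term.arr_cls_castHom _ _ _)

theorem wS_assoc (a b c : ℕ+) (Z : List ℕ) :
    (webCat k).comp (wS (a + b + c : ℕ+) (a + b : ℕ+) c Z) (wS (a + b : ℕ+) a b (c :: Z)) =
      (webCat k).comp (wS (a + b + c : ℕ+) a (b + c : ℕ+) Z) (wl a (wS (b + c : ℕ+) b c Z)) := by
  refine arr_inj.1 ((arr_comp_mul_id (arr_wS_coe _ _ _ rfl Z) (arr_wS_cons a b c _ rfl Z)).trans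
    (.trans ?_ (arr_comp_mul_id (arr_wS_coe _ _ _ (add_assoc a b c).symm Z)
      (arr_wl_wS a b c _ rfl Z)).symm))
  refine congrArg (· * _) ?_
  exact (arr_inj.2 (Term.cls_eq (.split_assoc a b c))).trans (Term.arr_cls_castHom _ _ _)

theorem digon (a b : ℕ+) (Z : List ℕ) :
    (webCat k).comp (wS (a + b : ℕ+) a b Z) (wM a b (a + b : ℕ+) Z) =
      (Nat.choose (a + b) a : k) • (webCat k).id (squash ((a + b : ℕ+) :: Z)) := by
  have h : [a + b] ++ squash Z = squash ((a + b : ℕ+) :: Z) := by rw [squash, strand_coe]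
  have h1 : (webCat k).comp (wS (a + b : ℕ+) a b Z) (wM a b (a + b : ℕ+) Z) =
      whisk (S := webCat k) (squash Z) h h (Term.comp (.split a b) (.merge a b)).cls :=
    arr_inj.1 ((arr_comp_mul_id (arr_wS_coe _ _ _ rfl Z) (arr_wM_coe _ _ _ rfl Z)).trans
      (arr_whisk _ _ _ _).symm)
  have h2 : (webCat k).id (squash ((a + b : ℕ+) :: Z)) =
      whisk (S := webCat k) (squash Z) h h (Term.id [a + b]).cls := by
    refine arr_inj.1 (.trans ?_ (arr_whisk _ _ _ _).symm)
    rw [arr_id_cons, arr_id_strand_coe]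
    rfl
  rw [h1, h2, Term.cls_eq (.digon a b), ← map_smul]
  rfl

/-- The summand of the merge-split relation, composed from `wS`, `wX` and `wM`. -/
def wL (a c b d s u v t : ℕ) (Z : List ℕ) :
    (webCat k).Hom (squash (a :: c :: Z)) (squash (b :: d :: Z)) :=
  (webCat k).comp (wS a s u (c :: Z)) <| (webCat k).comp (wl s (wl u (wS c v t Z))) <|
    (webCat k).comp (wl s (wX u v (t :: Z))) <| (webCat k).comp (wM s v b (u :: t :: Z)) <|
      wl b (wM u t d Z)

theorem arr_wL {a b c d : ℕ+} {s u v t : ℕ} (ha : s + u = (a : ℕ)) (hc : v + t = (c : ℕ))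
    (hb : s + v = (b : ℕ)) (hd : u + t = (d : ℕ)) (Z : List ℕ) :
    arr (wL (k := k) a c b d s u v t Z) =
      arr (Term.ladder (k := k) a b c d s u v t ha hc hb hd).cls *
        arr ((webCat k).id (squash Z)) := by
  rw [wL, ← (webCat k).assoc, Term.ladder, Term.cls_comp, Term.cls_comp]
  refine arr_comp_mul_id ?_ (arr_comp_mul_id ?_ ?_)
  · refine (arr_comp_left_right (f := (Term.splitZ s u a ha).cls)
      (g := (webCat k).tensor (Term.splitZ v t c hc).cls ((webCat k).id (squash Z)))
      ?_ ?_).trans ?_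
    · rw [arr_wS, split_eq ha, arr_id_cons, arr_id_append, strand_coe]
    · rw [arr_wl_wl, arr_wS, split_eq hc]; rfl
    · rw [arr_tensor, ← mul_assoc]; rfl
  · rw [Term.arr_cls_castHom, Term.cls_tensor, Term.cls_tensor, arr_tensor, arr_tensor, arr_wl,
      arr_wX, arr_id_cons]
    simp only [mul_assoc]
    rfl
  · refine (arr_comp_left_right (f := (Term.mergeZ s v b hb).cls)
      (g := (webCat k).tensor (Term.mergeZ u t d hd).cls ((webCat k).id (squash Z)))
      ?_ ?_).trans ?_
    · rw [arr_wM, merge_eq hb, arr_id_cons, arr_id_cons, arr_id_append, arr_id_append, mul_assoc]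
    · rw [arr_wl, arr_wM, merge_eq hd, strand_coe]; rfl
    · rw [arr_tensor, ← mul_assoc]; rfl

theorem wL_ne {a b c d s u v t : ℕ} (h : s + v ≠ b ∨ u + t ≠ d) (Z : List ℕ) :
    wL (k := k) a c b d s u v t Z = 0 := by
  rcases h with h | h
  · simp only [wL, wM_ne _ h, CompCat.zero_comp, CompCat.comp_zero]
  · simp only [wL, wM_ne _ h, wl_zero, CompCat.comp_zero]

open Finset.HasAntidiagonal in
theorem merge_split (a b c d : ℕ+) (h : a + c = b + d) (Z : List ℕ) :
    (webCat k).comp (wM a c (a + c : ℕ+) Z) (wS (a + c : ℕ+) b d Z) =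
      ∑ P ∈ antidiagonal (a : ℕ), ∑ Q ∈ antidiagonal (c : ℕ),
        wL a c b d P.1 P.2 Q.1 Q.2 Z := by
  have hac : [a, c] ++ squash Z = squash (a :: c :: Z) := by
    simp only [squash, strand_coe]; rfl
  have hbd : [b, d] ++ squash Z = squash (b :: d :: Z) := by
    simp only [squash, strand_coe]; rfl
  have h' := congrArg PNat.val h
  simp only [PNat.add_coe] at h'
  have h1 : (webCat k).comp (wM a c (a + c : ℕ+) Z) (wS (a + c : ℕ+) b d Z) =
      whisk (S := webCat k) (squash Z) hac hbd (Term.ladderSum a b c d h).cls := by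
    rw [← Term.cls_eq (.merge_split a b c d h)]
    refine arr_inj.1 ((arr_comp_mul_id (arr_wM_coe _ _ _ rfl Z)
      ((arr_wS_coe _ _ _ h.symm Z).trans
        (congrArg (· * _) (Term.arr_cls_castHom _ _ _).symm))).trans (arr_whisk _ _ _ _).symm)
  rw [h1, Term.cls_ladderSum, map_sum, ← Finset.sum_product']
  symm
  have hterm : ∀ s t : ℕ, s ≤ min (a : ℕ) b ∧ t ≤ min (c : ℕ) d ∧ t + (a : ℕ) = s + (d : ℕ) →
      whisk (S := webCat k) (squash Z) hac hbd (Term.ladderST a b c d h s t).cls =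
        wL a c b d s (a - s) (c - t) t Z := fun s t hst => by
    rw [Term.ladderST, dif_pos hst]
    exact arr_inj.1 ((arr_whisk _ _ _ _).trans (arr_wL _ _ _ _ Z).symm)
  have hne : ∀ T ∈ antidiagonal (a : ℕ) ×ˢ antidiagonal (c : ℕ),
      wL (k := k) a c b d T.1.1 T.1.2 T.2.1 T.2.2 Z ≠ 0 →
      (T.1.1 + T.1.2 = a ∧ T.2.1 + T.2.2 = c) ∧ T.1.1 + T.2.1 = b ∧ T.1.2 + T.2.2 = d := by
    intro T hT h0
    rw [Finset.mem_product, mem_antidiagonal, mem_antidiagonal] at hT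
    by_contra hcon
    exact h0 (wL_ne (by tauto) Z)
  -- A ladder with the right thicknesses is determined by its two outer strings `s` and `t`.
  refine Finset.sum_bij_ne_zero (fun T _ _ => (T.1.1, T.2.2)) ?_ ?_ ?_ ?_
  · intro T hT h0
    have := hne T hT h0
    simp only [Finset.mem_product, Finset.mem_range]
    omega
  · rintro ⟨⟨p, p'⟩, q, q'⟩ hT h0 ⟨⟨r, r'⟩, s, s'⟩ hT' h0' he
    have h1 := hne _ hT h0
    have h2 := hne _ hT' h0'
    simp only [Prod.mk.injEq] at h1 h2 he ⊢
    omega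
  · rintro ⟨s, t⟩ - h0
    have hst : s ≤ min (a : ℕ) b ∧ t ≤ min (c : ℕ) d ∧ t + (a : ℕ) = s + (d : ℕ) := by
      by_contra hcon
      refine h0 ?_
      rw [Term.ladderST, dif_neg hcon]
      exact map_zero (whisk (S := webCat k) _ _ _)
    refine ⟨((s, a - s), (c - t, t)), ?_, ?_, rfl⟩
    · simp only [Finset.mem_product, mem_antidiagonal]
      omega
    · rwa [hterm s t hst] at h0
  · rintro ⟨⟨p, p'⟩, q, q'⟩ hT h0
    have h1 := hne _ hT h0
    simp only at h1
    rw [hterm p q' (by omega), show (a : ℕ) - p = p' by omega, show (c : ℕ) - q' = q by omega]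

end WebHom

open WebHom in
/-- The web category as a model: strings of thickness zero are omitted, so that their removal and
creation are identities. -/
def webModel (k : Type u) [CommRing k] : WebModel k where
  Hom X Y := (webCat k).Hom (squash X) (squash Y)
  addCommGroup X Y := (webCat k).addCommGroup _ _
  module X Y := (webCat k).module _ _
  id X := (webCat k).id (squash X)
  comp := (webCat k).comp
  id_comp := (webCat k).id_comp
  comp_id := (webCat k).comp_id
  assoc := (webCat k).assoc
  add_comp := (webCat k).add_comp
  comp_add := (webCat k).comp_add
  smul_comp := (webCat k).smul_comp
  comp_smul := (webCat k).comp_smul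
  wl a _ _ f := wl a f
  wl_id a X := (webCat k).id_tensor_id _ _
  wl_comp a _ _ _ f g := wl_comp a f g
  wl_add a _ _ f g := (webCat k).tensor_add _ f g
  wl_smul a _ _ r f := (webCat k).tensor_smul r _ f
  del Z := (webCat k).id (squash Z)
  ins Z := (webCat k).id (squash Z)
  del_ins Z := (webCat k).comp_id _
  ins_del Z := (webCat k).comp_id _
  del_nat f := by
    refine ((webCat k).id_comp f).trans (.trans ?_ ((webCat k).comp_id _).symm)
    exact ((webCat k).unit_tensor f).symm
  M := wM
  S := wS
  X := wX
  M_nat a b n _ _ f := wM_nat a b n f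
  S_nat n a b _ _ f := wS_nat n a b f
  X_nat a b _ _ f := wX_nat a b f
  M_ne _ _ _ Z h := wM_ne Z h
  S_ne _ _ _ Z h := wS_ne Z h
  M_zero_left b Z := arr_inj.1 <|
    (arr_wM 0 b b Z).trans ((congrArg (· * _) (arr_merge_zero_left b)).trans (arr_id_cons b Z).symm)
  M_zero_right a Z := arr_inj.1 <|
    (arr_wM a 0 a Z).trans (congrArg (· * _) (arr_merge_zero_right a))
  S_zero_left b Z := arr_inj.1 <|
    (arr_wS b 0 b Z).trans ((congrArg (· * _) (arr_split_zero_left b)).trans (arr_id_cons b Z).symm)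
  S_zero_right a Z := arr_inj.1 <|
    (arr_wS a a 0 Z).trans (congrArg (· * _) (arr_split_zero_right a))
  X_zero_left b Z := arr_inj.1 <|
    (arr_wX 0 b Z).trans ((congrArg (· * _) (arr_cross_zero_left b)).trans
      (arr_inj.2 ((webCat k).id_comp _)).symm)
  X_zero_right a Z := arr_inj.1 <|
    (arr_wX a 0 Z).trans ((congrArg (· * _) (arr_cross_zero_right a)).trans
      ((arr_inj.2 ((webCat k).comp_id _)).symm))
  M_assoc_pos a b c e f n Z ha hb hc he hf := by
    subst he hf
    lift a to ℕ+ using ha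
    lift b to ℕ+ using hb
    lift c to ℕ+ using hc
    by_cases h : (a + b + c : ℕ) = n
    · subst h
      exact wM_assoc a b c Z
    · refine (congrArg _ (wM_ne Z h)).trans ((CompCat.comp_zero _).trans ?_)
      exact ((congrArg _ (wM_ne Z (by omega))).trans (CompCat.comp_zero _)).symm
  S_assoc_pos a b c e f n Z ha hb hc he hf := by
    subst he hf
    lift a to ℕ+ using ha
    lift b to ℕ+ using hb
    lift c to ℕ+ using hc
    by_cases h : (a + b + c : ℕ) = n
    · subst h
      exact wS_assoc a b c Z
    · have h1 := wS_ne (k := k) Z h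
      have h2 := wS_ne (k := k) (a := a) (b := b + c) (n := n) Z (by omega)
      refine (congrArg (fun x => (webCat k).comp x _) h1).trans ((CompCat.zero_comp _).trans ?_)
      exact ((congrArg (fun x => (webCat k).comp x _) h2).trans (CompCat.zero_comp _)).symm
  digon_pos n a b Z ha hb h := by
    subst h
    lift a to ℕ+ using ha
    lift b to ℕ+ using hb
    exact digon a b Z
  merge_split_pos a c n b d Z ha hb hc hd h h' := by
    lift a to ℕ+ using ha
    lift b to ℕ+ using hb
    lift c to ℕ+ using hc
    lift d to ℕ+ using hd
    subst h
    exact merge_split a b c d (PNat.eq h'.symm) Z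

end SchurWeb

namespace SchurWeb

/-! ### A spanning set of the web category -/

open CompCat WebModel

namespace WebHom

variable {k : Type u} [CommRing k]

/-- A morphism of the web category with identity strings `L` on its left and `Z` on its right, as a
morphism of the model. -/
def embed (L Z : Comp) {X Y : Comp} {U V : List ℕ} (hU : L ++ (X ++ Z) = squash U)
    (hV : L ++ (Y ++ Z) = squash V) : (webCat k).Hom X Y →ₗ[k] (webModel k).Hom U V where
  toFun f := castHom (H := (webCat k).Hom) hU hV
    ((webCat k).tensor ((webCat k).id L) ((webCat k).tensor f ((webCat k).id Z)))
  map_add' f g := by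
    have : ∀ {U V : Comp} (hU : L ++ (X ++ Z) = U) (hV : L ++ (Y ++ Z) = V),
      castHom (H := (webCat k).Hom) hU hV ((webCat k).tensor ((webCat k).id L)
        ((webCat k).tensor (f + g) ((webCat k).id Z))) =
      castHom (H := (webCat k).Hom) hU hV ((webCat k).tensor ((webCat k).id L)
        ((webCat k).tensor f ((webCat k).id Z))) +
      castHom (H := (webCat k).Hom) hU hV ((webCat k).tensor ((webCat k).id L)
        ((webCat k).tensor g ((webCat k).id Z))) := by
      rintro U V rfl rfl
      rw [(webCat k).add_tensor, (webCat k).tensor_add]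
      rfl
    exact this _ _
  map_smul' r f := by
    have : ∀ {U V : Comp} (hU : L ++ (X ++ Z) = U) (hV : L ++ (Y ++ Z) = V),
      castHom (H := (webCat k).Hom) hU hV ((webCat k).tensor ((webCat k).id L)
        ((webCat k).tensor (r • f) ((webCat k).id Z))) =
      r • castHom (H := (webCat k).Hom) hU hV ((webCat k).tensor ((webCat k).id L)
        ((webCat k).tensor f ((webCat k).id Z))) := by
      rintro U V rfl rfl
      rw [(webCat k).smul_tensor, (webCat k).tensor_smul]
      rfl
    exact this _ _

/-- A morphism of the model as an element of the monoid of all morphisms. -/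
def modelArr {U V : List ℕ} (F : (webModel k).Hom U V) : (webCat k).Arr :=
  CompCat.arr (S := webCat k) (X := squash U) (Y := squash V) F

theorem modelArr_inj {U V : List ℕ} {F G : (webModel k).Hom U V} (h : modelArr F = modelArr G) :
    F = G := arr_inj.1 h

theorem modelArr_embed (L Z : Comp) {X Y : Comp} {U V : List ℕ} (hU : L ++ (X ++ Z) = squash U)
    (hV : L ++ (Y ++ Z) = squash V) (f : (webCat k).Hom X Y) :
    modelArr (embed L Z hU hV f) =
      arr ((webCat k).id L) * (arr f * arr ((webCat k).id Z)) :=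
  arr_castHom hU hV _

/-- A morphism of the web category is stable if it preserves the spans of the normal forms, whatever
identity strings are juxtaposed on its two sides. Allowing these makes the notion compatible with
tensor products. -/
def StableWeb {X Y : Comp} (f : (webCat k).Hom X Y) : Prop :=
  ∀ (L Z : Comp) {U V : List ℕ} (hU : L ++ (X ++ Z) = squash U) (hV : L ++ (Y ++ Z) = squash V),
    U = (L ++ (X ++ Z)).map PNat.val → V = (L ++ (Y ++ Z)).map PNat.val →
      Stable (embed L Z hU hV f)

theorem stableWeb_id (X : Comp) : StableWeb ((webCat k).id X) := by
  rintro L Z U V hU hV rfl rfl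
  have : embed L Z hU hV ((webCat k).id X) = (webModel k).id _ :=
    modelArr_inj (by
      rw [modelArr_embed, ← arr_id_append, ← arr_id_append]
      exact arr_id_congr hU)
  rw [this]
  exact Stable.id _

theorem stableWeb_comp {X Y Z : Comp} {f : (webCat k).Hom X Y} {g : (webCat k).Hom Y Z}
    (hf : StableWeb f) (hg : StableWeb g) : StableWeb ((webCat k).comp f g) := by
  rintro L T U V hU hV hU' hV'
  have hM : L ++ (Y ++ T) = squash ((L ++ (Y ++ T)).map PNat.val) := (squash_map _).symm
  have : embed L T hU hV ((webCat k).comp f g) =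
      (webModel k).comp (embed L T hU hM f) (embed L T hM hV g) :=
    modelArr_inj (by
      have h1 : arr ((webCat k).comp ((webCat k).tensor f ((webCat k).id T))
          ((webCat k).tensor g ((webCat k).id T))) =
          arr ((webCat k).comp f g) * arr ((webCat k).id T) := by
        rw [(webCat k).interchange, (webCat k).comp_id]
        rfl
      refine Eq.trans ?_ (arr_comp_eq_mul (S := webCat k)
        (f := (webCat k).id L) (g := (webCat k).id L)
        (f' := (webCat k).tensor f ((webCat k).id T)) (g' := (webCat k).tensor g ((webCat k).id T))
        (modelArr_embed L T hU hM f) (modelArr_embed L T hM hV g)).symm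
      rw [modelArr_embed, (webCat k).comp_id, h1])
  rw [this]
  exact (hf _ _ _ _ hU' rfl).comp (hg _ _ _ _ rfl hV')

theorem stableWeb_tensor {X Y X' Y' : Comp} {f : (webCat k).Hom X Y} {g : (webCat k).Hom X' Y'}
    (hf : StableWeb f) (hg : StableWeb g) : StableWeb ((webCat k).tensor f g) := by
  rintro L T U V hU hV hU' hV'
  have hU1 : L ++ (X ++ (X' ++ T)) = squash U := by rw [← hU, List.append_assoc]
  have hM1 : L ++ (Y ++ (X' ++ T)) = squash ((L ++ (Y ++ (X' ++ T))).map PNat.val) :=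
    (squash_map _).symm
  have hM2 : (L ++ Y) ++ (X' ++ T) = squash ((L ++ (Y ++ (X' ++ T))).map PNat.val) := by
    rw [← hM1, List.append_assoc]
  have hV2 : (L ++ Y) ++ (Y' ++ T) = squash V := by rw [← hV]; simp only [List.append_assoc]
  have : embed L T hU hV ((webCat k).tensor f g) =
      (webModel k).comp (embed L (X' ++ T) hU1 hM1 f) (embed (L ++ Y) T hM2 hV2 g) :=
    modelArr_inj (by
      refine Eq.trans ?_ (arr_comp_left_right (S := webCat k)
        (f := (webCat k).tensor ((webCat k).id L) f)
        (g := (webCat k).tensor g ((webCat k).id T)) ?_ ?_).symm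
      · rw [modelArr_embed]; simp only [arr_tensor, mul_assoc]
      · refine (modelArr_embed L (X' ++ T) hU1 hM1 f).trans ?_
        simp only [arr_tensor, mul_assoc]
      · exact (modelArr_embed (L ++ Y) T hM2 hV2 g))
  rw [this]
  exact (hf _ _ _ _ (by rw [hU']; simp only [List.append_assoc]) rfl).comp
    (hg _ _ _ _ (by simp only [List.append_assoc]) (by rw [hV']; simp only [List.append_assoc]))

/-- Strings on the left can be added one at a time by `stable_wl`. -/
theorem stableWeb_of_nil {X Y : Comp} {f : (webCat k).Hom X Y}
    (h : ∀ (Z : Comp) {U V : List ℕ} (hU : [] ++ (X ++ Z) = squash U)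
      (hV : [] ++ (Y ++ Z) = squash V), U = (X ++ Z).map PNat.val → V = (Y ++ Z).map PNat.val →
        Stable (embed [] Z hU hV f)) : StableWeb f := by
  intro L Z
  induction L with
  | nil => exact h Z
  | cons a L ih =>
    rintro U V hU hV rfl rfl
    have hU1 : L ++ (X ++ Z) = squash ((L ++ (X ++ Z)).map PNat.val) := (squash_map _).symm
    have hV1 : L ++ (Y ++ Z) = squash ((L ++ (Y ++ Z)).map PNat.val) := (squash_map _).symm
    have : embed (a :: L) Z hU hV f = (webModel k).wl a (embed L Z hU1 hV1 f) :=
      modelArr_inj (by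
        refine Eq.trans ?_ (arr_wl a _).symm
        refine (modelArr_embed (a :: L) Z hU hV f).trans ?_
        refine Eq.trans ?_ (congrArg _ (modelArr_embed L Z hU1 hV1 f).symm)
        rw [arr_id_strand_coe, ← mul_assoc _ (arr ((webCat k).id L)), ← arr_id_append]
        rfl)
    rw [this]
    exact stable_wl (ih _ _ rfl rfl) a

theorem stableWeb_merge (a b : ℕ+) : StableWeb (Term.merge (k := k) a b).cls := by
  refine stableWeb_of_nil ?_
  rintro Z U V hU hV rfl rfl
  have : embed [] Z hU hV (Term.merge (k := k) a b).cls =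
      (webModel k).M a b (a + b : ℕ+) (Z.map PNat.val) :=
    modelArr_inj (by
      refine (modelArr_embed [] Z hU hV _).trans ?_
      refine Eq.trans ?_ (arr_wM_coe a b _ rfl _).symm
      rw [squash_map]
      exact one_mul _)
  rw [this]
  exact stable_M _ _ _ _

theorem stableWeb_split (a b : ℕ+) : StableWeb (Term.split (k := k) a b).cls := by
  refine stableWeb_of_nil ?_
  rintro Z U V hU hV rfl rfl
  have : embed [] Z hU hV (Term.split (k := k) a b).cls =
      (webModel k).S (a + b : ℕ+) a b (Z.map PNat.val) :=
    modelArr_inj (by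
      refine (modelArr_embed [] Z hU hV _).trans ?_
      refine Eq.trans ?_ (arr_wS_coe a b _ rfl _).symm
      rw [squash_map]
      exact one_mul _)
  rw [this]
  exact stable_S _ _ _ _

theorem stableWeb_cross (a b : ℕ+) : StableWeb (Term.cross (k := k) a b).cls := by
  refine stableWeb_of_nil ?_
  rintro Z U V hU hV rfl rfl
  have : embed [] Z hU hV (Term.cross (k := k) a b).cls =
      (webModel k).X a b (Z.map PNat.val) :=
    modelArr_inj (by
      refine (modelArr_embed [] Z hU hV _).trans ?_
      refine Eq.trans ?_ (arr_wX a b _).symm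
      rw [squash_map, arr_cross_coe]
      exact one_mul _)
  rw [this]
  exact stable_X _ _ _ _ rfl

theorem stableWeb {X Y : Comp} (f : Term k X Y) : StableWeb f.cls := by
  induction f with
  | id X => exact stableWeb_id X
  | comp f g hf hg => exact stableWeb_comp hf hg
  | tensor f g hf hg => exact stableWeb_tensor hf hg
  | zero =>
    intro L Z U V hU hV _ _
    refine Eq.mpr (congrArg Stable (map_zero (embed L Z hU hV))) (Stable.zero _ _)
  | add f g hf hg =>
    intro L Z U V hU hV hU' hV'
    exact Eq.mpr (congrArg Stable (map_add (embed L Z hU hV) f.cls g.cls))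
      ((hf L Z hU hV hU' hV').add (hg L Z hU hV hU' hV'))
  | smul r f hf =>
    intro L Z U V hU hV hU' hV'
    exact Eq.mpr (congrArg Stable (map_smul (embed L Z hU hV) r f.cls))
      ((hf L Z hU hV hU' hV').smul r)
  | merge a b => exact stableWeb_merge a b
  | split a b => exact stableWeb_split a b
  | cross a b => exact stableWeb_cross a b

/-- The morphisms from `mu` to `la` of the web category are spanned by a family indexed by the
matrices with row sums `la` and column sums `mu`. -/
theorem exists_span_eq_top (la mu : Comp) :
    ∃ b : Mat la mu → (webCat k).Hom mu la, Submodule.span k (Set.range b) = ⊤ := by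
  let g : (webModel k).Hom (mu.map PNat.val) (la.map PNat.val) →ₗ[k] (webCat k).Hom mu la :=
    { toFun := fun f => castHom (H := (webCat k).Hom) (squash_map mu) (squash_map la) f
      map_add' := by
        have : ∀ {X Y X' Y' : Comp} (hX : X = X') (hY : Y = Y') (f f' : (webCat k).Hom X Y),
            castHom hX hY (f + f') = castHom hX hY f + castHom hX hY f' := by
          rintro X Y X' Y' rfl rfl f f'; rfl
        exact this _ _
      map_smul' := by
        have : ∀ {X Y X' Y' : Comp} (hX : X = X') (hY : Y = Y') (r : k) (f : (webCat k).Hom X Y),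
            castHom hX hY (r • f) = r • castHom hX hY f := by
          rintro X Y X' Y' rfl rfl r f; rfl
        exact this _ _ }
  refine ⟨fun A => g ((webModel k).normalForm (mu.map PNat.val) (rows A) (la.map PNat.val)), ?_⟩
  refine Submodule.eq_top_iff'.2 fun f => ?_
  have hU : [] ++ (mu ++ []) = squash (mu.map PNat.val) := by rw [squash_map]; simp
  have hV : [] ++ (la ++ []) = squash (la.map PNat.val) := by rw [squash_map]; simp
  have h1 : embed [] [] hU hV f ∈ (webModel k).normalSpan (mu.map PNat.val) (la.map PNat.val) := by
    induction f using WebHom.ind with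
    | h f => exact (stableWeb f [] [] hU hV (by simp) (by simp)).mem_normalSpan
  have h2 : g (embed [] [] hU hV f) = f := by
    refine (castHom_eq_iff (squash_map mu) (squash_map la) _ _).2
      ((modelArr_embed [] [] hU hV f).trans ?_)
    exact (one_mul _).trans (mul_one _)
  rw [normalSpan_eq] at h1
  have h3 := Submodule.mem_map_of_mem (f := g) h1
  rw [Submodule.map_span, ← Set.range_comp, h2] at h3
  exact h3

/-- The morphism spaces of the web category are no larger than those of the Schur category. -/
theorem finrank_le (k : Type u) [Field k] (la mu : Comp) :
    Module.Finite k ((webCat k).Hom mu la) ∧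
      Module.finrank k ((webCat k).Hom mu la) ≤ Fintype.card (Mat la mu) := by
  obtain ⟨b, hb⟩ := exists_span_eq_top (k := k) la mu
  refine ⟨⟨⟨(Set.finite_range b).toFinset, by simpa using hb⟩⟩, ?_⟩
  rw [← finrank_top, ← hb]
  exact finrank_range_le_card b

end WebHom

end SchurWeb

namespace SchurWeb

/-! ### Maps of strings in the Schur category -/

namespace SchurHom

variable {k : Type u} [CommRing k] {X Y Z X' Y' : Comp}

/-- The morphism `f` is the basis element of the matrix of the map `φ` from the strings of `X` to
those of `Y`, in which each string at the bottom goes as a whole to one string at the top. Strings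
are numbered from left to right; the values of `φ` beyond the length of `X` are irrelevant. -/
def IsFun (φ : ℕ → ℕ) (f : SchurHom k X Y) : Prop :=
  ∃ A : Mat Y X, (∀ y x, A.val y x = if φ x = y then (X.get x : ℕ) else 0) ∧ f = xi A

/-- The morphism `f` is the basis element of the transposed matrix of the map `φ` from the strings
of `Y` to those of `X`: each string at the top comes as a whole from one string at the bottom. -/
def IsCofun (φ : ℕ → ℕ) (f : SchurHom k X Y) : Prop :=
  ∃ A : Mat Y X, (∀ y x, A.val y x = if φ y = x then (Y.get y : ℕ) else 0) ∧ f = xi A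

/-- The string `x` occurs in the tuple `j` as often as its thickness in `X` says. -/
def HasContent {R : Type} (X : Comp) (j : R → Fin X.length) : Prop :=
  ∀ x, Nat.card {r // j r = x} = (X.get x : ℕ)

theorem exists_fun_eq {A : Mat Y X} {φ : ℕ → ℕ}
    (hA : ∀ y x, A.val y x = if φ x = y then (X.get x : ℕ) else 0) (x : Fin X.length) :
    ∃ y : Fin Y.length, φ x = y := by
  by_contra! h
  have := A.col_sum x
  rw [Finset.sum_eq_zero fun y _ => by rw [hA, if_neg (h y)]] at this
  exact (X.get x).pos.ne this

theorem exists_cofun_eq {A : Mat Y X} {φ : ℕ → ℕ}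
    (hA : ∀ y x, A.val y x = if φ y = x then (Y.get y : ℕ) else 0) (y : Fin Y.length) :
    ∃ x : Fin X.length, φ y = x := by
  by_contra! h
  have := A.row_sum y
  rw [Finset.sum_eq_zero fun x _ => by rw [hA, if_neg (h x)]] at this
  exact (Y.get y).pos.ne this

/-- The pairs of tuples of the type of the matrix of a map: the map takes one tuple to the other. -/
theorem inOrbit_fun {R : Type} [Finite R] {A : Mat Y X} {φ : ℕ → ℕ}
    (hA : ∀ y x, A.val y x = if φ x = y then (X.get x : ℕ) else 0)
    (i : R → Fin Y.length) (j : R → Fin X.length) :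
    InOrbit A.val i j ↔ (∀ r, φ (j r) = i r) ∧ HasContent X j := by
  constructor
  · intro h
    refine ⟨fun r => ?_, fun x => by rw [h.card_right, A.col_sum]⟩
    by_contra hne
    exact h.ne_zero r (by rw [hA, if_neg hne])
  · rintro ⟨h1, h2⟩ y x
    rw [hA]
    split_ifs with h
    · rw [← h2 x]
      refine Nat.card_congr (Equiv.subtypeEquivRight fun r => ⟨fun hr => hr.2, fun hr => ⟨?_, hr⟩⟩)
      rw [← hr] at h
      exact Fin.ext ((h1 r).symm.trans h)
    · have : IsEmpty {r // i r = y ∧ j r = x} :=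
        ⟨fun ⟨r, h3, h4⟩ => h (by rw [← h3, ← h4, h1])⟩
      exact Nat.card_of_isEmpty

theorem inOrbit_cofun {R : Type} [Finite R] {A : Mat Y X} {φ : ℕ → ℕ}
    (hA : ∀ y x, A.val y x = if φ y = x then (Y.get y : ℕ) else 0)
    (i : R → Fin Y.length) (j : R → Fin X.length) :
    InOrbit A.val i j ↔ (∀ r, φ (i r) = j r) ∧ HasContent Y i := by
  constructor
  · intro h
    refine ⟨fun r => ?_, fun x => by rw [h.card_left, A.row_sum]⟩
    by_contra hne
    exact h.ne_zero r (by rw [hA, if_neg hne])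
  · rintro ⟨h1, h2⟩ y x
    rw [hA]
    split_ifs with h
    · rw [← h2 y]
      refine Nat.card_congr (Equiv.subtypeEquivRight fun r => ⟨fun hr => hr.1, fun hr => ⟨hr, ?_⟩⟩)
      rw [← hr] at h
      exact Fin.ext ((h1 r).symm.trans h)
    · have : IsEmpty {r // i r = y ∧ j r = x} :=
        ⟨fun ⟨r, h3, h4⟩ => h (by rw [← h3, ← h4, h1])⟩
      exact Nat.card_of_isEmpty

theorem IsFun.congr {φ χ : ℕ → ℕ} {f : SchurHom k X Y} (hf : IsFun φ f)
    (h : ∀ x < X.length, φ x = χ x) : IsFun χ f := by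
  obtain ⟨A, hA, rfl⟩ := hf
  exact ⟨A, fun y x => by rw [hA, h x x.2], rfl⟩

theorem IsCofun.congr {φ χ : ℕ → ℕ} {f : SchurHom k X Y} (hf : IsCofun φ f)
    (h : ∀ y < Y.length, φ y = χ y) : IsCofun χ f := by
  obtain ⟨A, hA, rfl⟩ := hf
  exact ⟨A, fun y x => by rw [hA, h y y.2], rfl⟩

theorem IsFun.eq {φ : ℕ → ℕ} {f g : SchurHom k X Y} (hf : IsFun φ f) (hg : IsFun φ g) : f = g := by
  obtain ⟨A, hA, rfl⟩ := hf
  obtain ⟨B, hB, rfl⟩ := hg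
  exact congrArg xi (Mat.ext fun y x => by rw [hA, hB])

theorem IsCofun.eq {φ : ℕ → ℕ} {f g : SchurHom k X Y} (hf : IsCofun φ f) (hg : IsCofun φ g) :
    f = g := by
  obtain ⟨A, hA, rfl⟩ := hf
  obtain ⟨B, hB, rfl⟩ := hg
  exact congrArg xi (Mat.ext fun y x => by rw [hA, hB])

theorem IsFun.castHom {φ : ℕ → ℕ} {f : SchurHom k X Y} (hf : IsFun φ f) (hX : X = X')
    (hY : Y = Y') : IsFun φ (castHom (H := SchurHom k) hX hY f) := by
  subst hX hY
  exact hf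

theorem isFun_id (X : Comp) : IsFun _root_.id (id X : SchurHom k X X) := by
  refine ⟨_, fun y x => ?_, rfl⟩
  simp only [Mat.diag, Matrix.diagonal_apply, _root_.id, Fin.val_inj]
  by_cases h : y = x
  · subst h; simp
  · rw [if_neg h, if_neg (Ne.symm h)]

theorem isCofun_id (X : Comp) : IsCofun _root_.id (id X : SchurHom k X X) := by
  refine ⟨_, fun y x => ?_, rfl⟩
  simp only [Mat.diag, Matrix.diagonal_apply, _root_.id, Fin.val_inj]

theorem isFun_xi_singleton {n : ℕ+} (A : Mat [n] X) :
    IsFun (fun _ => 0) (xi A : SchurHom k X [n]) := by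
  refine ⟨A, fun y x => ?_, rfl⟩
  change Fin 1 at y
  obtain rfl : y = 0 := Subsingleton.elim _ _
  refine Eq.trans ?_ (if_pos rfl).symm
  rw [← A.col_sum x]
  exact (Fin.sum_univ_one fun i : Fin 1 => A.val i x).symm

theorem isCofun_xi_singleton {n : ℕ+} (A : Mat X [n]) :
    IsCofun (fun _ => 0) (xi A : SchurHom k [n] X) := by
  refine ⟨A, fun y x => ?_, rfl⟩
  change Fin 1 at x
  obtain rfl : x = 0 := Subsingleton.elim _ _
  refine Eq.trans ?_ (if_pos rfl).symm
  rw [← A.row_sum y]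
  exact (Fin.sum_univ_one fun i : Fin 1 => A.val y i).symm

theorem IsFun.comp {φ χ : ℕ → ℕ} {f : SchurHom k X Y} {g : SchurHom k Y Z} (hf : IsFun φ f)
    (hg : IsFun χ g) : IsFun (χ ∘ φ) (comp f g) := by
  classical
  obtain ⟨A, hA, rfl⟩ := hf
  obtain ⟨B, hB, rfl⟩ := hg
  choose p hp using exists_fun_eq hA
  choose q hq using exists_fun_eq hB
  let C : Mat Z X :=
    { val := fun z x => if χ (φ x) = z then (X.get x : ℕ) else 0
      row_sum := fun z => by
        rw [← B.row_sum z]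
        simp only [hB, ← A.row_sum, hA, hp, hq, Fin.val_inj]
        simp only [Finset.ite_sum_zero]
        rw [Finset.sum_comm]
        refine Finset.sum_congr rfl fun x _ => ?_
        rw [Finset.sum_eq_single (p x)]
        · simp
        · intro y _ hy; simp [hy.symm]
        · simp
      col_sum := fun x => by
        simp only [hp, hq, Fin.val_inj]
        simp }
  refine ⟨C, fun y x => rfl, ext_ev fun i j => ?_⟩
  rw [ev_comp, ev_xi, if_congr (inOrbit_fun (A := C) (φ := χ ∘ φ) (fun y x => rfl) i j) rfl rfl,
    Finset.sum_eq_single fun r => p (j r)]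
  · rw [ev_xi, ev_xi, if_congr (inOrbit_fun hA _ j) rfl rfl]
    by_cases hj : HasContent X j
    · have h1 : (∀ r, φ (j r) = p (j r)) ∧ HasContent X j := ⟨fun r => hp _, hj⟩
      have h2 := (inOrbit_fun hA _ _).2 h1
      have h3 : HasContent Y fun r => p (j r) := fun x => by rw [h2.card_left, A.row_sum]
      rw [if_pos h1, if_congr (inOrbit_fun hB i _) rfl rfl, mul_one]
      refine if_congr ?_ rfl rfl
      simp only [h3, hj, Function.comp, hp]
    · rw [if_neg fun h => hj (And.right h), if_neg fun h => hj (And.right h), mul_zero]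
  · intro y _ hy
    rw [ev_xi (A := A), if_neg, mul_zero]
    rw [inOrbit_fun hA]
    exact fun h => hy (funext fun r => Fin.ext ((h.1 r).symm.trans (hp _)))
  · simp

theorem IsCofun.comp {φ χ : ℕ → ℕ} {f : SchurHom k X Y} {g : SchurHom k Y Z} (hf : IsCofun φ f)
    (hg : IsCofun χ g) : IsCofun (φ ∘ χ) (comp f g) := by
  classical
  obtain ⟨A, hA, rfl⟩ := hf
  obtain ⟨B, hB, rfl⟩ := hg
  choose p hp using exists_cofun_eq hA
  choose q hq using exists_cofun_eq hB
  let C : Mat Z X :=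
    { val := fun z x => if φ (χ z) = x then (Z.get z : ℕ) else 0
      col_sum := fun x => by
        rw [← A.col_sum x]
        simp only [hA, ← B.col_sum, hB, hp, hq, Fin.val_inj]
        simp only [Finset.ite_sum_zero]
        rw [Finset.sum_comm]
        refine Finset.sum_congr rfl fun z _ => ?_
        rw [Finset.sum_eq_single (q z)]
        · simp
        · intro y _ hy; simp [hy.symm]
        · simp
      row_sum := fun z => by
        simp only [hp, hq, Fin.val_inj]
        simp }
  refine ⟨C, fun y x => rfl, ext_ev fun i j => ?_⟩
  rw [ev_comp, ev_xi, if_congr (inOrbit_cofun (A := C) (φ := φ ∘ χ) (fun y x => rfl) i j) rfl rfl,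
    Finset.sum_eq_single fun r => q (i r)]
  · rw [ev_xi, ev_xi, if_congr (inOrbit_cofun hB i _) rfl rfl]
    by_cases hi : HasContent Z i
    · have h1 : (∀ r, χ (i r) = q (i r)) ∧ HasContent Z i := ⟨fun r => hq _, hi⟩
      have h2 := (inOrbit_cofun hB _ _).2 h1
      have h3 : HasContent Y fun r => q (i r) := fun x => by rw [h2.card_right, B.col_sum]
      rw [if_pos h1, if_congr (inOrbit_cofun hA _ j) rfl rfl, one_mul]
      refine if_congr ?_ rfl rfl
      simp only [h3, hi, Function.comp, hq]
    · rw [if_neg fun h => hi (And.right h), if_neg fun h => hi (And.right h), zero_mul]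
  · intro y _ hy
    rw [ev_xi (A := B), if_neg, zero_mul]
    rw [inOrbit_cofun hB]
    exact fun h => hy (funext fun r => Fin.ext ((h.1 r).symm.trans (hq _)))
  · simp

/-- Splitting strings and then sending the parts to the strings at the top gives a single basis
element, provided that no two parts have the same source and the same target: in Schur's product
rule the tuple in the middle is then determined by the outer two. -/
theorem IsCofun.comp_isFun {φ χ : ℕ → ℕ} {f : SchurHom k X Y} {g : SchurHom k Y Z}
    (hf : IsCofun φ f) (hg : IsFun χ g)
    (hinj : ∀ y < Y.length, ∀ y' < Y.length, φ y = φ y' → χ y = χ y' → y = y') :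
    ∃ C : Mat Z X, (∀ z x, C.val z x = ∑ y : Fin Y.length,
      if χ y = z ∧ φ y = x then (Y.get y : ℕ) else 0) ∧ SchurHom.comp f g = xi C := by
  classical
  obtain ⟨A, hA, rfl⟩ := hf
  obtain ⟨B, hB, rfl⟩ := hg
  choose p hp using exists_cofun_eq hA
  choose q hq using exists_fun_eq hB
  let C : Mat Z X :=
    { val := fun z x => ∑ y : Fin Y.length, if χ y = z ∧ φ y = x then (Y.get y : ℕ) else 0
      row_sum := fun z => by
        rw [Finset.sum_comm, ← B.row_sum z]
        refine Finset.sum_congr rfl fun y _ => ?_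
        simp only [hB, hp, hq, Fin.val_inj, ite_and]
        split_ifs <;> simp
      col_sum := fun x => by
        rw [Finset.sum_comm, ← A.col_sum x]
        refine Finset.sum_congr rfl fun y _ => ?_
        simp only [hA, hp, hq, Fin.val_inj, ite_and]
        simp }
  have hC : ∀ z x, C.val z x =
      ∑ y : Fin Y.length, if χ y = z ∧ φ y = x then (Y.get y : ℕ) else 0 := fun _ _ => rfl
  refine ⟨C, hC, ext_ev fun i l => ?_⟩
  have key : ∀ j : Fin (size Z) → Fin Y.length, InOrbit B.val i j ∧ InOrbit A.val j l ↔
      InOrbit C.val i l ∧ ∀ r, χ (j r) = i r ∧ φ (j r) = l r := by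
    intro j
    rw [inOrbit_fun hB, inOrbit_cofun hA]
    constructor
    · rintro ⟨⟨h1, h2⟩, h3, -⟩
      refine ⟨fun z x => ?_, fun r => ⟨h1 r, h3 r⟩⟩
      rw [hC]
      calc Nat.card {r // i r = z ∧ l r = x}
          = Nat.card (Σ y : Fin Y.length, {r // j r = y ∧ (χ y = z ∧ φ y = x)}) := by
            refine Nat.card_congr
              { toFun := fun r => ⟨j r.1, r.1, rfl, by rw [h1, r.2.1], by rw [h3, r.2.2]⟩
                invFun := fun s => ⟨s.2.1, ?_, ?_⟩
                left_inv := fun r => rfl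
                right_inv := ?_ }
            · exact Fin.ext (by rw [← h1, s.2.2.1, s.2.2.2.1])
            · exact Fin.ext (by rw [← h3, s.2.2.1, s.2.2.2.2])
            · rintro ⟨y, r, rfl, h4⟩; rfl
        _ = _ := by
            rw [Nat.card_sigma]
            refine Finset.sum_congr rfl fun y _ => ?_
            split_ifs with h
            · simp only [h, and_self, and_true]
              exact h2 y
            · simp [h]
    · rintro ⟨h1, h2⟩
      have hY : HasContent Y j := by
        intro y
        have h3 := h1 (q y) (p y)
        rw [hC, Finset.sum_eq_single y, if_pos ⟨hq y, hp y⟩] at h3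
        · rw [← h3]
          refine Nat.card_congr (Equiv.subtypeEquivRight fun r => ⟨?_, fun h => ?_⟩)
          · rintro rfl
            exact ⟨Fin.ext ((h2 r).1.symm.trans (hq _)), Fin.ext ((h2 r).2.symm.trans (hp _))⟩
          · refine Fin.ext (hinj _ (j r).2 _ y.2 ?_ ?_)
            · rw [(h2 r).2, hp, h.2]
            · rw [(h2 r).1, hq, h.1]
        · intro y' _ hne
          refine if_neg fun h => hne (Fin.ext (hinj _ y'.2 _ y.2 ?_ ?_))
          · rw [h.2, hp]
          · rw [h.1, hq]
        · simp
      exact ⟨⟨fun r => (h2 r).1, hY⟩, fun r => (h2 r).2, hY⟩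
  rw [ev_comp, ev_xi]
  have h1 : ∀ j, ev (k := k) i j (xi B : SchurHom k Y Z) * ev j l (xi A) =
      if InOrbit B.val i j ∧ InOrbit A.val j l then 1 else 0 := by
    intro j
    rw [ev_xi, ev_xi]
    split_ifs <;> simp_all
  simp only [h1, key]
  split_ifs with h
  · have hex : ∀ r, ∃ y : Fin Y.length, χ y = i r ∧ φ y = l r := by
      intro r
      by_contra! hne
      refine h.ne_zero r ?_
      rw [hC]
      exact Finset.sum_eq_zero fun y _ => if_neg fun h => hne y h.1 h.2
    choose j hj using hex
    rw [Finset.sum_eq_single j, if_pos ⟨h, hj⟩]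
    · intro j' _ hne
      refine if_neg fun h' => hne (funext fun r => Fin.ext (hinj _ (j' r).2 _ (j r).2 ?_ ?_))
      · rw [(h'.2 r).2, (hj r).2]
      · rw [(h'.2 r).1, (hj r).1]
    · simp
  · exact Finset.sum_eq_zero fun j _ => if_neg fun h' => h h'.1

/-- The juxtaposition of a map of `m` strings to `n` strings and a second map of strings. -/
def sumMap (m n : ℕ) (φ χ : ℕ → ℕ) (x : ℕ) : ℕ := if x < m then φ x else n + χ (x - m)

theorem IsFun.tensor {φ χ : ℕ → ℕ} {f : SchurHom k X Y} {g : SchurHom k X' Y'} (hf : IsFun φ f)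
    (hg : IsFun χ g) : IsFun (sumMap X.length Y.length φ χ) (tensor f g) := by
  obtain ⟨A, hA, rfl⟩ := hf
  obtain ⟨B, hB, rfl⟩ := hg
  refine ⟨A.blockDiag B, fun y x => ?_, tensor_xi A B⟩
  obtain ⟨y, rfl⟩ := (Mat.appendIdx Y Y').surjective y
  obtain ⟨x, rfl⟩ := (Mat.appendIdx X X').surjective x
  rw [Mat.blockDiag_apply]
  rcases x with x | x <;> rcases y with y | y
  · rw [Mat.get_appendIdx_inl, Mat.appendIdx_inl_val, Mat.appendIdx_inl_val, sumMap, if_pos x.2]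
    exact hA y x
  · rw [Mat.get_appendIdx_inl, Mat.appendIdx_inl_val, Mat.appendIdx_inr_val, sumMap, if_pos x.2,
      if_neg]
    · rfl
    · obtain ⟨y', h⟩ := exists_fun_eq hA x
      omega
  · rw [Mat.get_appendIdx_inr, Mat.appendIdx_inl_val, Mat.appendIdx_inr_val, sumMap,
      if_neg (Nat.not_lt.2 (Nat.le_add_right _ _)), if_neg]
    · rfl
    · omega
  · rw [Mat.get_appendIdx_inr, Mat.appendIdx_inr_val, Mat.appendIdx_inr_val, sumMap,
      if_neg (Nat.not_lt.2 (Nat.le_add_right _ _)), Nat.add_sub_cancel_left]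
    refine (hB y x).trans (if_congr ?_ rfl rfl)
    omega

theorem IsCofun.tensor {φ χ : ℕ → ℕ} {f : SchurHom k X Y} {g : SchurHom k X' Y'}
    (hf : IsCofun φ f) (hg : IsCofun χ g) :
    IsCofun (sumMap Y.length X.length φ χ) (tensor f g) := by
  obtain ⟨A, hA, rfl⟩ := hf
  obtain ⟨B, hB, rfl⟩ := hg
  refine ⟨A.blockDiag B, fun y x => ?_, tensor_xi A B⟩
  obtain ⟨y, rfl⟩ := (Mat.appendIdx Y Y').surjective y
  obtain ⟨x, rfl⟩ := (Mat.appendIdx X X').surjective x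
  rw [Mat.blockDiag_apply]
  rcases y with y | y <;> rcases x with x | x
  · rw [Mat.get_appendIdx_inl, Mat.appendIdx_inl_val, Mat.appendIdx_inl_val, sumMap, if_pos y.2]
    exact hA y x
  · rw [Mat.get_appendIdx_inl, Mat.appendIdx_inl_val, Mat.appendIdx_inr_val, sumMap, if_pos y.2,
      if_neg]
    · rfl
    · obtain ⟨x', h⟩ := exists_cofun_eq hA y
      omega
  · rw [Mat.get_appendIdx_inr, Mat.appendIdx_inl_val, Mat.appendIdx_inr_val, sumMap,
      if_neg (Nat.not_lt.2 (Nat.le_add_right _ _)), if_neg]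
    · rfl
    · omega
  · rw [Mat.get_appendIdx_inr, Mat.appendIdx_inr_val, Mat.appendIdx_inr_val, sumMap,
      if_neg (Nat.not_lt.2 (Nat.le_add_right _ _)), Nat.add_sub_cancel_left]
    refine (hB y x).trans (if_congr ?_ rfl rfl)
    omega

end SchurHom

end SchurWeb

namespace SchurWeb

/-! ### Evaluation of webs in the Schur category -/

open SchurHom

namespace Term

variable {k : Type u} [CommRing k]

/-- The value in the Schur category of an expression in merges, splits and crossings. -/
noncomputable def eval : {X Y : Comp} → Term k X Y → SchurHom k X Y
  | _, _, id X => SchurHom.id X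
  | _, _, comp f g => SchurHom.comp f.eval g.eval
  | _, _, tensor f f' => SchurHom.tensor f.eval f'.eval
  | _, _, zero => 0
  | _, _, add f g => f.eval + g.eval
  | _, _, smul r f => r • f.eval
  | _, _, merge a b => SchurHom.xi (mergeMat a b)
  | _, _, split a b => SchurHom.xi (splitMat a b)
  | _, _, cross a b => SchurHom.xi (crossMat a b)

theorem eval_castHom {X X' Y Y' : Comp} (hX : X = X') (hY : Y = Y') (f : Term k X Y) :
    (castHom hX hY f : Term k X' Y').eval = castHom (H := SchurHom k) hX hY f.eval := by
  subst hX hY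
  rfl

theorem eval_sum {X Y : Comp} (l : List (Term k X Y)) : (sum l).eval = (l.map eval).sum := by
  induction l with
  | nil => rfl
  | cons f l ih => rw [List.map_cons, List.sum_cons, ← ih]; rfl

/-- The value of the expression is the matrix of the map `φ` from its bottom to its top strings. -/
abbrev IsFun {X Y : Comp} (φ : ℕ → ℕ) (f : Term k X Y) : Prop := SchurHom.IsFun φ f.eval

/-- The value of the expression is the transposed matrix of the map `φ` from its top to its bottom
strings. -/
abbrev IsCofun {X Y : Comp} (φ : ℕ → ℕ) (f : Term k X Y) : Prop := SchurHom.IsCofun φ f.eval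

theorem isFun_castHom {φ : ℕ → ℕ} {X X' Y Y' : Comp} {f : Term k X Y} (hf : IsFun φ f)
    (hX : X = X') (hY : Y = Y') : IsFun φ (castHom hX hY f : Term k X' Y') := by
  subst hX hY
  exact hf

theorem isCofun_castHom {φ : ℕ → ℕ} {X X' Y Y' : Comp} {f : Term k X Y} (hf : IsCofun φ f)
    (hX : X = X') (hY : Y = Y') : IsCofun φ (castHom hX hY f : Term k X' Y') := by
  subst hX hY
  exact hf

theorem isFun_merge (a b : ℕ+) : IsFun (k := k) (fun _ => 0) (merge a b) := isFun_xi_singleton _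

theorem isCofun_split (a b : ℕ+) : IsCofun (k := k) (fun _ => 0) (split a b) :=
  isCofun_xi_singleton _

theorem isFun_id_singleton (a : ℕ+) : IsFun (k := k) (fun _ => 0) (id [a]) := isFun_xi_singleton _

theorem isCofun_id_singleton (a : ℕ+) : IsCofun (k := k) (fun _ => 0) (id [a]) :=
  isCofun_xi_singleton _

theorem isFun_cross (a b : ℕ+) : IsFun (k := k) (fun x => 1 - x) (cross a b) := by
  refine ⟨_, ?_, rfl⟩
  change ∀ y x : Fin 2, !![0, (b : ℕ); (a : ℕ), 0] y x =
    if 1 - (x : ℕ) = y then (([a, b] : Comp).get x : ℕ) else 0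
  intro y x
  fin_cases y <;> fin_cases x <;> simp

theorem isFun_mergeZ (s t : ℕ) (x : ℕ+) (h : s + t = (x : ℕ)) :
    IsFun (k := k) (fun _ => 0) (mergeZ s t x h) := by
  rcases s with _ | s <;> rcases t with _ | t
  · exact absurd h (Nat.ne_of_lt x.pos)
  · rw [mergeZ]; exact isFun_castHom (isFun_id_singleton _) _ _
  · rw [mergeZ]; exact isFun_castHom (isFun_id_singleton _) _ _
  · rw [mergeZ]; exact isFun_castHom (isFun_merge _ _) _ _

theorem isCofun_splitZ (s t : ℕ) (x : ℕ+) (h : s + t = (x : ℕ)) :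
    IsCofun (k := k) (fun _ => 0) (splitZ s t x h) := by
  rcases s with _ | s <;> rcases t with _ | t
  · exact absurd h (Nat.ne_of_lt x.pos)
  · rw [splitZ]; exact isCofun_castHom (isCofun_id_singleton _) _ _
  · rw [splitZ]; exact isCofun_castHom (isCofun_id_singleton _) _ _
  · rw [splitZ]; exact isCofun_castHom (isCofun_split _ _) _ _

/-- The map of strings that interchanges a block of `m` and a block of `n` strings. -/
def blockSwap (m n x : ℕ) : ℕ := if x < m then n + x else x - m

theorem isFun_crossZ : ∀ s t : ℕ,
    IsFun (k := k) (blockSwap (strand s).length (strand t).length) (crossZ s t)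
  | 0, 0 => (isFun_id _).congr fun x hx => absurd hx (Nat.not_lt_zero x)
  | 0, t + 1 => (isFun_id _).congr fun x _ => by simp [blockSwap, strand]
  | s + 1, 0 => (isFun_id _).congr fun x (hx : x < 1) => by
      simp [blockSwap, strand, hx]
  | s + 1, t + 1 => (isFun_cross _ _).congr fun x (hx : x < 2) => by
      change 1 - x = if x < 1 then 1 + x else x - 1
      split_ifs <;> omega

theorem length_strand_le : ∀ s, (strand s).length ≤ 1
  | 0 => Nat.zero_le _
  | _ + 1 => le_rfl

theorem size_strand : ∀ s, size (strand s) = s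
  | 0 => rfl
  | _ + 1 => rfl

/-- The value of a ladder is a basis element: a ladder splits its strings and then sends the parts
injectively to the top. Its upper left entry is the thickness of the left vertical string. -/
theorem eval_ladder (a b c d : ℕ+) (s u v t : ℕ) (ha : s + u = (a : ℕ)) (hc : v + t = (c : ℕ))
    (hb : s + v = (b : ℕ)) (hd : u + t = (d : ℕ)) :
    ∃ C : Mat [b, d] [a, c], C.val (0 : Fin 2) (0 : Fin 2) = s ∧
      (ladder (k := k) a b c d s u v t ha hc hb hd).eval = SchurHom.xi C := by
  have h1 := (isCofun_splitZ (k := k) s u a ha).tensor (isCofun_splitZ v t c hc)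
  have h2 := ((isFun_id (k := k) (strand s)).tensor
    ((isFun_crossZ u v).tensor (isFun_id (strand t)))).castHom
    (X' := (strand s ++ strand u) ++ (strand v ++ strand t))
    (Y' := (strand s ++ strand v) ++ (strand u ++ strand t)) (by simp) (by simp)
  have h3 := (isFun_mergeZ (k := k) s v b hb).tensor (isFun_mergeZ u t d hd)
  have ls := length_strand_le s
  have lu := length_strand_le u
  have lv := length_strand_le v
  have lt := length_strand_le t
  obtain ⟨C, hC, h4⟩ := h1.comp_isFun (h2.comp h3) (by
    simp only [List.length_append, Function.comp, sumMap, blockSwap, _root_.id,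
      List.length_singleton]
    intro y hy y' hy'
    split_ifs <;> omega)
  refine ⟨C, ?_, ?_⟩
  · refine (hC (0 : Fin 2) (0 : Fin 2)).trans ?_
    rw [← (Mat.appendIdx (strand s ++ strand u) (strand v ++ strand t)).sum_comp,
      Fintype.sum_sum_type, ← (Mat.appendIdx (strand s) (strand u)).sum_comp,
      Fintype.sum_sum_type]
    simp only [Mat.get_appendIdx_inl, Mat.get_appendIdx_inr, Mat.appendIdx_inl_val,
      Mat.appendIdx_inr_val]
    rw [Finset.sum_congr rfl (g := fun x => ((strand s).get x : ℕ)), sum_get, size_strand,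
      Finset.sum_eq_zero, Finset.sum_eq_zero]
    · rfl
    · intro x _
      refine if_neg ?_
      simp only [List.length_append, Function.comp, sumMap, blockSwap, _root_.id,
        List.length_singleton, Fin.val_zero]
      split_ifs <;> omega
    · intro x _
      refine if_neg ?_
      have := x.2
      simp only [List.length_append, Function.comp, sumMap, blockSwap, _root_.id,
        List.length_singleton, Fin.val_zero]
      split_ifs <;> omega
    · intro x _
      refine if_pos ?_
      have := x.2
      simp only [List.length_append, Function.comp, sumMap, blockSwap, _root_.id,
        List.length_singleton, Fin.val_zero]
      split_ifs <;> omega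
  · rw [ladder, eval, eval, eval_castHom]
    exact h4

/-- In Schur's product rule for the digon the outer tuples are constant, and the tuples in the
middle are the choices of `a` out of `a + b` places. -/
theorem eval_digon (a b : ℕ+) : (comp (split (k := k) a b) (merge a b)).eval =
    (Nat.choose ((a : ℕ) + b) a : k) • SchurHom.id [a + b] := by
  classical
  refine ext_ev fun i l => ?_
  obtain ⟨A, hA, hA'⟩ := isCofun_split (k := k) a b
  obtain ⟨B, hB, hB'⟩ := isFun_merge (k := k) a b
  have hi : i = fun _ => (0 : Fin 1) := funext fun r => Subsingleton.elim (α := Fin 1) _ _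
  have hl : l = fun _ => (0 : Fin 1) := funext fun r => Subsingleton.elim (α := Fin 1) _ _
  have hcard : ∀ (n m : ℕ), (∑ j : Fin n → Fin 2,
      if Nat.card {r // j r = 0} = m then (1 : k) else 0) = (n.choose m : k) := by
    intro n m
    rw [← Finset.sum_filter, Finset.sum_const, nsmul_eq_mul, mul_one]
    congr 1
    conv_rhs => rw [← Finset.card_fin n, ← Finset.card_powersetCard]
    refine Finset.card_nbij' (fun j => Finset.univ.filter fun r => j r = 0)
      (fun s r => if r ∈ s then 0 else 1) ?_ ?_ ?_ ?_
    · intro j hj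
      rw [Finset.mem_coe, Finset.mem_filter] at hj
      rw [Finset.mem_coe, Finset.mem_powersetCard]
      refine ⟨Finset.subset_univ _, ?_⟩
      rw [← hj.2, Nat.card_eq_fintype_card, Fintype.card_subtype]
    · intro s hs
      rw [Finset.mem_coe, Finset.mem_powersetCard] at hs
      rw [Finset.mem_coe, Finset.mem_filter]
      refine ⟨Finset.mem_univ _, ?_⟩
      rw [← hs.2, Nat.card_eq_fintype_card, Fintype.card_subtype]
      congr 1
      ext r
      simp
    · intro j _
      funext r
      have : j r = 0 ∨ j r = 1 := by omega
      rcases this with h | h <;> simp [h]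
    · intro s _
      ext r
      simp
  have hcontent : ∀ j : Fin (size [a + b]) → Fin 2,
      HasContent [a, b] j ↔ Nat.card {r // j r = 0} = a := by
    intro j
    refine ⟨fun h => h (0 : Fin 2), fun h => ?_⟩
    have h2 : Nat.card {r // j r = 0} + Nat.card {r // j r = 1} = a + b := by
      have h3 : Nat.card (Fin (size [a + b])) = a + b := by simp [size]
      rw [← h3, ← Nat.card_sum, Nat.card_congr (Equiv.sumCompl fun r => j r = 0).symm]
      refine Nat.card_congr (Equiv.sumCongr (Equiv.refl _) (Equiv.subtypeEquivRight fun r => ?_))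
      omega
    change ∀ x : Fin 2, Nat.card {r // j r = x} = (([a, b] : Comp).get x : ℕ)
    intro x
    fin_cases x
    · exact h
    · simp only [Fin.mk_one]
      change Nat.card {r // j r = 1} = (b : ℕ)
      omega
  have h1 : ∀ j : Fin (size [a + b]) → Fin ([a, b] : Comp).length,
      (ev (k := k) i j (SchurHom.xi B) * ev (k := k) j l (SchurHom.xi A) : k) =
        if Nat.card {r // j r = (0 : Fin 2)} = a then 1 else 0 := by
    intro j
    rw [ev_xi, ev_xi, if_congr (inOrbit_fun (φ := fun _ => 0) hB i j) rfl rfl,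
      if_congr (inOrbit_cofun (φ := fun _ => 0) hA j l) rfl rfl, ← if_congr (hcontent j) rfl rfl]
    have h2 : ∀ r, 0 = (i r).val := fun r => by rw [hi]; rfl
    have h3 : ∀ r, 0 = (l r).val := fun r => by rw [hl]; rfl
    by_cases hj : HasContent [a, b] j
    · rw [if_pos hj, if_pos ⟨h2, hj⟩, if_pos ⟨h3, hj⟩, mul_one]
    · rw [if_neg hj, if_neg fun h => hj (And.right h), zero_mul]
  have h2 : ev (k := k) i l (SchurHom.id [a + b]) = 1 := by
    rw [SchurHom.id, ev_xi, hi, hl, if_pos]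
    refine inOrbit_diag ?_
    change ∀ x : Fin 1, Nat.card {r : Fin (size [a + b]) // (0 : Fin 1) = x} =
      (([a + b] : Comp).get x : ℕ)
    intro x
    fin_cases x
    simp [size]
  rw [eval, hA', hB', ev_comp, map_smul, h2, smul_eq_mul, mul_one, ← hcard]
  refine (Finset.sum_congr rfl fun j _ => h1 j).trans ?_
  have h3 : size [a + b] = a + b := by simp [size]
  rw [h3]
  rfl

/-- A two by two matrix with given row and column sums is determined by its upper left entry. -/
theorem mat_two_ext {a b c d : ℕ+} {A B : Mat [b, d] [a, c]}
    (h : A.val (0 : Fin 2) (0 : Fin 2) = B.val (0 : Fin 2) (0 : Fin 2)) : A = B := by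
  have h1 : ∀ A : Mat [b, d] [a, c],
      A.val (0 : Fin 2) (0 : Fin 2) + A.val (0 : Fin 2) (1 : Fin 2) = b := fun A =>
    (Fin.sum_univ_two fun j : Fin 2 => A.val (0 : Fin 2) j).symm.trans (A.row_sum (0 : Fin 2))
  have h2 : ∀ A : Mat [b, d] [a, c],
      A.val (0 : Fin 2) (0 : Fin 2) + A.val (1 : Fin 2) (0 : Fin 2) = a := fun A =>
    (Fin.sum_univ_two fun i : Fin 2 => A.val i (0 : Fin 2)).symm.trans (A.col_sum (0 : Fin 2))
  have h3 : ∀ A : Mat [b, d] [a, c],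
      A.val (1 : Fin 2) (0 : Fin 2) + A.val (1 : Fin 2) (1 : Fin 2) = d := fun A =>
    (Fin.sum_univ_two fun j : Fin 2 => A.val (1 : Fin 2) j).symm.trans (A.row_sum (1 : Fin 2))
  have := h1 A
  have := h1 B
  have := h2 A
  have := h2 B
  have := h3 A
  have := h3 B
  refine Mat.ext ?_
  change ∀ i j : Fin 2, A.val i j = B.val i j
  intro i j
  fin_cases i <;> fin_cases j
  · exact h
  · change A.val (0 : Fin 2) (1 : Fin 2) = B.val (0 : Fin 2) (1 : Fin 2); omega
  · change A.val (1 : Fin 2) (0 : Fin 2) = B.val (1 : Fin 2) (0 : Fin 2); omega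
  · change A.val (1 : Fin 2) (1 : Fin 2) = B.val (1 : Fin 2) (1 : Fin 2); omega

theorem eval_ladderSum (a b c d : ℕ+) (h : a + c = b + d) :
    (ladderSum (k := k) a b c d h).eval =
      ∑ T ∈ Finset.range (min (a : ℕ) b + 1) ×ˢ Finset.range (min (c : ℕ) d + 1),
        (ladderST a b c d h T.1 T.2).eval := by
  rw [ladderSum, eval_sum, List.map_flatMap]
  simp only [List.map_map]
  exact sum_flatMap_range _ _ _

/-- Every two by two matrix with the right row and column sums occurs once on both sides: for merge
and split because the tuple in the middle is constant, for the sum because the ladders run through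
these matrices. -/
theorem eval_merge_split (a b c d : ℕ+) (h : a + c = b + d) :
    (comp (merge a c) (castHom (congrArg (fun x => [x]) h.symm) rfl (split b d))).eval =
      (ladderSum (k := k) a b c d h).eval := by
  classical
  refine Finsupp.ext fun A => ?_
  have hA1 : A.val (0 : Fin 2) (0 : Fin 2) + A.val (0 : Fin 2) (1 : Fin 2) = b :=
    (Fin.sum_univ_two fun j : Fin 2 => A.val (0 : Fin 2) j).symm.trans (A.row_sum (0 : Fin 2))
  have hA2 : A.val (0 : Fin 2) (0 : Fin 2) + A.val (1 : Fin 2) (0 : Fin 2) = a :=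
    (Fin.sum_univ_two fun i : Fin 2 => A.val i (0 : Fin 2)).symm.trans (A.col_sum (0 : Fin 2))
  have hA3 : A.val (1 : Fin 2) (0 : Fin 2) + A.val (1 : Fin 2) (1 : Fin 2) = d :=
    (Fin.sum_univ_two fun j : Fin 2 => A.val (1 : Fin 2) j).symm.trans (A.row_sum (1 : Fin 2))
  have hA4 : A.val (0 : Fin 2) (1 : Fin 2) + A.val (1 : Fin 2) (1 : Fin 2) = c :=
    (Fin.sum_univ_two fun i : Fin 2 => A.val i (1 : Fin 2)).symm.trans (A.col_sum (1 : Fin 2))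
  trans 1
  · obtain ⟨⟨i, l⟩, hil⟩ := A.exists_inOrbit
    obtain ⟨B, hB, hB'⟩ := isFun_merge (k := k) a c
    obtain ⟨C, hC, hC'⟩ := isCofun_castHom (isCofun_split (k := k) b d)
      (congrArg (fun x => [x]) h.symm) rfl
    let z : Fin (size [b, d]) → Fin ([a + c] : Comp).length := fun _ => (0 : Fin 1)
    rw [← ev_eq _ hil, eval, hB', hC', ev_comp, Finset.sum_eq_single z]
    · rw [ev_xi, ev_xi, if_pos, if_pos, mul_one]
      · exact (inOrbit_fun (φ := fun _ => 0) hB _ _).2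
          ⟨fun r => rfl, fun x => by rw [hil.card_right, A.col_sum]⟩
      · exact (inOrbit_cofun (φ := fun _ => 0) hC _ _).2
          ⟨fun r => rfl, fun x => by rw [hil.card_left, A.row_sum]⟩
    · intro j _ hj
      exact absurd (funext fun r => Subsingleton.elim (α := Fin 1) (j r) (z r)) hj
    · exact fun hz => absurd (Finset.mem_univ _) hz
  · rw [eval_ladderSum, Finsupp.finsetSum_apply]
    have h2 : ∀ s t, s ≤ min (a : ℕ) b ∧ t ≤ min (c : ℕ) d ∧ t + (a : ℕ) = s + (d : ℕ) →
        (ladderST (k := k) a b c d h s t).eval A =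
          if s = A.val (0 : Fin 2) (0 : Fin 2) then 1 else 0 := by
      intro s t hst
      rw [ladderST, dif_pos hst]
      obtain ⟨C, hC, hC'⟩ := eval_ladder (k := k) a b c d s (a - s) (c - t) t (by omega) (by omega)
        (by omega) (by omega)
      rw [hC', SchurHom.xi, Finsupp.single_apply]
      refine if_congr ⟨?_, fun hs => mat_two_ext (hC.trans hs)⟩ rfl rfl
      rintro rfl
      exact hC.symm
    rw [Finset.sum_eq_single (A.val (0 : Fin 2) (0 : Fin 2), A.val (1 : Fin 2) (1 : Fin 2))]
    · rw [h2 _ _ (by omega), if_pos rfl]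
    · rintro ⟨s, t⟩ - hne
      by_cases hst : s ≤ min (a : ℕ) b ∧ t ≤ min (c : ℕ) d ∧ t + (a : ℕ) = s + (d : ℕ)
      · rw [h2 _ _ hst, if_neg]
        intro hs
        replace hs : s = _ := hs
        exact hne (Prod.ext hs (by omega))
      · rw [ladderST, dif_neg hst]
        rfl
    · intro hnot
      refine absurd ?_ hnot
      simp only [Finset.mem_product, Finset.mem_range]
      omega

/-- The relations of the web category hold in the Schur category. -/
theorem eval_eq {X Y : Comp} {f g : Term k X Y} (h : Rel f g) : f.eval = g.eval := by
  induction h with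
  | refl f => rfl
  | symm _ h => exact h.symm
  | trans _ _ h h' => exact h.trans h'
  | comp_congr _ _ h h' => exact congrArg₂ SchurHom.comp h h'
  | tensor_congr _ _ h h' => exact congrArg₂ SchurHom.tensor h h'
  | add_congr _ _ h h' => exact congrArg₂ (· + ·) h h'
  | smul_congr r _ h => exact congrArg (r • ·) h
  | add_assoc f g h => exact _root_.add_assoc _ _ _
  | add_comm f g => exact _root_.add_comm _ _
  | zero_add f => exact _root_.zero_add _
  | one_smul f => exact _root_.one_smul k _
  | mul_smul r s f => exact SemigroupAction.mul_smul _ _ _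
  | smul_add r f g => exact _root_.smul_add _ _ _
  | add_smul r s f => exact _root_.add_smul _ _ _
  | zero_smul f => exact _root_.zero_smul k _
  | id_comp f => exact SchurHom.id_comp _
  | comp_id f => exact SchurHom.comp_id _
  | assoc f g h => exact SchurHom.comp_assoc _ _ _
  | add_comp f f' g => exact SchurHom.add_comp _ _ _
  | comp_add f g g' => exact SchurHom.comp_add _ _ _
  | smul_comp r f g => exact SchurHom.smul_comp _ _ _
  | comp_smul r f g => exact SchurHom.comp_smul _ _ _
  | id_tensor_id X Y => exact SchurHom.id_tensor_id _ _
  | interchange f g f' g' => exact SchurHom.interchange _ _ _ _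
  | tensor_assoc f f' f'' => exact (eval_castHom _ _ _).trans (SchurHom.tensor_assoc _ _ _)
  | unit_tensor f => exact SchurHom.unit_tensor _
  | tensor_unit f => exact (eval_castHom _ _ _).trans (SchurHom.tensor_unit _)
  | add_tensor f g f' => exact SchurHom.add_tensor _ _ _
  | tensor_add f f' g' => exact SchurHom.tensor_add _ _ _
  | smul_tensor r f f' => exact SchurHom.smul_tensor _ _ _
  | tensor_smul r f f' => exact SchurHom.tensor_smul _ _ _
  | merge_assoc a b c =>
    exact SchurHom.IsFun.eq (φ := fun _ => 0)
      (((isFun_merge a b).tensor (isFun_id_singleton c)).comp (isFun_merge _ c))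
      (isFun_castHom (f := comp (Y := [a, b + c]) (tensor (id [a]) (merge b c)) (merge a (b + c)))
        (((isFun_id_singleton a).tensor (isFun_merge b c)).comp (isFun_merge a _)) _ _)
  | split_assoc a b c =>
    exact SchurHom.IsCofun.eq (φ := fun _ => 0)
      ((isCofun_split _ c).comp ((isCofun_split a b).tensor (isCofun_id_singleton c)))
      (isCofun_castHom (f := comp (Y := [a, b + c]) (split a (b + c)) (tensor (id [a]) (split b c)))
        ((isCofun_split a _).comp ((isCofun_id_singleton a).tensor (isCofun_split b c))) _ _)
  | digon a b => exact eval_digon a b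
  | merge_split a b c d h => exact eval_merge_split a b c d h

end Term

end SchurWeb

namespace SchurWeb

/-! ### The value of a reduced chicken foot diagram -/

open SchurHom

section words

variable {α β : Type}

theorem length_swapAt : ∀ (p : ℕ) (l : List α), (swapAt p l).length = l.length
  | 0, [] => rfl
  | 0, [_] => rfl
  | 0, _ :: _ :: _ => rfl
  | _ + 1, [] => rfl
  | p + 1, _ :: l => congrArg (· + 1) (length_swapAt p l)

theorem length_applyWord : ∀ (w : List ℕ) (l : List α), (applyWord w l).length = l.length
  | [], _ => rfl
  | p :: w, l => (length_applyWord w _).trans (length_swapAt p l)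

theorem swapAt_map (f : α → β) : ∀ (p : ℕ) (l : List α), swapAt p (l.map f) = (swapAt p l).map f
  | 0, [] => rfl
  | 0, [_] => rfl
  | 0, _ :: _ :: _ => rfl
  | _ + 1, [] => rfl
  | p + 1, a :: l => congrArg (f a :: ·) (swapAt_map f p l)

theorem applyWord_map (f : α → β) : ∀ (w : List ℕ) (l : List α),
    applyWord w (l.map f) = (applyWord w l).map f
  | [], _ => rfl
  | p :: w, l => by rw [applyWord, swapAt_map, applyWord_map, applyWord]

theorem swapAt_swapAt : ∀ (p : ℕ) (l : List α), swapAt p (swapAt p l) = l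
  | 0, [] => rfl
  | 0, [_] => rfl
  | 0, _ :: _ :: _ => rfl
  | _ + 1, [] => rfl
  | p + 1, a :: l => congrArg (a :: ·) (swapAt_swapAt p l)

theorem applyWord_append : ∀ (w w' : List ℕ) (l : List α),
    applyWord (w ++ w') l = applyWord w' (applyWord w l)
  | [], _, _ => rfl
  | _ :: w, w', _ => applyWord_append w w' _

theorem applyWord_reverse_applyWord : ∀ (w : List ℕ) (l : List α),
    applyWord w.reverse (applyWord w l) = l
  | [], _ => rfl
  | p :: w, l => by
    rw [List.reverse_cons, applyWord_append]
    change swapAt p (applyWord w.reverse (applyWord w (swapAt p l))) = l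
    rw [applyWord_reverse_applyWord, swapAt_swapAt]

theorem swapAt_perm : ∀ (p : ℕ) (l : List α), (swapAt p l).Perm l
  | 0, [] => .refl _
  | 0, [_] => .refl _
  | 0, _ :: _ :: _ => .swap _ _ _
  | _ + 1, [] => .refl _
  | p + 1, a :: l => (swapAt_perm p l).cons a

theorem applyWord_perm : ∀ (w : List ℕ) (l : List α), (applyWord w l).Perm l
  | [], _ => .refl _
  | p :: w, l => (applyWord_perm w _).trans (swapAt_perm p l)

/-- The transposition of the positions `p` and `p + 1`. -/
def transp : ℕ → ℕ → ℕ
  | 0, 0 => 1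
  | 0, 1 => 0
  | 0, x + 2 => x + 2
  | _ + 1, 0 => 0
  | p + 1, x + 1 => transp p x + 1

theorem getD_swapAt (d : α) : ∀ (p : ℕ) (l : List α) (_ : p + 1 < l.length) (x : ℕ),
    (swapAt p l).getD x d = l.getD (transp p x) d
  | 0, [], h, _ => absurd h (by simp)
  | 0, [_], h, _ => absurd h (by simp)
  | 0, _ :: _ :: _, _, 0 => rfl
  | 0, _ :: _ :: _, _, 1 => rfl
  | 0, _ :: _ :: _, _, _ + 2 => rfl
  | _ + 1, [], h, _ => absurd h (by simp)
  | _ + 1, _ :: _, _, 0 => rfl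
  | p + 1, _ :: l, h, x + 1 => getD_swapAt d p l (by simpa using h) x

/-- The position to which a word moves an entry. -/
def position : List ℕ → ℕ → ℕ
  | [], x => x
  | p :: w, x => position w (transp p x)

/-- Applying the reversed word pulls the entries of a list back along `position`; this relates the
top vertex of a string to the position to which the crossings move it. -/
theorem getD_applyWord_reverse (d : α) : ∀ (w : List ℕ) (l : List α),
    (∀ p ∈ w, p + 1 < l.length) → ∀ x, (applyWord w.reverse l).getD x d = l.getD (position w x) d
  | [], _, _, _ => rfl
  | p :: w, l, h, x => by
    rw [List.reverse_cons, applyWord_append]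
    change (swapAt p (applyWord w.reverse l)).getD x d = _
    rw [getD_swapAt _ _ _ (by rw [length_applyWord]; exact h p (by simp)),
      getD_applyWord_reverse d w l fun q hq => h q (by simp [hq])]
    rfl

end words

namespace Block

theorem length_vertices : ∀ (n : ℕ) (B : List Block), (vertices n B).length = (flat B).length
  | _, [] => rfl
  | n, (a, l) :: B => by
    simp [vertices, flat, length_vertices (n + 1) B, Nat.add_right_comm]

theorem vertices_succ : ∀ (n : ℕ) (B : List Block), vertices (n + 1) B = (vertices n B).map (1 + ·)
  | _, [] => rfl
  | n, (a, l) :: B => by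
    rw [vertices, vertices, vertices_succ (n + 1) B, List.map_append, List.map_replicate,
      Nat.add_comm 1 n]

theorem getD_vertices_cons (a : ℕ+) (l : List ℕ+) (B : List Block) {x : ℕ}
    (hx : x < (flat ((a, l) :: B)).length) :
    (vertices 0 ((a, l) :: B)).getD x 0 =
      sumMap (l.length + 1) 1 (fun _ => 0) (fun x => (vertices 0 B).getD x 0) x := by
  rw [vertices, vertices_succ, sumMap]
  split_ifs with h
  · rw [List.getD_append _ _ _ _ (by simpa using h), List.getD_eq_getElem _ _ (by simpa using h),
      List.getElem_replicate]
  · have h2 : x - (l.length + 1) < (vertices 0 B).length := by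
      rw [length_vertices]
      simp only [flat, List.length_append, List.length_cons] at hx
      omega
    rw [List.getD_append_right _ _ _ _ (by simpa using h), List.length_replicate,
      List.getD_eq_getElem _ _ (by simpa using h2), List.getElem_map, List.getD_eq_getElem _ _ h2]

end Block

namespace Term

variable {k : Type u} [CommRing k]

theorem isFun_mergeFold : ∀ (a : ℕ+) (l : List ℕ+), IsFun (k := k) (fun _ => 0) (mergeFold a l)
  | a, [] => isFun_id_singleton a
  | a, b :: l => ((isFun_id_singleton a).tensor (isFun_mergeFold b l)).comp (isFun_merge _ _)

theorem isCofun_splitFold : ∀ (a : ℕ+) (l : List ℕ+),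
    IsCofun (k := k) (fun _ => 0) (splitFold a l)
  | a, [] => isCofun_id_singleton a
  | a, b :: l => (isCofun_split _ _).comp ((isCofun_id_singleton a).tensor (isCofun_splitFold b l))

theorem isFun_merges : ∀ B : List Block,
    IsFun (k := k) (fun x => (Block.vertices 0 B).getD x 0) (merges B)
  | [] => (isFun_id []).congr fun x hx => absurd hx (Nat.not_lt_zero x)
  | (a, l) :: B => ((isFun_mergeFold a l).tensor (isFun_merges B)).congr fun _ hx =>
      (Block.getD_vertices_cons a l B hx).symm

theorem isCofun_splits : ∀ B : List Block,
    IsCofun (k := k) (fun x => (Block.vertices 0 B).getD x 0) (splits B)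
  | [] => (isCofun_id []).congr fun x hx => absurd hx (Nat.not_lt_zero x)
  | (a, l) :: B => ((isCofun_splitFold a l).tensor (isCofun_splits B)).congr fun _ hx =>
      (Block.getD_vertices_cons a l B hx).symm

theorem isFun_crossAt : ∀ (p : ℕ) (X : Comp), p + 1 < X.length →
    IsFun (k := k) (transp p) (crossAt p X)
  | 0, [], h => absurd h (by simp)
  | 0, [_], h => absurd h (by simp)
  | _ + 1, [], h => absurd h (by simp)
  | 0, a :: b :: X, _ => ((isFun_cross a b).tensor (isFun_id X)).congr fun x _ => by
      change sumMap 2 2 _ _ x = _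
      rcases x with _ | _ | x
      · rfl
      · rfl
      · change (if x + 2 < 2 then _ else 2 + (x + 2 - 2)) = x + 2
        rw [if_neg (by omega)]
        omega
  | p + 1, a :: X, h =>
      ((isFun_id_singleton a).tensor (isFun_crossAt p X (by simpa using h))).congr fun x _ => by
        change sumMap 1 1 _ _ x = _
        rcases x with _ | x
        · rfl
        · simp [sumMap, transp, Nat.add_comm]

theorem isFun_crossWord : ∀ (w : List ℕ) (X : Comp), (∀ p ∈ w, p + 1 < X.length) →
    IsFun (k := k) (position w) (crossWord w X)
  | [], X, _ => isFun_id X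
  | p :: w, X, h => (isFun_crossAt p X (h p (by simp))).comp
      (isFun_crossWord w (swapAt p X) fun q hq => by
        rw [length_swapAt]; exact h q (by simp [hq]))

end Term

namespace ChickenFoot

variable {mu la : Comp} (D : ChickenFoot mu la)

theorem topVertex_eq (p : ℕ) :
    D.topVertex p = (Block.vertices 0 D.top).getD (position D.word p) 0 := by
  refine getD_applyWord_reverse 0 D.word _ (fun q hq => ?_) p
  rw [Block.length_vertices, ← D.word_eq, length_applyWord]
  exact D.word_lt q hq

variable {D} in
/-- In a reduced diagram, a string is determined by its two ends. -/
theorem IsReduced.injective (h : D.IsReduced) {p q : ℕ} (hp : p < D.numStrings)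
    (hq : q < D.numStrings) (hb : D.bottomVertex p = D.bottomVertex q)
    (ht : D.topVertex p = D.topVertex q) : p = q := by
  rcases lt_trichotomy p q with hlt | rfl | hlt
  · have := h p q hlt hq
    rw [if_pos hb, if_pos ht] at this
    omega
  · rfl
  · have := h q p hlt hp
    rw [if_pos hb.symm, if_pos ht.symm] at this
    omega

variable {D} in
/-- A chicken foot diagram splits its strings and then sends the parts to the top; if it is reduced,
the parts are determined by their two ends, and its value is a single basis element. -/
theorem IsReduced.eval_term {k : Type u} [CommRing k] (h : D.IsReduced) {A : Mat la mu}
    (hA : D.HasType A) : (D.term k).eval = SchurHom.xi A := by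
  have h1 := Term.isCofun_splits (k := k) D.bottom
  have h2 := Term.isFun_castHom (Term.isFun_crossWord (k := k) D.word _ D.word_lt) rfl D.word_eq
  have h3 := Term.isFun_merges (k := k) D.top
  obtain ⟨C, hC, hC'⟩ := h1.comp_isFun (h2.comp h3) (by
    intro p hp q hq hb ht
    refine h.injective hp hq hb ?_
    rw [topVertex_eq, topVertex_eq]
    exact ht)
  rw [term, Term.eval_castHom]
  refine (congrArg (castHom (H := SchurHom k) D.bottom_eq D.top_eq) hC').trans ?_
  rw [castHom_xi]
  refine congrArg SchurHom.xi (Mat.ext fun i j => ?_)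
  rw [castMat_apply, hC, hA, Finset.sum_range]
  refine Finset.sum_congr rfl fun p _ => ?_
  refine if_congr ?_ ?_ rfl
  · rw [topVertex_eq]
    exact Iff.rfl
  · rw [thickness, List.getD_eq_getElem _ _ (by rw [List.length_map]; exact p.2), List.getElem_map]
    rfl

end ChickenFoot

end SchurWeb

namespace SchurWeb

/-! ### Existence of reduced chicken foot diagrams -/

section sorting

theorem applyWord_map_succ {α : Type} : ∀ (w : List ℕ) (a : α) (l : List α),
    applyWord (w.map (· + 1)) (a :: l) = a :: applyWord w l
  | [], _, _ => rfl
  | _ :: w, a, _ => applyWord_map_succ w a _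

theorem crossings_map_succ : ∀ (w : List ℕ) (a : ℕ) (l : List ℕ),
    crossings (w.map (· + 1)) (a :: l) = crossings w l
  | [], _, _ => rfl
  | _ :: w, a, _ => congrArg (_ :: ·) (crossings_map_succ w a _)

theorem crossings_append : ∀ (w w' : List ℕ) (l : List ℕ),
    crossings (w ++ w') l = crossings w l ++ crossings w' (applyWord w l)
  | [], _, _ => rfl
  | _ :: w, w', _ => congrArg (_ :: ·) (crossings_append w w' _)

variable {β : Type} [LinearOrder β] (κ : ℕ → β)

/-- The entry `a` in front of a sorted list is moved to its place, passing each smaller entry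
once. -/
theorem exists_word_insert (a : ℕ) : ∀ (l : List ℕ), l.Pairwise (κ · < κ ·) →
    (∀ b ∈ l, κ a ≠ κ b) → ∃ w : List ℕ, (∀ p ∈ w, p < l.length) ∧
      (applyWord w (a :: l)).Pairwise (κ · < κ ·) ∧ (crossings w (a :: l)).Nodup ∧
      ∀ e ∈ crossings w (a :: l), ∃ b ∈ l, e = s(a, b) ∧ κ b < κ a
  | [], _, _ => ⟨[], by simp [applyWord, crossings]⟩
  | b :: l, hl, ha => by
    rcases lt_or_gt_of_ne (ha b (by simp)) with h | h
    · refine ⟨[], by simp, ?_, by simp [crossings], by simp [crossings]⟩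
      refine List.pairwise_cons.2 ⟨fun c hc => ?_, hl⟩
      rcases List.mem_cons.1 hc with rfl | hc
      · exact h
      · exact h.trans (List.rel_of_pairwise_cons hl hc)
    · obtain ⟨w, h1, h2, h3, h4⟩ := exists_word_insert a l (List.pairwise_cons.1 hl).2
        fun c hc => ha c (by simp [hc])
      have hc : crossings (0 :: w.map (· + 1)) (a :: b :: l) = s(a, b) :: crossings w (a :: l) :=
        congrArg (_ :: ·) (crossings_map_succ w b _)
      have hw : applyWord (0 :: w.map (· + 1)) (a :: b :: l) = b :: applyWord w (a :: l) :=
        applyWord_map_succ w b _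
      refine ⟨0 :: w.map (· + 1), ?_, ?_, ?_, ?_⟩
      · intro p hp
        simp only [List.mem_cons, List.mem_map] at hp
        rcases hp with rfl | ⟨q, hq, rfl⟩
        · simp
        · simpa using h1 q hq
      · rw [hw]
        refine List.pairwise_cons.2 ⟨fun c hc => ?_, h2⟩
        rw [(applyWord_perm w _).mem_iff, List.mem_cons] at hc
        rcases hc with rfl | hc
        · exact h
        · exact List.rel_of_pairwise_cons hl hc
      · rw [hc]
        refine List.nodup_cons.2 ⟨fun hmem => ?_, h3⟩
        obtain ⟨c, hc, he, -⟩ := h4 _ hmem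
        obtain rfl := Sym2.congr_right.1 he
        exact lt_irrefl _ (List.rel_of_pairwise_cons hl hc)
      · rw [hc]
        intro e he
        rcases List.mem_cons.1 he with rfl | he
        · exact ⟨b, by simp, rfl, h⟩
        · obtain ⟨c, hc, h5⟩ := h4 e he
          exact ⟨c, by simp [hc], h5⟩

/-- Insertion sort: adjacent transpositions sort a list so that any two entries are interchanged at
most once, and only if they are in the wrong order at the start. -/
theorem exists_word_sort : ∀ (l : List ℕ), l.Pairwise (κ · ≠ κ ·) →
    ∃ w : List ℕ, (∀ p ∈ w, p + 1 < l.length) ∧ (applyWord w l).Pairwise (κ · < κ ·) ∧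
      (crossings w l).Nodup ∧
      ∀ e ∈ crossings w l, ∃ a b, e = s(a, b) ∧ [a, b].Sublist l ∧ κ b < κ a
  | [], _ => ⟨[], by simp [applyWord, crossings]⟩
  | a :: l, hl => by
    obtain ⟨w, h1, h2, h3, h4⟩ := exists_word_sort l (List.pairwise_cons.1 hl).2
    have hmem : ∀ b, b ∈ applyWord w l ↔ b ∈ l := fun b => (applyWord_perm w l).mem_iff
    obtain ⟨w', h1', h2', h3', h4'⟩ := exists_word_insert κ a (applyWord w l) h2
      fun b hb => List.rel_of_pairwise_cons hl ((hmem b).1 hb)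
    have hc : crossings (w.map (· + 1) ++ w') (a :: l) =
        crossings w l ++ crossings w' (a :: applyWord w l) := by
      rw [crossings_append, crossings_map_succ, applyWord_map_succ]
    refine ⟨w.map (· + 1) ++ w', ?_, ?_, ?_, ?_⟩
    · intro p hp
      rcases List.mem_append.1 hp with hp | hp
      · obtain ⟨q, hq, rfl⟩ := List.mem_map.1 hp
        simpa using h1 q hq
      · have := h1' p hp
        rw [length_applyWord] at this
        simpa using this
    · rw [applyWord_append, applyWord_map_succ]
      exact h2'
    · rw [hc]
      refine List.nodup_append.2 ⟨h3, h3', ?_⟩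
      rintro e he _ he' rfl
      obtain ⟨b, c, rfl, hs, -⟩ := h4 e he
      obtain ⟨d, hd, he'', -⟩ := h4' _ he'
      have : a ∈ s(b, c) := he'' ▸ Sym2.mem_mk_left a d
      have hal : a ∈ l := by
        rcases Sym2.mem_iff.1 this with rfl | rfl
        · exact hs.subset (by simp)
        · exact hs.subset (by simp)
      exact List.rel_of_pairwise_cons hl hal rfl
    · rw [hc]
      intro e he
      rcases List.mem_append.1 he with he | he
      · obtain ⟨b, c, h5, h6, h7⟩ := h4 e he
        exact ⟨b, c, h5, h6.cons a, h7⟩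
      · obtain ⟨b, hb, h5, h6⟩ := h4' e he
        exact ⟨a, b, h5, (List.singleton_sublist.2 ((hmem b).1 hb)).cons_cons a, h6⟩

end sorting

namespace Block

/-- The block with the given strings; the value at the empty list is irrelevant. -/
def ofList : List ℕ+ → Block
  | [] => (1, [])
  | a :: l => (a, l)

variable (F : ℕ → List ℕ+)

theorem flat_map_ofList : ∀ (n m : ℕ), (∀ j, n ≤ j → j < n + m → F j ≠ []) →
    flat ((List.range' n m).map fun j => ofList (F j)) = (List.range' n m).flatMap F
  | _, 0, _ => rfl
  | n, m + 1, h => by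
    have ih := flat_map_ofList (n + 1) m fun j h1 h2 => h j (by omega) (by omega)
    rw [List.range'_succ, List.map_cons, List.flatMap_cons, ← ih]
    have := h n le_rfl (by omega)
    rcases hF : F n with _ | ⟨a, l⟩
    · exact absurd hF this
    · rfl

theorem vertices_map_ofList : ∀ (n m : ℕ), (∀ j, n ≤ j → j < n + m → F j ≠ []) →
    vertices n ((List.range' n m).map fun j => ofList (F j)) =
      (List.range' n m).flatMap fun j => (F j).map fun _ => j
  | _, 0, _ => rfl
  | n, m + 1, h => by
    have ih := vertices_map_ofList (n + 1) m fun j h1 h2 => h j (by omega) (by omega)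
    rw [List.range'_succ, List.map_cons, List.flatMap_cons, ← ih]
    have := h n le_rfl (by omega)
    rcases hF : F n with _ | ⟨a, l⟩
    · exact absurd hF this
    · simp [ofList, vertices, List.replicate_succ]

theorem total_coe : ∀ (a : ℕ+) (l : List ℕ+), (total a l : ℕ) = ((a :: l).map PNat.val).sum
  | a, [] => by simp [total]
  | a, b :: l => by
    rw [total, PNat.add_coe, total_coe b l]
    simp only [List.map_cons, List.sum_cons]

theorem totals_map_ofList (X : ℕ → ℕ+) : ∀ (n m : ℕ),
    (∀ j, n ≤ j → j < n + m → F j ≠ [] ∧ ((F j).map PNat.val).sum = X j) →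
    totals ((List.range' n m).map fun j => ofList (F j)) = (List.range' n m).map X
  | _, 0, _ => rfl
  | n, m + 1, h => by
    have ih := totals_map_ofList X (n + 1) m fun j h1 h2 => h j (by omega) (by omega)
    rw [List.range'_succ, List.map_cons, List.map_cons, ← ih]
    obtain ⟨h1, h2⟩ := h n le_rfl (by omega)
    rcases hF : F n with _ | ⟨a, l⟩
    · exact absurd hF h1
    · rw [hF, ← total_coe] at h2
      rw [← PNat.eq h2]
      rfl

end Block

section cells

variable (a : ℕ → ℕ → ℕ) (N M : ℕ)

/-- The positions of the nonzero entries of an `N` by `M` matrix, row by row. -/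
def cells : List (ℕ × ℕ) :=
  (List.range' 0 N).flatMap fun i => ((List.range M).filter (a i · ≠ 0)).map (Prod.mk i)

/-- The nonzero entries of a row, from left to right. -/
def rowParts (i : ℕ) : List ℕ+ := ((List.range M).filter (a i · ≠ 0)).map fun j => (a i j).toPNat'

/-- The blocks formed by the nonzero entries of the rows. -/
def rowBlocks : List Block := (List.range' 0 N).map fun i => Block.ofList (rowParts a M i)

theorem mem_cells {x : ℕ × ℕ} : x ∈ cells a N M ↔ x.1 < N ∧ x.2 < M ∧ a x.1 x.2 ≠ 0 := by
  obtain ⟨i, j⟩ := x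
  simp [cells]

theorem cells_pairwise : (cells a N M).Pairwise fun x y => toLex x < toLex y := by
  rw [cells, List.pairwise_flatMap]
  refine ⟨fun i _ => ?_, ?_⟩
  · rw [List.pairwise_map]
    refine (List.pairwise_lt_range.filter _).imp fun h => ?_
    exact Prod.Lex.toLex_lt_toLex.2 (.inr ⟨rfl, h⟩)
  · refine (List.pairwise_lt_range' (s := 0) (n := N) (step := 1)).imp fun h => ?_
    simp only [List.mem_map]
    rintro _ ⟨x, _, rfl⟩ _ ⟨y, _, rfl⟩
    exact Prod.Lex.toLex_lt_toLex.2 (.inl h)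

variable {a N M}

theorem sum_rowParts (i : ℕ) :
    ((rowParts a M i).map PNat.val).sum = ∑ j ∈ Finset.range M, a i j := by
  induction M with
  | zero => rfl
  | succ M ih =>
    rw [Finset.sum_range_succ, ← ih, rowParts, rowParts, List.range_succ, List.filter_append,
      List.map_append, List.map_append, List.sum_append]
    congr 1
    by_cases h : a i M = 0
    · simp [h]
    · simp [h, Nat.pos_of_ne_zero h]

variable {X : ℕ → ℕ+} (h : ∀ i < N, ∑ j ∈ Finset.range M, a i j = X i)

include h

theorem rowParts_ne_nil {i : ℕ} (hi : i < N) : rowParts a M i ≠ [] := by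
  intro h0
  have := sum_rowParts (a := a) (M := M) i
  rw [h0, h i hi] at this
  exact (X i).pos.ne this

theorem totals_rowBlocks : Block.totals (rowBlocks a N M) = (List.range N).map X := by
  rw [rowBlocks, Block.totals_map_ofList _ X, List.range_eq_range']
  intro i _ hi
  rw [Nat.zero_add] at hi
  exact ⟨rowParts_ne_nil h hi, (sum_rowParts i).trans (h i hi)⟩

theorem flat_rowBlocks :
    Block.flat (rowBlocks a N M) = (cells a N M).map fun x => (a x.1 x.2).toPNat' := by
  rw [rowBlocks, Block.flat_map_ofList, cells, List.map_flatMap]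
  · refine congrArg (List.flatMap · _) (funext fun i => ?_)
    rw [rowParts, List.map_map]
    rfl
  · intro i _ hi
    exact rowParts_ne_nil h (by omega)

theorem vertices_rowBlocks : Block.vertices 0 (rowBlocks a N M) = (cells a N M).map Prod.fst := by
  rw [rowBlocks, Block.vertices_map_ofList, cells, List.map_flatMap]
  · refine congrArg (List.flatMap · _) (funext fun i => ?_)
    rw [rowParts, List.map_map, List.map_map]
    rfl
  · intro i _ hi
    exact rowParts_ne_nil h (by omega)

end cells

/-- The strings of the diagram are the nonzero entries of the matrix, listed column by column at the
bottom and row by row at the top. Insertion sort lets two strings cross at most once, and not at all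
if they lie in the same row or in the same column, as then the two orders agree. -/
theorem exists_reduced {la mu : Comp} (A : Mat la mu) :
    ∃ D : ChickenFoot mu la, D.IsReduced ∧ D.HasType A := by
  -- The matrix extended by zero, so that its indices are natural numbers.
  let a : ℕ → ℕ → ℕ := fun i j =>
    if h : i < la.length ∧ j < mu.length then A.val ⟨i, h.1⟩ ⟨j, h.2⟩ else 0
  have ha : ∀ (i : Fin la.length) (j : Fin mu.length), a i j = A.val i j := fun i j =>
    dif_pos ⟨i.2, j.2⟩
  have hrow : ∀ i < la.length, ∑ j ∈ Finset.range mu.length, a i j = la.getD i 1 := by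
    intro i hi
    rw [Finset.sum_range, List.getD_eq_getElem _ _ hi]
    exact (Finset.sum_congr rfl fun j _ => ha ⟨i, hi⟩ j).trans (A.row_sum ⟨i, hi⟩)
  have hcol : ∀ j < mu.length, ∑ i ∈ Finset.range la.length, (flip a) j i = mu.getD j 1 := by
    intro j hj
    rw [Finset.sum_range, List.getD_eq_getElem _ _ hj]
    exact (Finset.sum_congr rfl fun i _ => ha i ⟨j, hj⟩).trans (A.col_sum ⟨j, hj⟩)
  have hget : ∀ X : Comp, (List.range X.length).map (fun i => X.getD i 1) = X := fun X =>
    List.ext_getElem (by simp) fun i h1 h2 => by simp [h2]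
  -- `T` lists the cells of the nonzero entries row by row, `E` column by column; `e p` is the cell
  -- of the string that starts at the position `p`.
  let T := cells a la.length mu.length
  let E := (cells (flip a) mu.length la.length).map Prod.swap
  let e : ℕ → ℕ × ℕ := fun p => E.getD p (0, 0)
  have hE : (List.range E.length).map e = E :=
    List.ext_getElem (by simp) fun i h1 h2 => by simp [e, h2]
  have hE1 : E.Pairwise fun x y => toLex x.swap < toLex y.swap := by
    rw [List.pairwise_map]
    exact cells_pairwise _ _ _
  have hEmem : ∀ x, x ∈ E ↔ x.1 < la.length ∧ x.2 < mu.length ∧ a x.1 x.2 ≠ 0 := by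
    rintro ⟨i, j⟩
    have : (i, j) ∈ E ↔ (j, i) ∈ cells (flip a) mu.length la.length := by
      simp only [E, List.mem_map]
      constructor
      · rintro ⟨⟨x, y⟩, hx, hxy⟩
        simp only [Prod.swap_prod_mk, Prod.mk.injEq] at hxy
        rwa [← hxy.1, ← hxy.2]
      · exact fun h => ⟨_, h, rfl⟩
    rw [this, mem_cells]
    simp only [flip]
    tauto
  have hEnd : E.Nodup := hE1.imp fun hlt heq => by rw [heq] at hlt; exact lt_irrefl _ hlt
  have hTnd : T.Nodup := (cells_pairwise a _ _).imp fun hlt heq => by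
    rw [heq] at hlt; exact lt_irrefl _ hlt
  obtain ⟨w, hw1, hw2, hw3, hw4⟩ := exists_word_sort (fun p => toLex (e p)) (List.range E.length)
    (by
      have := hEnd
      rw [← hE, List.Nodup, List.pairwise_map] at this
      exact this.imp fun h h' => h (toLex.injective h'))
  have hT : applyWord w E = T := by
    have h1 : (applyWord w E).Pairwise fun x y => toLex x < toLex y := by
      rw [← hE, applyWord_map, List.pairwise_map]
      exact hw2
    have h2 : (applyWord w E).Perm T := (applyWord_perm w E).trans
      ((List.perm_ext_iff_of_nodup hEnd hTnd).2 fun x => by rw [hEmem, mem_cells])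
    exact h2.eq_of_pairwise (fun x y _ _ h h' => absurd h (lt_asymm h')) h1 (cells_pairwise a _ _)
  have hflat : Block.flat (rowBlocks (flip a) mu.length la.length) =
      E.map fun x => (a x.1 x.2).toPNat' := by
    rw [flat_rowBlocks hcol, List.map_map]
    rfl
  have hbv : Block.vertices 0 (rowBlocks (flip a) mu.length la.length) = E.map Prod.snd := by
    rw [vertices_rowBlocks hcol, List.map_map]
    rfl
  have htv : applyWord w.reverse (Block.vertices 0 (rowBlocks a la.length mu.length)) =
      E.map Prod.fst := by
    rw [vertices_rowBlocks hrow]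
    change applyWord w.reverse (T.map Prod.fst) = _
    rw [← hT, ← applyWord_map, applyWord_reverse_applyWord]
  let D : ChickenFoot mu la :=
    { bottom := rowBlocks (flip a) mu.length la.length
      word := w
      top := rowBlocks a la.length mu.length
      bottom_eq := (totals_rowBlocks hcol).trans (hget mu)
      top_eq := (totals_rowBlocks hrow).trans (hget la)
      word_lt := fun p hp => by simpa [hflat] using hw1 p hp
      word_eq := by
        rw [hflat, flat_rowBlocks hrow, applyWord_map, hT] }
  have hn : D.numStrings = E.length := by
    change (Block.flat (rowBlocks (flip a) mu.length la.length)).length = _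
    rw [hflat, List.length_map]
  have hgetE : ∀ (f : ℕ × ℕ → ℕ), ∀ p < E.length, (E.map f).getD p 0 = f (e p) := by
    intro f p hp
    simp [e, hp]
  have hb : ∀ p < E.length, D.bottomVertex p = (e p).2 := fun p hp =>
    (congrArg (List.getD · p 0) hbv).trans (hgetE _ p hp)
  have ht : ∀ p < E.length, D.topVertex p = (e p).1 := fun p hp =>
    (congrArg (List.getD · p 0) htv).trans (hgetE _ p hp)
  have hemem : ∀ p < E.length, e p ∈ E := fun p hp => by simp [e, hp]
  have hth : ∀ p < E.length, D.thickness p = a (e p).1 (e p).2 := by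
    intro p hp
    have h0 := ((hEmem _).1 (hemem p hp)).2.2
    refine (congrArg (fun l => (List.map PNat.val l).getD p 0) hflat).trans ?_
    simp only [List.map_map]
    rw [hgetE _ p hp]
    exact (Nat.toPNat'_coe _).trans (if_pos (Nat.pos_of_ne_zero h0))
  refine ⟨D, fun p q hpq hq => ?_, fun i j => ?_⟩
  · rw [hn] at hq
    have hlt : toLex (e p).swap < toLex (e q).swap := by
      have := hE1
      rw [← hE, List.pairwise_map] at this
      have := List.pairwise_iff_getElem.1 this p q (by simp; omega) (by simpa using hq) hpq
      simpa using this
    have hlt' := Prod.Lex.toLex_lt_toLex.1 hlt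
    rw [hb p (by omega), hb q hq, ht p (by omega), ht q hq]
    have hc1 : D.numCrossings p q ≤ 1 := by
      rw [ChickenFoot.numCrossings, hn]
      exact List.nodup_iff_count_le_one.1 hw3 _
    have hc2 : D.numCrossings p q ≠ 0 → toLex (e q) < toLex (e p) := by
      intro hne
      rw [ChickenFoot.numCrossings, hn] at hne
      obtain ⟨x, y, hxy, hsub, hlt⟩ := hw4 _ (List.count_pos_iff.1 (Nat.pos_of_ne_zero hne))
      have hxy' : x < y := List.rel_of_pairwise_cons (List.pairwise_lt_range.sublist hsub) (by simp)
      rcases Sym2.eq_iff.1 hxy with ⟨rfl, rfl⟩ | ⟨rfl, rfl⟩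
      · exact hlt
      · omega
    simp only [Prod.Lex.toLex_lt_toLex] at hc2
    simp only [Prod.fst_swap, Prod.snd_swap] at hlt'
    by_cases hc : D.numCrossings p q = 0
    · split_ifs <;> omega
    · have := hc2 hc
      split_ifs <;> omega
  · rw [hn, ← ha]
    have h1 : ∀ p ∈ Finset.range E.length,
        (if D.topVertex p = i.val ∧ D.bottomVertex p = j.val then D.thickness p else 0) =
          if e p = (i.val, j.val) then a i j else 0 := by
      intro p hp
      rw [Finset.mem_range] at hp
      rw [hb p hp, ht p hp, hth p hp]
      by_cases h : e p = (i.val, j.val)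
      · rw [h, if_pos ⟨rfl, rfl⟩, if_pos rfl]
      · rw [if_neg h, if_neg fun h' => h (Prod.ext h'.1 h'.2)]
    rw [Finset.sum_congr rfl h1]
    by_cases h : a i j = 0
    · simp [h]
    · obtain ⟨p, hp, hpe⟩ := List.getElem_of_mem ((hEmem (i.val, j.val)).2 ⟨i.2, j.2, h⟩)
      have hp' : e p = (i.val, j.val) := by simp [e, hp, hpe]
      rw [Finset.sum_eq_single p, if_pos hp']
      · intro q hq hne
        rw [Finset.mem_range] at hq
        refine if_neg fun hq' => hne ((hEnd.getElem_inj_iff (hi := hq) (hj := hp)).1 ?_)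
        rw [hpe, ← hq']
        simp [e, hq]
      · intro hnp
        exact absurd (Finset.mem_range.2 hp) hnp

end SchurWeb

namespace SchurWeb

/-! ### The isomorphism -/

open SchurHom

section functor

variable (k : Type u)

/-- Evaluation in the Schur category, on morphisms of the web category. -/
noncomputable def evalLin [CommRing k] (X Y : Comp) : (webCat k).Hom X Y →ₗ[k] SchurHom k X Y where
  toFun := Quotient.lift Term.eval fun _ _ h => Term.eval_eq h
  map_add' f g := by
    induction f using WebHom.ind with | h f => induction g using WebHom.ind with
    | h g => rfl
  map_smul' r f := by induction f using WebHom.ind with | h f => rfl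

/-- Every basis element is the value of a reduced chicken foot diagram. -/
theorem evalLin_surjective [CommRing k] (X Y : Comp) : Function.Surjective (evalLin k X Y) := by
  rw [← LinearMap.range_eq_top, eq_top_iff]
  intro f _
  induction f using SchurHom.induction_xi with
  | h0 => exact zero_mem _
  | hadd f g hf hg => exact add_mem (hf trivial) (hg trivial)
  | hsmul r f hf => exact Submodule.smul_mem _ r (hf trivial)
  | hxi A =>
    obtain ⟨D, hD, hA⟩ := exists_reduced A
    exact ⟨(D.term k).cls, hD.eval_term hA⟩

/-- The source is spanned by as many elements as the target has basis elements, so the surjection is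
bijective. -/
theorem evalLin_bijective [Field k] (X Y : Comp) : Function.Bijective (evalLin k X Y) := by
  refine ⟨?_, evalLin_surjective k X Y⟩
  obtain ⟨_, h⟩ := WebHom.finrank_le k Y X
  refine (LinearMap.injective_iff_surjective_of_finrank_eq_finrank (le_antisymm ?_ ?_)).2
    (evalLin_surjective k X Y)
  · rw [Module.finrank_finsupp_self]
    exact h
  · exact LinearMap.finrank_le_finrank_of_surjective (evalLin_surjective k X Y)

/-- Evaluation as a linear equivalence of morphism spaces. -/
noncomputable def evalEquiv [Field k] (X Y : Comp) : (webCat k).Hom X Y ≃ₗ[k] SchurHom k X Y :=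
  LinearEquiv.ofBijective (evalLin k X Y) (evalLin_bijective k X Y)

/-- The inverse of evaluation. -/
noncomputable def evalInv [Field k] (X Y : Comp) (f : SchurHom k X Y) : (webCat k).Hom X Y :=
  (evalEquiv k X Y).symm f

theorem evalLin_evalInv [Field k] (X Y : Comp) (f : SchurHom k X Y) :
    evalLin k X Y (evalInv k X Y f) = f := (evalEquiv k X Y).apply_symm_apply f

theorem evalInv_eq [Field k] {X Y : Comp} {f : SchurHom k X Y} {g : (webCat k).Hom X Y}
    (h : f = evalLin k X Y g) : evalInv k X Y f = g := (evalEquiv k X Y).symm_apply_eq.2 h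

theorem evalLin_add [CommRing k] {X Y : Comp} (f g : (webCat k).Hom X Y) :
    evalLin k X Y (f + g) = evalLin k X Y f + evalLin k X Y g := map_add _ f g

theorem evalLin_smul [CommRing k] {X Y : Comp} (r : k) (f : (webCat k).Hom X Y) :
    evalLin k X Y (r • f) = r • evalLin k X Y f := map_smul _ r f

theorem eq_eqToHom_comp_eqToHom {C : Type*} [Category* C] {X Y : C} (f : X ⟶ Y) (hX : X = X)
    (hY : Y = Y) : f = eqToHom hX ≫ f ≫ eqToHom hY := by
  rw [eqToHom_refl, eqToHom_refl, Category.id_comp, Category.comp_id]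

/-- The evaluation functor, which is the identity on objects. -/
noncomputable def webToSchur [CommRing k] : Web k ⥤ Schur k where
  obj X := X
  map {X Y} f := evalLin k X Y f
  map_id _ := rfl
  map_comp {X Y Z} f g := by
    induction f using WebHom.ind with | h f => induction g using WebHom.ind with
    | h g => rfl

/-- The inverse of the evaluation functor. -/
noncomputable def schurToWeb [Field k] : Schur k ⥤ Web k where
  obj X := X
  map {X Y} f := evalInv k X Y f
  map_id X := evalInv_eq k ((webToSchur k).map_id X).symm
  map_comp {X Y Z} f g := evalInv_eq k <|
    Eq.trans (congrArg₂ SchurHom.comp (evalLin_evalInv k X Y f).symm (evalLin_evalInv k Y Z g).symm)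
      ((webToSchur k).map_comp (X := X) (Y := Y) (Z := Z) (evalInv k X Y f) (evalInv k Y Z g)).symm

theorem isStrictMonoidalIso_webToSchur [Field k] : IsStrictMonoidalIso k (webToSchur k) where
  strictMonoidal :=
    { obj_unit := rfl
      obj_tensor := fun _ _ => rfl
      map_tensor := fun {X Y X' Y'} f f' => by
        refine Eq.trans ?_ (eq_eqToHom_comp_eqToHom _ rfl rfl)
        induction f using WebHom.ind with | h f => induction f' using WebHom.ind with
        | h f' => rfl }
  additive := ⟨fun {X Y f g} => evalLin_add k f g⟩
  linear := ⟨fun {X Y} f r => evalLin_smul k r f⟩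
  exists_inverse := ⟨schurToWeb k,
    CategoryTheory.Functor.ext (fun _ => rfl) fun X Y f =>
      (evalInv_eq k (X := X) (Y := Y) rfl).trans (eq_eqToHom_comp_eqToHom _ rfl rfl),
    CategoryTheory.Functor.ext (fun _ => rfl) fun X Y f =>
      (evalLin_evalInv k X Y f).trans (eq_eqToHom_comp_eqToHom _ rfl rfl)⟩

end functor

end SchurWeb

theorem mainTheorem6 (k : Type u) [Field k] [IsAlgClosed k] :
    -- every matrix is the type of some reduced chicken foot diagram
    (∀ (la mu : Comp) (A : SchurWeb.Mat la mu), ∃ D : ChickenFoot mu la, D.IsReduced ∧ D.HasType A) ∧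
    ∃ F : Web k ⥤ Schur k,
      IsStrictMonoidalIso k F ∧
      -- `F` is the identity on objects
      ∃ hF : ∀ X : Comp, F.obj ((webCat k).of X) = (schurCat k).of X,
        -- `F` sends each reduced chicken foot diagram of type `A` to `ξ_A`
        (∀ (la mu : Comp) (A : SchurWeb.Mat la mu) (D : ChickenFoot mu la), D.IsReduced → D.HasType A →
          F.map (D.toWeb k) = eqToHom (hF mu) ≫ xi k A ≫ eqToHom (hF la).symm) ∧
        ∀ a b : ℕ+,
          F.map (Term.merge a b).toWeb =
            eqToHom (hF _) ≫ xi k (mergeMat a b) ≫ eqToHom (hF _).symm ∧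
          F.map (Term.split a b).toWeb =
            eqToHom (hF _) ≫ xi k (splitMat a b) ≫ eqToHom (hF _).symm ∧
          F.map (Term.cross a b).toWeb =
            eqToHom (hF _) ≫ xi k (crossMat a b) ≫ eqToHom (hF _).symm := by
  refine ⟨fun la mu A => exists_reduced A, webToSchur k, isStrictMonoidalIso_webToSchur k,
    fun _ => rfl, fun la mu A D hD hA => ?_, fun a b => ⟨?_, ?_, ?_⟩⟩
  · exact Eq.trans (hD.eval_term hA) (eq_eqToHom_comp_eqToHom (C := Schur k) (xi k A) rfl rfl)
  · exact eq_eqToHom_comp_eqToHom (C := Schur k) (xi k (mergeMat a b)) rfl rfl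
  · exact eq_eqToHom_comp_eqToHom (C := Schur k) (xi k (splitMat a b)) rfl rfl
  · exact eq_eqToHom_comp_eqToHom (C := Schur k) (xi k (crossMat a b)) rfl rfl
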